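/- **Setting.** For each value $n$ of the security parameter let $p=p(n)$ be a prime such that $1/p(n)$ is negligible in $n$, let $m=m(n)>3\log_2 p$, and let $t=t(n)\ge 0$. In the generic asymmetric bilinear group model, $\psi_1,\psi_2,\psi_T:\mathbb F_p\to\{0,1\}^m$ are independent uniformly random injections, $\mathbb G_1,\mathbb G_2,\mathbb G_T$ are their ranges with the group structure of $(\mathbb F_p,+)$, and $g_i^a=\psi_i(a)$. There are oracles for multiplication and exponentiation in each group, for the pairing $e:\mathbb G_1\times\mathbb G_2\to\mathbb G_T$, $e(\psi_1(a),\psi_2(b))=\psi_T(ab)$, for the isomorphism $\phi:\mathbb G_2\to\mathbb G_1$, $\psi_2(a)\mapsto\psi_1(a)$ (but none from $\mathbb G_1$ to $\mathbb G_2$), and for a random function $H:\{0,1\}^*\to\mathbb G_2$. Attributes are bit strings; user identities are nonzero elements of $\mathbb Z_p$. Access structures are trees with attributes at the leaves and $k$-of-$l$ threshold gates, $1\le k\le l$, at the inner nodes. **Construction (PIRATTE, complete key revocation).** - *Setup*: $\alpha\in\mathbb Z_p$, $\beta\in\mathbb Z_p^*$ and the $t+1$ coefficients of a polynomial $P$ over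 $\mathbb Z_p$ are uniformly random; $PK=(g_1,g_2,h=g_1^\beta,e(g_1,g_2)^\alpha,f=g_2^{1/\beta})$ (where $f$ is the component that allows delegation), $MK=(\beta,g_2^\alpha,P)$. - *Encrypt*$(PK,M,\tau)$: a random $s\in\mathbb Z_p$ is shared down the tree $\tau$: each node $x$ has a polynomial $q_x$, random of degree at most $k_x-1$ for a gate with threshold $k_x$ and constant for a leaf, with $q_{root}(0)=s$ and $q_z(0)=q_x(i)$ for the $i$-th child $z$ of $x$. The ciphertext is $\tilde C=M e(g_1,g_2)^{\alpha s}$, $C=h^s$ and, for each leaf $y$, $C_y=g_1^{q_y(0)}$, $C'_y=H(att(y))^{q_y(0)}$. - *KeyGen*$(MK,S)$ for user $u$: with random $r,r_j\in\mathbb Z_p$, $D=g_2^{(\alpha+r)/\beta}$ and, for $j\in S$, $D_j=g_2^rH(j)^{r_jP(0)}$, $D_j'=g_1^{r_j}$, $D_j''=g_1^{r_jP(u)}$. - *ProxyRekey*$(PK,MK,RL)$, $|RL|\le t$: $PXK$ consists of $(u_i,P(u_i))$ for all $u_i\in RL$, filled up to $t$ pairs with $(x,P(x))$ at random nonzero points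 $x$ that are distinct, outside $RL$ and not identities of users to whom keys have been issued. - *Convert*$(PXK,(C_1',\dots,C_l'),u)$, for $C_i'\in\mathbb G_2$ and $u$ not a point of $PXK$: returns $(C_i')^{\sum_j\lambda_jP(u_j)}$ for each $i$, and $\lambda_u$, where $\lambda_j=\frac{u}{u-u_j}\prod_{i\ne j}\frac{u_i}{u_i-u_j}$ and $\lambda_u=\prod_i\frac{u_i}{u_i-u}$. **Game.** The challenger runs Setup, gives $PK$ to the adversary and runs ProxyRekey$(PK,MK,\emptyset)$. In Phase 1 the adversary adaptively obtains secret keys for users $u_k$ with attribute sets $S_k$, calls Convert with the stored $PXK$, and calls ProxyRekey with lists of its choice, which replaces the stored $PXK$. In the Challenge it submits $M_0,M_1\in\mathbb G_T$, a tree $\mathbb A^*$ and a list $RL^*$, $|RL^*|\le t$, such that for every issued key $u_k\in RL^*$ or $S_k$ does not satisfy $\mathbb A^*$; for a uniform bit $b$ it receives the encryption of $M_b$ under $\mathbb A^*$ and the new proxy key ProxyRekey$(PK,MK,RL^*)$. In Phase 2 it may obtain further keys, subject to the same condition. Queries that violate the rules, or that contain strings outside the required group, are refused; a rekeying or a challenge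 for which too few points are left to fill up the proxy key is refused as well. The group, pairing, isomorphism and hash oracles are available throughout. Finally it outputs $b'$; its advantage is $\Pr[b'=b]-\frac12$. **Theorem 1.** The construction is secure in the generic asymmetric bilinear group model: every polynomial-time adversary has negligible advantage in this game. This holds even for every computationally unbounded, non-uniform, randomized adversary for which the total cost of its queries and coin flips is bounded by a polynomial in $n$, where a query costs one plus the number of items it lists (attributes of a key query, strings of a Convert query, identities of a revocation list, nodes of the challenge tree). -/

import Mathlib

namespace Piratte

/-! ### Parameters, groups and encodings -/

/-- Attributes are arbitrary bit strings. -/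
abbrev Attr : Type := List Bool

/-- The parameters at one value of the security parameter: the prime group order `p`, the length
`m` of the encodings, with `m > 3 log₂ p`, and the maximal number `t` of simultaneously revoked
users. -/
structure Params where
  p : ℕ
  m : ℕ
  t : ℕ
  prime : p.Prime
  len : p ^ 3 < 2 ^ m

instance (pp : Params) : Fact pp.p.Prime := ⟨pp.prime⟩

/-- The field of exponents. -/
abbrev Scalar (pp : Params) : Type := ZMod pp.p

/-- User identities are the nonzero elements of `ℤ/p` (the secret is the share at `0`). -/
abbrev Identity (pp : Params) : Type := (ZMod pp.p)ˣ

/-- Encodings of group elements are bit strings of length `m`. -/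
abbrev Str (pp : Params) : Type := Fin pp.m → Bool

/-- Names of the three groups of the pairing `G1 × G2 → GT`. -/
inductive Grp : Type
  | G1
  | G2
  | GT

/-- The three injective encodings `ψ₁, ψ₂, ψ_T` of the additive group `ℤ/p`. The element `gᵢ ^ a`
of the `i`-th group is the string `ψᵢ a`. -/
structure Encoding (pp : Params) where
  ψ : Grp → Scalar pp ↪ Str pp

namespace Encoding

/-- The discrete logarithm of a string, if the string belongs to the `i`-th group. -/
noncomputable def log {pp : Params} (E : Encoding pp) (i : Grp) (x : Str pp) :
    Option (Scalar pp) :=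
  Function.partialInv (E.ψ i) x

/-- There is an injective encoding, because `p ≤ 2 ^ m`. -/
theorem nonempty_embedding (pp : Params) : Nonempty (Scalar pp ↪ Str pp) := by
  apply Function.Embedding.nonempty_of_card_le
  have h : pp.p ≤ pp.p ^ 3 := Nat.le_self_pow (by norm_num) _
  simpa [ZMod.card] using h.trans pp.len.le

instance (pp : Params) : Nonempty (Scalar pp ↪ Str pp) := nonempty_embedding pp

end Encoding

/-- Three independent uniformly random injective encodings. -/
noncomputable def randomEncoding (pp : Params) : PMF (Encoding pp) := do
  let ψ₁ ← PMF.uniformOfFintype (Scalar pp ↪ Str pp)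
  let ψ₂ ← PMF.uniformOfFintype (Scalar pp ↪ Str pp)
  let ψT ← PMF.uniformOfFintype (Scalar pp ↪ Str pp)
  pure ⟨fun i => match i with
    | .G1 => ψ₁
    | .G2 => ψ₂
    | .GT => ψT⟩

/-! ### Access trees -/

/-- Access trees: attributes at the leaves, `k`-of-`n` threshold gates at the inner nodes. -/
inductive AccessTree : Type
  | leaf (a : Attr) : AccessTree
  | gate (k n : ℕ) (hk : 1 ≤ k) (hn : k ≤ n) (child : Fin n → AccessTree) : AccessTree

namespace AccessTree

/-- The number of nodes. -/
def size : AccessTree → ℕ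
  | leaf _ => 1
  | gate _ _ _ _ c => 1 + ∑ i, (c i).size

/-- The attribute set `S` satisfies the tree. -/
def Satisfies (S : Finset Attr) : AccessTree → Prop
  | leaf a => a ∈ S
  | gate k n _ _ c => ∃ U : Finset (Fin n), k ≤ U.card ∧ ∀ i ∈ U, (c i).Satisfies S

/-- The leaf nodes of the tree. -/
def Leaf : AccessTree → Type
  | leaf _ => Unit
  | gate _ n _ _ c => Σ i : Fin n, (c i).Leaf

/-- The attribute at a leaf node. -/
def att : (T : AccessTree) → T.Leaf → Attr
  | leaf a, _ => a
  | gate _ _ _ _ c, ⟨i, y⟩ => (c i).att y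

/-- The set of attributes that occur in the tree. -/
def attrs : AccessTree → Finset Attr
  | leaf a => {a}
  | gate _ _ _ _ c => Finset.univ.biUnion fun i => (c i).attrs

/-- The coins of the secret sharing: for each gate with threshold `k`, the `k - 1` nonconstant
coefficients of its polynomial. -/
def Coeffs (F : Type) : AccessTree → Type
  | leaf _ => Unit
  | gate k n _ _ c => (Fin (k - 1) → F) × ((i : Fin n) → (c i).Coeffs F)

noncomputable instance Coeffs.fintype (F : Type) [Fintype F] :
    (T : AccessTree) → Fintype (T.Coeffs F)
  | leaf _ => inferInstanceAs (Fintype Unit)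
  | gate k n _ _ c =>
    letI : ∀ i, Fintype ((c i).Coeffs F) := fun i => Coeffs.fintype F (c i)
    inferInstanceAs (Fintype ((Fin (k - 1) → F) × ((i : Fin n) → (c i).Coeffs F)))

instance Coeffs.nonempty (F : Type) [Nonempty F] :
    (T : AccessTree) → Nonempty (T.Coeffs F)
  | leaf _ => inferInstanceAs (Nonempty Unit)
  | gate k n _ _ c =>
    letI : ∀ i, Nonempty ((c i).Coeffs F) := fun i => Coeffs.nonempty F (c i)
    inferInstanceAs (Nonempty ((Fin (k - 1) → F) × ((i : Fin n) → (c i).Coeffs F)))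

/-- Top-down sharing of the secret `s`: the polynomial `q` of a gate has degree at most `k - 1` and
constant term the value at that gate; the child of index `1, …, n` gets the value of `q` at its
index. The result is `q_y(0)` for each leaf `y`. -/
def share {F : Type} [CommSemiring F] : (T : AccessTree) → T.Coeffs F → F → T.Leaf → F
  | leaf _, _, s, _ => s
  | gate _ _ _ _ c, (a, d), s, ⟨i, y⟩ =>
    (c i).share (d i) (s + ∑ j, a j * (((i : ℕ) + 1 : ℕ) : F) ^ ((j : ℕ) + 1)) y

end AccessTree

/-! ### The scheme

A group element is written through its exponent and published through its encoding. -/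

/-- The public key `g₁, g₂, h = g₁ ^ β, e(g₁, g₂) ^ α`, together with the component
`f = g₂ ^ (1 / β)` that is published to support delegation. -/
structure PublicKey (pp : Params) where
  g₁ : Str pp
  g₂ : Str pp
  h : Str pp
  eα : Str pp
  f : Str pp

/-- The master key; `P` lists the coefficients of a polynomial of degree at most `t`. -/
structure MasterKey (pp : Params) where
  α : Scalar pp
  β : (ZMod pp.p)ˣ
  P : Fin (pp.t + 1) → Scalar pp

/-- The value of the revocation polynomial. -/
def MasterKey.evalP {pp : Params} (mk : MasterKey pp) (x : Scalar pp) : Scalar pp :=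
  ∑ i, mk.P i * x ^ (i : ℕ)

/-- A secret key for the attribute set `S`. -/
structure SecretKey (pp : Params) (S : Finset Attr) where
  D : Str pp
  Dj : S → Str pp
  Dj' : S → Str pp
  Dj'' : S → Str pp

/-- A ciphertext under the access tree `T`. -/
structure Ciphertext (pp : Params) (T : AccessTree) where
  Ct : Str pp
  C : Str pp
  Cy : T.Leaf → Str pp
  Cy' : T.Leaf → Str pp

/-- A proxy key: a set of pairs `(u, P(u))`. -/
abbrev ProxyKey (pp : Params) : Type := Finset (Identity pp × Scalar pp)

/-- The part of the random oracle `H` that has been determined so far; the value at `a` is the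
discrete logarithm `h_a` of `H(a)` to the base `g₂`. -/
abbrev HashTable (pp : Params) : Type := Attr → Option (Scalar pp)

/-- Determine the random oracle at all attributes of `S`: the values that are not yet there are
drawn uniformly and independently. -/
noncomputable def hashExtend {pp : Params} (H : HashTable pp) (S : Finset Attr) :
    PMF (HashTable pp) := do
  let v ← PMF.uniformOfFintype (S → Scalar pp)
  pure fun a => match H a with
    | some x => some x
    | none => if ha : a ∈ S then some (v ⟨a, ha⟩) else none

/-- The logarithm of `H(a)`, for an attribute at which `H` has been determined. -/
def hashVal {pp : Params} (H : HashTable pp) (a : Attr) : Scalar pp := (H a).getD 0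

/-- Setup. -/
noncomputable def setup (pp : Params) (E : Encoding pp) : PMF (PublicKey pp × MasterKey pp) := do
  let α ← PMF.uniformOfFintype (Scalar pp)
  let β ← PMF.uniformOfFintype (ZMod pp.p)ˣ
  let P ← PMF.uniformOfFintype (Fin (pp.t + 1) → Scalar pp)
  pure (⟨E.ψ .G1 1, E.ψ .G2 1, E.ψ .G1 (β : Scalar pp), E.ψ .GT α,
    E.ψ .G2 (β : Scalar pp)⁻¹⟩, ⟨α, β, P⟩)

/-- Key generation for the user `u` and the attribute set `S`; the hash table has to be determined
on `S`. -/
noncomputable def keyGen {pp : Params} (E : Encoding pp) (mk : MasterKey pp) (H : HashTable pp)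
    (u : Identity pp) (S : Finset Attr) : PMF (SecretKey pp S) := do
  let r ← PMF.uniformOfFintype (Scalar pp)
  let ρ ← PMF.uniformOfFintype (S → Scalar pp)
  pure
    { D := E.ψ .G2 ((mk.α + r) / (mk.β : Scalar pp))
      Dj := fun j => E.ψ .G2 (r + hashVal H j * ρ j * mk.evalP 0)
      Dj' := fun j => E.ψ .G1 (ρ j)
      Dj'' := fun j => E.ψ .G1 (ρ j * mk.evalP u) }

/-- Encryption of the element of `GT` with logarithm `μ`; the hash table has to be determined on
the attributes of `T`. The exponents `α` and `β` enter only through the powers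
`(e(g₁, g₂) ^ α) ^ s` and `h ^ s` of elements of the public key. -/
noncomputable def encrypt {pp : Params} (E : Encoding pp) (mk : MasterKey pp) (H : HashTable pp)
    (μ : Scalar pp) (T : AccessTree) : PMF (Ciphertext pp T) := do
  let s ← PMF.uniformOfFintype (Scalar pp)
  let q ← PMF.uniformOfFintype (T.Coeffs (Scalar pp))
  pure
    { Ct := E.ψ .GT (μ + mk.α * s)
      C := E.ψ .G1 ((mk.β : Scalar pp) * s)
      Cy := fun y => E.ψ .G1 (T.share q s y)
      Cy' := fun y => E.ψ .G2 (hashVal H (T.att y) * T.share q s y) }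

open Classical in
/-- The proxy key for the revocation list `RL`: the pairs `(u, P(u))` for `u` in `RL`, filled up to
length `t` with uniformly random other points that are not identities of actual users. The result
is `none` if `RL` has more than `t` elements or too few points are left. -/
noncomputable def proxyRekey {pp : Params} (mk : MasterKey pp) (users RL : Finset (Identity pp)) :
    PMF (Option (ProxyKey pp)) :=
  if hF : RL.card ≤ pp.t ∧
      ((Finset.univ \ (users ∪ RL)).powersetCard (pp.t - RL.card)).Nonempty then do
    let X ← PMF.uniformOfFinset _ hF.2
    pure (some ((RL ∪ X).image fun u => (u, mk.evalP u)))
  else pure none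

open Classical in
/-- The Lagrange coefficient of the point `i` of the proxy key, for the user `u`. -/
noncomputable def lambda {pp : Params} (K : ProxyKey pp) (u : Scalar pp)
    (i : Identity pp × Scalar pp) : Scalar pp :=
  u / (u - (i.1 : Scalar pp)) *
    ∏ j ∈ K.erase i, (j.1 : Scalar pp) / ((j.1 : Scalar pp) - (i.1 : Scalar pp))

/-- The Lagrange coefficient of the user `u` itself. -/
noncomputable def lambdaUser {pp : Params} (K : ProxyKey pp) (u : Scalar pp) : Scalar pp :=
  ∏ j ∈ K, (j.1 : Scalar pp) / ((j.1 : Scalar pp) - u)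

open Classical in
/-- Conversion of a list of elements of `G2` for the user `u`: each is raised to the power
`∑ i, λ_i P(u_i)`; the user also gets its own Lagrange coefficient. The result is `none` if `u` is
one of the points of the proxy key or some string does not belong to `G2`. -/
noncomputable def convert {pp : Params} (E : Encoding pp) (K : ProxyKey pp) (C : List (Str pp))
    (u : Scalar pp) : Option (List (Str pp) × Scalar pp) :=
  if ∃ i ∈ K, (i.1 : Scalar pp) = u then none
  else (C.mapM (E.log .G2)).map fun c =>
    (c.map fun x => E.ψ .G2 (x * ∑ i ∈ K, lambda K u i * i.2), lambdaUser K u)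

/-! ### The security game -/

/-- What an adversary can ask for. -/
inductive Query (pp : Params) : Type
  /-- multiplication in one of the groups -/
  | mul (i : Grp) (x y : Str pp) : Query pp
  /-- exponentiation, in particular inversion, in one of the groups -/
  | pow (i : Grp) (a : Scalar pp) (x : Str pp) : Query pp
  /-- the pairing `G1 × G2 → GT` -/
  | pair (x y : Str pp) : Query pp
  /-- the isomorphism `G2 → G1` -/
  | iso (x : Str pp) : Query pp
  /-- the random oracle -/
  | hash (a : Attr) : Query pp
  /-- a fair coin -/
  | flip : Query pp
  /-- a secret key for the user `u` with the attribute set `S` -/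
  | keygen (u : Identity pp) (S : Finset Attr) : Query pp
  /-- conversion by the proxy, with the proxy key that is stored at that moment -/
  | convert (C : List (Str pp)) (u : Scalar pp) : Query pp
  /-- replacement of the proxy key -/
  | rekey (RL : Finset (Identity pp)) : Query pp
  /-- the challenge -/
  | challenge (M₀ M₁ : Str pp) (T : AccessTree) (RL : Finset (Identity pp)) : Query pp

namespace Query

/-- The type of the answers; `none` means that the query is refused. -/
def Answer {pp : Params} : Query pp → Type
  | mul _ _ _ => Option (Str pp)
  | pow _ _ _ => Option (Str pp)
  | pair _ _ => Option (Str pp)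
  | iso _ => Option (Str pp)
  | hash _ => Str pp
  | flip => Bool
  | keygen _ S => Option (SecretKey pp S)
  | convert _ _ => Option (List (Str pp) × Scalar pp)
  | rekey _ => Unit
  | challenge _ _ T _ => Option (Ciphertext pp T × ProxyKey pp)

/-- The cost of a query: one, plus the number of items that it lists. -/
def cost {pp : Params} : Query pp → ℕ
  | mul _ _ _ => 1
  | pow _ _ _ => 1
  | pair _ _ => 1
  | iso _ => 1
  | hash _ => 1
  | flip => 1
  | keygen _ S => 1 + S.card
  | convert C _ => 1 + C.length
  | rekey RL => 1 + RL.card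
  | challenge _ _ T RL => 1 + T.size + RL.card

end Query

/-- An adaptive adversary: it outputs a guess, or it makes a query and goes on depending on the
answer. -/
inductive Adversary (pp : Params) : Type
  | guess (b : Bool) : Adversary pp
  | query (q : Query pp) (next : q.Answer → Adversary pp) : Adversary pp

/-- The total cost of the queries is at most `n`, whatever the answers are. -/
def Adversary.CostLE {pp : Params} : Adversary pp → ℕ → Prop
  | guess _, _ => True
  | query q next, n => q.cost ≤ n ∧ ∀ a, (next a).CostLE (n - q.cost)

/-- The state of the challenger. -/
structure State (pp : Params) where
  /-- the random oracle, as far as determined -/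
  H : HashTable pp
  /-- the users and attribute sets for which keys have been issued -/
  issued : List (Identity pp × Finset Attr)
  /-- the stored proxy key -/
  pxk : Option (ProxyKey pp)
  /-- the challenge access tree and the challenge revocation list, once the challenge is over -/
  chal : Option (AccessTree × Finset (Identity pp))

open Classical in
/-- The users to whom keys have been issued. -/
noncomputable def State.users {pp : Params} (σ : State pp) : Finset (Identity pp) :=
  (σ.issued.map Prod.fst).toFinset

/-- A key for the user `u` with attributes `S` is compatible with a challenge: `u` is revoked, or
`S` does not satisfy the access tree. -/
def Compatible {pp : Params} (T : AccessTree) (RL : Finset (Identity pp)) (u : Identity pp)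
    (S : Finset Attr) : Prop :=
  u ∈ RL ∨ ¬ T.Satisfies S

open Classical in
/-- The challenger's answer to a query, and its new state. Before the challenge all queries are
served. There is only one challenge; afterwards conversions and replacements of the proxy key are
refused, and so are keys that are not compatible with the challenge. -/
noncomputable def answer {pp : Params} (E : Encoding pp) (mk : MasterKey pp) (b : Bool)
    (σ : State pp) : (q : Query pp) → PMF (q.Answer × State pp)
  | .mul i x y =>
    pure ((do let a ← E.log i x; let c ← E.log i y; some (E.ψ i (a + c)) : Option (Str pp)), σ)
  | .pow i a x => pure ((do let c ← E.log i x; some (E.ψ i (a * c)) : Option (Str pp)), σ)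
  | .pair x y =>
    pure ((do let a ← E.log .G1 x; let c ← E.log .G2 y; some (E.ψ .GT (a * c)) :
      Option (Str pp)), σ)
  | .iso x => pure ((do let a ← E.log .G2 x; some (E.ψ .G1 a) : Option (Str pp)), σ)
  | .hash a => do
    let H ← hashExtend σ.H {a}
    pure (E.ψ .G2 (hashVal H a), { σ with H := H })
  | .flip => do
    let c ← PMF.uniformOfFintype Bool
    pure (c, σ)
  | .keygen u S =>
    if ∀ c ∈ σ.chal, Compatible c.1 c.2 u S then do
      let H ← hashExtend σ.H S
      let sk ← keyGen E mk H u S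
      pure (some sk, { σ with H := H, issued := (u, S) :: σ.issued })
    else pure (none, σ)
  | .convert C u =>
    if σ.chal = none then
      pure ((do let K ← σ.pxk; convert E K C u : Option (List (Str pp) × Scalar pp)), σ)
    else pure (none, σ)
  | .rekey RL =>
    if σ.chal = none then do
      let K ← proxyRekey mk σ.users RL
      match K with
      | some K => pure ((), { σ with pxk := some K })
      | none => pure ((), σ)
    else pure ((), σ)
  | .challenge M₀ M₁ T RL =>
    match E.log .GT M₀, E.log .GT M₁ with
    | some μ₀, some μ₁ =>
      if σ.chal = none ∧ ∀ k ∈ σ.issued, Compatible T RL k.1 k.2 then do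
        let K ← proxyRekey mk σ.users RL
        match K with
        | some K => do
          let H ← hashExtend σ.H T.attrs
          let ct ← encrypt E mk H (if b then μ₁ else μ₀) T
          pure (some (ct, K), { σ with H := H, pxk := some K, chal := some (T, RL) })
        | none => pure (none, σ)
      else pure (none, σ)
    | _, _ => pure (none, σ)

/-- The guess of an adversary that interacts with the challenger. -/
noncomputable def play {pp : Params} (E : Encoding pp) (mk : MasterKey pp) (b : Bool) :
    Adversary pp → State pp → PMF Bool
  | .guess b', _ => PMF.pure b'
  | .query q next, σ => (answer E mk b σ q).bind fun r => play E mk b (next r.1) r.2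

/-- The security game; the result is whether the guess is right. -/
noncomputable def game (pp : Params) (A : PublicKey pp → Adversary pp) : PMF Bool := do
  let E ← randomEncoding pp
  let (pk, mk) ← setup pp E
  let K ← proxyRekey mk ∅ ∅
  let b ← PMF.uniformOfFintype Bool
  let b' ← play E mk b (A pk) { H := fun _ => none, issued := [], pxk := K, chal := none }
  pure (b' == b)

/-- The advantage `Pr[b' = b] - 1 / 2`. -/
noncomputable def advantage (pp : Params) (A : PublicKey pp → Adversary pp) : ℝ :=
  (game pp A true).toReal - 1 / 2

/-- A negligible function of the security parameter. -/
def Negligible (f : ℕ → ℝ) : Prop :=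
  Asymptotics.SuperpolynomialDecay Filter.atTop (fun n : ℕ => (n : ℝ)) f

/-- The cost of the adversaries is bounded by a polynomial in the security parameter. -/
def PolyCost {pp : ℕ → Params} (A : ∀ n, PublicKey (pp n) → Adversary (pp n)) : Prop :=
  ∃ c : Polynomial ℕ, ∀ n pk, (A n pk).CostLE (c.eval n)

end Piratte

/-!
The proof executes the game symbolically. The hidden variables are `α`, `β`, the coefficients of the
revocation polynomial `P`, and the coins of the challenger, which are drawn in advance (`play_eq`).
All group elements that the adversary receives are encodings of explicit rational functions of the
hidden variables, and instead of encoding the values of these functions one can encode the functions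
themselves by random strings. The outcome `g` of that symbolic game does not depend on the challenge
bit, because the masked message `μ + α s` is just one more symbol in it.

The two games are compared from one side only: `Sim` says that, given a table of symbolic exponents
and their strings, each result has in the real game at least its probability in the symbolic game,
up to a small error. Together with the total probability `1` this one-sided bound suffices
(`abs_advantage_le`). The errors have three sources.

* The adversary may use a string that it has not received but that belongs to a group; this is
  rare as `2 ^ m > p ^ 3` (`Sim.unknown`).
* At the challenge the values of `P` at the points of the new proxy key become public. They are
  uniformly random, so one may draw them first and replace `P` by a polynomial `revealP U c P` with
  these values and with the same value at `0`; different exponents that become equal by this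
  substitution are the second source (`Sim.reveal`).
* At the end, different symbolic exponents may have the same value at the hidden point
  (`Sim.guess`).

The last two events are rare because, by the Schwartz-Zippel argument `LinePoly.card_zeros_le`, a
function of low degree that does not vanish identically has few zeros. A difference of two symbolic
exponents vanishes identically only if they are equal, or if the mask `α s` is a linear combination
of the exponents that the adversary obtains without the masked message. The heart of the proof is
`Sym.Secure.mask_notMem`, which excludes the latter. By homogeneity under a torus action only the
pairings of `β s` with `(α + r) / β`, of shares `q_y` with `r + h ρ P(0)`, and of `ρ` or `ρ P(u)`
with `h q_y` could contribute. The linear functional `separator` vanishes on all of these but not on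
`α s`: if the user of a key is revoked, this is because `P(u)` is known while `P(0)` is not, and if
not, because the attributes of the key have shares that vanish for some sharing of the secret `1`
(`AccessTree.exists_share_eq_zero`).
-/

namespace Piratte

open scoped ENNReal

section

/-! ### Averages over finite types -/

/-- The average of a function on a finite type. -/
noncomputable def mean {α : Type*} [Fintype α] (f : α → ℝ≥0∞) : ℝ≥0∞ :=
  ∑ a, f a * (Fintype.card α : ℝ≥0∞)⁻¹

section Mean

variable {α β : Type*} [Fintype α] [Fintype β]

theorem mean_mono {f g : α → ℝ≥0∞} (h : ∀ a, f a ≤ g a) : mean f ≤ mean g :=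
  Finset.sum_le_sum fun a _ => mul_le_mul_left (h a) _

theorem mean_add (f g : α → ℝ≥0∞) : mean (fun a => f a + g a) = mean f + mean g := by
  simp [mean, add_mul, Finset.sum_add_distrib]

theorem mean_mul_left (c : ℝ≥0∞) (f : α → ℝ≥0∞) : mean (fun a => c * f a) = c * mean f := by
  simp [mean, Finset.mul_sum, mul_assoc]

theorem mean_const [Nonempty α] (c : ℝ≥0∞) : mean (fun _ : α => c) = c := by
  simp only [mean, Finset.sum_const, Finset.card_univ, nsmul_eq_mul]
  rw [mul_comm c, ← mul_assoc, ENNReal.mul_inv_cancel, one_mul] <;> simp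

theorem mean_sum {ι : Type*} (s : Finset ι) (f : ι → α → ℝ≥0∞) :
    mean (fun a => ∑ i ∈ s, f i a) = ∑ i ∈ s, mean (f i) := by
  simp only [mean, Finset.sum_mul]
  exact Finset.sum_comm

theorem mean_comm (f : α → β → ℝ≥0∞) :
    mean (fun a => mean fun b => f a b) = mean fun b => mean fun a => f a b := by
  simp only [mean, Finset.sum_mul]
  rw [Finset.sum_comm]
  refine Finset.sum_congr rfl fun b _ => Finset.sum_congr rfl fun a _ => by ring

theorem mean_equiv (e : α ≃ β) (f : β → ℝ≥0∞) : mean (fun a => f (e a)) = mean f := by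
  simp only [mean, Fintype.card_congr e]
  exact e.sum_comp fun b => f b * _

theorem mean_prod [Nonempty α] [Nonempty β] (f : α × β → ℝ≥0∞) :
    mean f = mean fun a => mean fun b => f (a, b) := by
  simp only [mean, Fintype.sum_prod_type, Finset.sum_mul, Fintype.card_prod, Nat.cast_mul]
  refine Finset.sum_congr rfl fun b _ => Finset.sum_congr rfl fun a _ => ?_
  rw [ENNReal.mul_inv (by simp) (by simp), mul_assoc, mul_comm (_⁻¹ : ℝ≥0∞)]

theorem bind_uniform_apply [Nonempty α] {γ : Type*} (G : α → PMF γ) (c : γ) :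
    ((PMF.uniformOfFintype α).bind G) c = mean fun a => G a c := by
  rw [PMF.bind_apply, tsum_fintype]
  simp [mean, mul_comm]

theorem mean_tsum {ι : Type*} (f : ι → α → ℝ≥0∞) :
    mean (fun a => ∑' i, f i a) = ∑' i, mean (f i) := by
  simp only [mean]
  rw [Summable.tsum_finsetSum fun _ _ => ENNReal.summable]
  simp [ENNReal.tsum_mul_right]

theorem mean_le_one_of_le [Nonempty α] {f : α → ℝ≥0∞} {c : ℝ≥0∞} (h : ∀ a, f a ≤ c) :
    mean f ≤ c :=
  (mean_mono h).trans (mean_const c).le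

theorem mean_ite_eq_card (P : α → Prop) [DecidablePred P] :
    mean (fun a => if P a then (1 : ℝ≥0∞) else 0) =
      (Finset.univ.filter P).card * (Fintype.card α : ℝ≥0∞)⁻¹ := by
  simp only [mean, ite_mul, one_mul, zero_mul]
  rw [← Finset.sum_filter]
  simp

end Mean

/-- The image of the uniform distribution under a map all of whose fibres are related by bijections
is uniform. -/
theorem uniform_map_of_transitive {α β : Type*} [Fintype α] [Nonempty α] [Fintype β] [Nonempty β]
    (f : α → β) (h : ∀ b b', ∃ e : α ≃ α, ∀ a, f (e a) = b' ↔ f a = b) :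
    (PMF.uniformOfFintype α).map f = PMF.uniformOfFintype β := by
  classical
  set μ := (PMF.uniformOfFintype α).map f with hμ
  have hval : ∀ b, μ b = mean fun a => if f a = b then 1 else 0 := by
    intro b
    rw [hμ, ← PMF.bind_pure_comp, bind_uniform_apply]
    refine Finset.sum_congr rfl fun a _ => ?_
    simp [PMF.pure_apply, eq_comm]
  have hconst : ∀ b b', μ b = μ b' := by
    intro b b'
    obtain ⟨e, he⟩ := h b b'
    rw [hval, hval b', ← mean_equiv e fun a => if f a = b' then 1 else 0]
    simp only [he]
  ext b
  have h1 : ∑ b', μ b' = 1 := by rw [← tsum_fintype (L := .unconditional β), μ.tsum_coe]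
  rw [Finset.sum_congr rfl fun b' _ => hconst b' b, Finset.sum_const, nsmul_eq_mul,
    Finset.card_univ] at h1
  rw [PMF.uniformOfFintype_apply]
  exact ENNReal.eq_inv_of_mul_eq_one_left (by rw [mul_comm]; exact h1)

/-- The coordinates of a uniformly random vector along an injection are uniformly random. -/
theorem uniform_map_comp {ι κ F : Type*} [Fintype ι] [DecidableEq ι] [Fintype κ] [DecidableEq κ]
    [Fintype F] [AddCommGroup F] (e : κ → ι) (he : Function.Injective e) :
    (PMF.uniformOfFintype (ι → F)).map (fun x => x ∘ e) = PMF.uniformOfFintype (κ → F) := by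
  refine uniform_map_of_transitive _ fun b b' => ?_
  refine ⟨Equiv.addRight (Function.extend e (b' - b) 0), fun a => ?_⟩
  have : (a + Function.extend e (b' - b) 0) ∘ e = a ∘ e + (b' - b) := by
    ext k; simp [he.extend_apply]
  simp only [Equiv.coe_addRight, this]
  constructor <;> intro h
  · have := congrArg (· - (b' - b)) h; simpa using this
  · rw [h]; abel

theorem uniform_map_equiv {α β : Type*} [Fintype α] [Nonempty α] [Fintype β] [Nonempty β]
    (e : α ≃ β) : (PMF.uniformOfFintype α).map e = PMF.uniformOfFintype β := by
  classical
  refine uniform_map_of_transitive _ fun b b' => ⟨e.trans ((Equiv.swap b b').trans e.symm), ?_⟩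
  intro a
  simp [Equiv.swap_apply_eq_iff]

theorem uniform_prod {α β : Type*} [Fintype α] [Nonempty α] [Fintype β] [Nonempty β] :
    PMF.uniformOfFintype (α × β) = (PMF.uniformOfFintype α).bind fun a =>
      (PMF.uniformOfFintype β).bind fun b => PMF.pure (a, b) := by
  ext c
  rw [bind_uniform_apply]
  have : ∀ G : α × β → ℝ≥0∞, PMF.uniformOfFintype (α × β) c = mean fun x => PMF.pure x c := by
    intro _
    rw [← bind_uniform_apply, PMF.bind_pure]
  rw [this 0, mean_prod]
  simp only [bind_uniform_apply]

/-! ### Functions that are polynomials on lines -/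

/-- The function `f` restricts to a polynomial of degree at most `d` on each line. -/
def LinePoly {F E : Type*} [Field F] [AddCommGroup E] [Module F E] (d : ℕ) (f : E → F) : Prop :=
  ∀ a b : E, ∃ q : Polynomial F, q.natDegree ≤ d ∧ ∀ t : F, f (a + t • b) = q.eval t

namespace LinePoly

variable {F E : Type*} [Field F] [AddCommGroup E] [Module F E] {d d' : ℕ} {f g : E → F}

theorem mono (h : LinePoly d f) (hd : d ≤ d') : LinePoly d' f := fun a b =>
  let ⟨q, hq, h⟩ := h a b
  ⟨q, hq.trans hd, h⟩

theorem add (hf : LinePoly d f) (hg : LinePoly d g) : LinePoly d (f + g) := fun a b => by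
  obtain ⟨q, hq, h⟩ := hf a b
  obtain ⟨q', hq', h'⟩ := hg a b
  exact ⟨q + q', Polynomial.natDegree_add_le_of_degree_le hq hq', fun t => by simp [h, h']⟩

theorem mul (hf : LinePoly d f) (hg : LinePoly d' g) : LinePoly (d + d') (f * g) := fun a b => by
  obtain ⟨q, hq, h⟩ := hf a b
  obtain ⟨q', hq', h'⟩ := hg a b
  exact ⟨q * q', Polynomial.natDegree_mul_le_of_le hq hq', fun t => by simp [h, h']⟩

theorem const (c : F) : LinePoly d (fun _ : E => c) := fun _ _ =>
  ⟨Polynomial.C c, by simp, fun t => by simp⟩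

theorem smul (c : F) (hf : LinePoly d f) : LinePoly d (c • f) := by
  have := (const (d := 0) (E := E) c).mul hf
  rw [zero_add] at this
  exact this

theorem linear (f : E →ₗ[F] F) : LinePoly 1 f := fun a b =>
  ⟨Polynomial.C (f a) + Polynomial.X * Polynomial.C (f b), by
    refine Polynomial.natDegree_add_le_of_degree_le (by simp) ?_
    exact (Polynomial.natDegree_mul_C_le _ _).trans Polynomial.natDegree_X_le, fun t => by simp; ring⟩

/-- A function that is a polynomial of degree at most `d` on lines, and not zero, has few zeros:
all lines through a point at which it does not vanish have at most `d` of them. -/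
theorem card_zeros_le [Fintype F] [Fintype E] [DecidableEq F] (hf : LinePoly d f) {a : E}
    (ha : f a ≠ 0) :
    (Fintype.card F - 1) * (Finset.univ.filter fun v => f v = 0).card ≤ d * Fintype.card E := by
  classical
  have h1 : ∀ t : Fˣ, (Finset.univ.filter fun v : E => f (a + (t : F) • v) = 0).card =
      (Finset.univ.filter fun v => f v = 0).card := by
    intro t
    refine Finset.card_bij (fun v _ => a + (t : F) • v) (by simp) ?_ ?_
    · intro v _ w _ h
      have h := add_left_cancel h
      exact (smul_right_injective E t.ne_zero) h
    · intro w hw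
      have : a + (t : F) • (t : F)⁻¹ • (w - a) = w := by simp [smul_smul]
      exact ⟨(t : F)⁻¹ • (w - a), by simpa [this] using hw, this⟩
  have h2 : ∀ v : E, (Finset.univ.filter fun t : Fˣ => f (a + (t : F) • v) = 0).card ≤ d := by
    intro v
    obtain ⟨q, hq, h⟩ := hf a v
    have hq0 : q ≠ 0 := by
      rintro rfl
      have := h 0
      simp at this
      exact ha this
    calc _ ≤ q.roots.toFinset.card := by
          refine Finset.card_le_card_of_injOn (fun t : Fˣ => (t : F)) ?_
            (fun _ _ _ _ h => Units.ext h)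
          intro t ht
          simp only [Finset.coe_filter, Finset.mem_univ, true_and, Set.mem_ofPred_eq, h] at ht
          simp [hq0, ht]
      _ ≤ d := (Multiset.toFinset_card_le _).trans ((Polynomial.card_roots' q).trans hq)
  have h3 := Finset.sum_card_bipartiteAbove_eq_sum_card_bipartiteBelow
    (s := (Finset.univ : Finset Fˣ)) (t := (Finset.univ : Finset E))
    (fun (t : Fˣ) v => f (a + (t : F) • v) = 0)
  simp only [Finset.bipartiteAbove, Finset.bipartiteBelow, h1] at h3
  rw [Finset.sum_const, Finset.card_univ, Fintype.card_units, smul_eq_mul] at h3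
  rw [h3]
  calc _ ≤ ∑ _v : E, d := Finset.sum_le_sum fun v _ => h2 v
    _ = _ := by simp [mul_comm]

end LinePoly

end

open Classical

section

/-! ### Random injective encodings with prescribed values -/

noncomputable instance : Fintype Grp :=
  ⟨{.G1, .G2, .GT}, fun i => by cases i <;> simp⟩

/-- The three encodings as a family indexed by the names of the groups. -/
abbrev Enc (pp : Params) : Type := Grp → (Scalar pp ↪ Str pp)

theorem randomEncoding_eq (pp : Params) :
    randomEncoding pp = (PMF.uniformOfFintype (Enc pp)).map Encoding.mk := by
  let e : (Scalar pp ↪ Str pp) × (Scalar pp ↪ Str pp) × (Scalar pp ↪ Str pp) ≃ Enc pp :=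
    { toFun := fun x i => match i with
        | .G1 => x.1
        | .G2 => x.2.1
        | .GT => x.2.2
      invFun := fun f => (f .G1, f .G2, f .GT)
      left_inv := fun x => rfl
      right_inv := fun f => by ext i : 1; cases i <;> rfl }
  rw [← uniform_map_equiv e, uniform_prod, uniform_prod]
  simp only [randomEncoding, PMF.map_bind, PMF.pure_map, PMF.bind_bind, PMF.pure_bind]
  rfl

variable {pp : Params}

/-- A list of objects in the groups together with the strings that encode them. -/
abbrev Entries (pp : Params) (α : Type) : Type := List (Grp × α × Str pp)

/-- Within each group, different entries have different objects and different strings. -/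
def Entries.Distinct {α : Type} (B : Entries pp α) : Prop :=
  B.Pairwise fun e e' => e.1 = e'.1 → e.2.1 ≠ e'.2.1 ∧ e.2.2 ≠ e'.2.2

/-- The strings in the group `i`. -/
noncomputable def Entries.strings {α : Type} (B : Entries pp α) (i : Grp) : Finset (Str pp) :=
  ((B.filter fun e => e.1 = i).map fun e => e.2.2).toFinset

theorem Entries.mem_strings {α : Type} {B : Entries pp α} {i : Grp} {s : Str pp} :
    s ∈ B.strings i ↔ ∃ a, (i, a, s) ∈ B := by
  simp only [Entries.strings, List.mem_toFinset, List.mem_map, List.mem_filter, decide_eq_true_eq]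
  constructor
  · rintro ⟨⟨j, a, s'⟩, ⟨h, rfl⟩, rfl⟩
    exact ⟨a, h⟩
  · rintro ⟨a, h⟩
    exact ⟨_, ⟨h, rfl⟩, rfl⟩

theorem Entries.Distinct.card_strings {α : Type} {B : Entries pp α} (hB : B.Distinct) (i : Grp) :
    (B.strings i).card = (B.map Prod.fst).count i := by
  rw [Entries.strings, List.toFinset_card_of_nodup]
  · rw [List.length_map, List.count_eq_countP, List.countP_map, List.countP_eq_length_filter]
    congr 1
  · rw [List.Nodup, List.pairwise_map]
    refine (List.Pairwise.filter _ hB).imp_of_mem ?_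
    intro a b ha hb h
    simp only [List.mem_filter, decide_eq_true_eq] at ha hb
    exact (h (ha.2.trans hb.2.symm)).2

/-- Prescribed values of the encodings. -/
abbrev Values (pp : Params) : Type := Entries pp (Scalar pp)

/-- The encodings have the prescribed values. -/
def Values.Agree (B : Values pp) (ψ : Enc pp) : Prop := ∀ e ∈ B, ψ e.1 e.2.1 = e.2.2

/-- The probability that random encodings have prescribed values, in terms of the list of the
groups to which the values belong. -/
noncomputable def weight (pp : Params) : List Grp → ℝ≥0∞
  | [] => 1
  | i :: l => weight pp l * ((2 ^ pp.m - l.count i : ℕ) : ℝ≥0∞)⁻¹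

theorem card_str (pp : Params) : Fintype.card (Str pp) = 2 ^ pp.m := by simp

/-- The probability that random encodings have prescribed values. -/
noncomputable def Values.prob (B : Values pp) : ℝ≥0∞ :=
  mean fun ψ : Enc pp => if B.Agree ψ then 1 else 0

theorem Values.agree_cons {B : Values pp} {e : Grp × Scalar pp × Str pp} {ψ : Enc pp} :
    Values.Agree (e :: B) ψ ↔ ψ e.1 e.2.1 = e.2.2 ∧ B.Agree ψ := by
  simp [Values.Agree]

/-- A fresh exponent is encoded by each of the unused strings with the same probability, by the
symmetry that exchanges two strings. -/
theorem Values.prob_cons_eq (B : Values pp) {i : Grp} {a : Scalar pp} {s s' : Str pp}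
    (hs : s ∉ B.strings i) (hs' : s' ∉ B.strings i) :
    Values.prob ((i, a, s) :: B) = Values.prob ((i, a, s') :: B) := by
  let τ : (Scalar pp ↪ Str pp) ≃ (Scalar pp ↪ Str pp) :=
    { toFun := fun f => f.trans (Equiv.swap s s').toEmbedding
      invFun := fun f => f.trans (Equiv.swap s s').toEmbedding
      left_inv := fun f => by ext1 x; simp
      right_inv := fun f => by ext1 x; simp }
  let e : Enc pp ≃ Enc pp := Equiv.piCongrRight fun j => if j = i then τ else Equiv.refl _
  have hei : ∀ ψ x, e ψ i x = Equiv.swap s s' (ψ i x) := by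
    intro ψ x
    simp [e, τ]
  have hej : ∀ ψ j x, j ≠ i → e ψ j x = ψ j x := by
    intro ψ j x hj
    simp [e, hj]
  rw [Values.prob, Values.prob, ← mean_equiv e]
  congr 1; ext ψ
  congr 1
  rw [Values.agree_cons, Values.agree_cons]
  simp only [hei, eq_iff_iff]
  refine and_congr (by rw [Equiv.swap_apply_eq_iff, Equiv.swap_apply_left]) ?_
  refine forall₂_congr fun x hx => ?_
  by_cases hj : x.1 = i
  · obtain ⟨j, b, y⟩ := x
    simp only at hj
    subst hj
    have hy : y ∈ B.strings j := Entries.mem_strings.2 ⟨b, hx⟩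
    rw [hei, Equiv.swap_apply_eq_iff, Equiv.swap_apply_of_ne_of_ne]
    · rintro rfl; exact hs hy
    · rintro rfl; exact hs' hy
  · rw [hej _ _ _ hj]

/-- The string of a fresh exponent is uniformly distributed on the unused strings. -/
theorem Values.prob_cons_mul (B : Values pp) (hB : B.Distinct) {i : Grp} {a : Scalar pp}
    {s : Str pp} (ha : ∀ s', (i, a, s') ∉ B) (ha' : ∀ b s', (i, b, s') ∈ B → s' ≠ s) :
    Values.prob ((i, a, s) :: B) * ((2 ^ pp.m - (B.map Prod.fst).count i : ℕ) : ℝ≥0∞) =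
      B.prob := by
  have hs : s ∉ B.strings i := fun h =>
    let ⟨b, hb⟩ := Entries.mem_strings.1 h
    ha' b s hb rfl
  have h1 : B.prob = ∑ s', Values.prob ((i, a, s') :: B) := by
    simp only [Values.prob]
    rw [← mean_sum]
    congr 1; ext ψ
    rw [Finset.sum_eq_single (ψ i a)]
    · simp [Values.agree_cons]
    · intro s' _ h
      simp [Values.agree_cons, h.symm]
    · simp
  have h2 : ∀ s' ∈ B.strings i, Values.prob ((i, a, s') :: B) = 0 := by
    intro s' hs'
    obtain ⟨b, hb⟩ := Entries.mem_strings.1 hs'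
    rw [Values.prob]
    simp only [mean]
    refine Finset.sum_eq_zero fun ψ _ => ?_
    rw [if_neg, zero_mul]
    rw [Values.agree_cons]
    rintro ⟨h, h'⟩
    have := h' _ hb
    simp only at this h
    rw [← h] at this
    have := (ψ i).injective this
    subst this
    exact ha _ hb
  rw [h1, ← Finset.sum_subset (Finset.subset_univ (B.strings i)ᶜ) (fun s' _ h => h2 s' (by simpa using h)),
    Finset.sum_congr rfl fun s' hs' => B.prob_cons_eq (by simpa using hs') hs, Finset.sum_const,
    Finset.card_compl, hB.card_strings, card_str, nsmul_eq_mul, mul_comm]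

theorem Values.prob_cons (B : Values pp) (hB : B.Distinct) {i : Grp} {a : Scalar pp}
    {s : Str pp} (ha : ∀ s', (i, a, s') ∉ B) (ha' : ∀ b s', (i, b, s') ∈ B → s' ≠ s) :
    Values.prob ((i, a, s) :: B) =
      B.prob * ((2 ^ pp.m - (B.map Prod.fst).count i : ℕ) : ℝ≥0∞)⁻¹ := by
  have hs : s ∉ B.strings i := fun h =>
    let ⟨b, hb⟩ := Entries.mem_strings.1 h
    ha' b s hb rfl
  have h0 : ((2 ^ pp.m - (B.map Prod.fst).count i : ℕ) : ℝ≥0∞) ≠ 0 := by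
    rw [← hB.card_strings, ← card_str, ← Finset.card_compl]
    simpa using Finset.ne_empty_of_mem (Finset.mem_compl.2 hs)
  rw [← B.prob_cons_mul hB ha ha', mul_assoc, ENNReal.mul_inv_cancel h0 (by simp), mul_one]

theorem Values.prob_eq_weight (B : Values pp) (hB : B.Distinct) :
    B.prob = weight pp (B.map Prod.fst) := by
  induction B with
  | nil =>
    simp only [Values.prob, Values.Agree, List.not_mem_nil, false_imp_iff, implies_true, if_true]
    exact mean_const 1
  | cons e B ih =>
    obtain ⟨i, a, s⟩ := e
    have hB' : Entries.Distinct B := (List.pairwise_cons.1 hB).2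
    have h := (List.pairwise_cons.1 hB).1
    rw [Values.prob_cons B hB', ih hB', List.map_cons, weight]
    · intro s' hs'
      exact (h _ hs' rfl).1 rfl
    · rintro b s' hs' rfl
      exact (h _ hs' rfl).2 rfl

/-- A string that is not among the prescribed ones belongs to a group with small probability. -/
theorem Values.prob_mem_range_le (B : Values pp) (hB : B.Distinct) {i : Grp} {s : Str pp}
    (hs : s ∉ B.strings i) :
    (mean fun ψ : Enc pp => if B.Agree ψ ∧ s ∈ Set.range (ψ i) then 1 else 0) ≤
      weight pp (B.map Prod.fst) *
        (pp.p * ((2 ^ pp.m - (B.map Prod.fst).count i : ℕ) : ℝ≥0∞)⁻¹) := by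
  rw [← B.prob_eq_weight hB]
  have h1 : ∀ a : Scalar pp, Values.prob ((i, a, s) :: B) ≤
      B.prob * ((2 ^ pp.m - (B.map Prod.fst).count i : ℕ) : ℝ≥0∞)⁻¹ := by
    intro a
    have ha' : ∀ b s', (i, b, s') ∈ B → s' ≠ s := by
      rintro b s' h rfl
      exact hs (Entries.mem_strings.2 ⟨b, h⟩)
    by_cases ha : ∀ s', (i, a, s') ∉ B
    · exact (B.prob_cons hB ha ha').le
    · push Not at ha
      obtain ⟨s', hs'⟩ := ha
      have : Values.prob ((i, a, s) :: B) = 0 := by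
        refine Finset.sum_eq_zero fun ψ _ => ?_
        dsimp only
        rw [if_neg, zero_mul]
        rw [Values.agree_cons]
        rintro ⟨h, h'⟩
        exact ha' _ _ hs' ((h' _ hs').symm.trans h)
      rw [this]; exact zero_le
  calc _ ≤ mean fun ψ : Enc pp => ∑ a : Scalar pp,
        if Values.Agree ((i, a, s) :: B) ψ then (1 : ℝ≥0∞) else 0 := by
        refine mean_mono fun ψ => ?_
        split_ifs with h
        · obtain ⟨h, a, ha⟩ := h
          refine le_trans ?_ (Finset.single_le_sum (fun _ _ => zero_le) (Finset.mem_univ a))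
          rw [if_pos (Values.agree_cons.2 ⟨ha, h⟩)]
        · exact zero_le
    _ = ∑ a : Scalar pp, Values.prob ((i, a, s) :: B) := mean_sum _ _
    _ ≤ ∑ _a : Scalar pp, B.prob * ((2 ^ pp.m - (B.map Prod.fst).count i : ℕ) : ℝ≥0∞)⁻¹ :=
        Finset.sum_le_sum fun a _ => h1 a
    _ = _ := by
        simp only [Finset.sum_const, Finset.card_univ, ZMod.card, nsmul_eq_mul]
        ring

end

section

/-! ### Simulation of generic groups -/

variable {pp : Params} {X : Type}

/-- A symbolic exponent: a function `f` of the hidden variables, and a coefficient `c` of the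
exponent of the masked challenge message. -/
abbrev Elt (X : Type) (pp : Params) : Type := (X → Scalar pp) × Scalar pp

/-- The value of a symbolic exponent at the point `x`, if `ν` is the exponent of the masked
challenge message. -/
def ev (ν : X → Scalar pp) (e : Elt X pp) (x : X) : Scalar pp := e.1 x + e.2 * ν x

/-- The symbolic exponents of the group elements whose encodings are known to the adversary. -/
abbrev Table (X : Type) (pp : Params) : Type := Entries pp (Elt X pp)

/-- The values of the entries of a table at the point `x`. -/
def Table.at (T : Table X pp) (ν : X → Scalar pp) (x : X) : Values pp :=
  T.map fun t => (t.1, ev ν t.2.1 x, t.2.2)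

/-- The probability that random encodings agree with a table. -/
noncomputable def Table.weight (T : Table X pp) : ℝ≥0∞ := Piratte.weight pp (T.map Prod.fst)

theorem Table.at_agree {T : Table X pp} {ν : X → Scalar pp} {x : X} {ψ : Enc pp}
    (h : (T.at ν x).Agree ψ) {i : Grp} {e : Elt X pp} {s : Str pp} (hs : (i, e, s) ∈ T) :
    ψ i (ev ν e x) = s :=
  h (i, ev ν e x, s) (List.mem_map.2 ⟨_, hs, rfl⟩)

theorem Table.at_map_fst (T : Table X pp) (ν : X → Scalar pp) (x : X) :
    (T.at ν x).map Prod.fst = T.map Prod.fst := by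
  simp [Table.at, List.map_map, Function.comp_def]

theorem Table.at_strings (T : Table X pp) (ν : X → Scalar pp) (x : X) (i : Grp) :
    (T.at ν x).strings i = T.strings i := by
  ext s
  rw [Entries.mem_strings, Entries.mem_strings]
  simp only [Table.at, List.mem_map, Prod.mk.injEq]
  constructor
  · rintro ⟨a, ⟨j, e, s'⟩, h, rfl, rfl, rfl⟩
    exact ⟨_, h⟩
  · rintro ⟨a, h⟩
    exact ⟨_, _, h, rfl, rfl, rfl⟩

/-- Substitution in a symbolic exponent. -/
def Elt.comp (e : Elt X pp) (θ : X → X) : Elt X pp := (e.1 ∘ θ, e.2)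

/-- Substitution in all entries of a table. -/
def Table.comp (T : Table X pp) (θ : X → X) : Table X pp :=
  T.map fun t => (t.1, Elt.comp t.2.1 θ, t.2.2)

theorem Table.comp_map_fst (T : Table X pp) (θ : X → X) :
    (T.comp θ).map Prod.fst = T.map Prod.fst := by
  simp [Table.comp, List.map_map, Function.comp_def]

theorem Table.at_comp (T : Table X pp) (θ : X → X) (ν : X → Scalar pp) (x : X) :
    (T.comp θ).at (fun x => ν (θ x)) x = T.at ν (θ x) := by
  simp [Table.comp, Table.at, List.map_map, Function.comp_def, Elt.comp, ev]

/-- Different strings cannot encode the same exponent. -/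
theorem Table.distinct_of_agree {T : Table X pp} (hT : T.Distinct) {ν : X → Scalar pp} {x : X}
    {ψ : Enc pp} (h : (T.at ν x).Agree ψ) : (T.at ν x).Distinct := by
  rw [Entries.Distinct, Table.at, List.pairwise_map]
  refine hT.imp_of_mem ?_
  rintro ⟨i, e, s⟩ ⟨j, e', s'⟩ ha hb hab hij
  simp only at hij
  subst hij
  refine ⟨?_, (hab rfl).2⟩
  intro heq
  refine (hab rfl).2 ?_
  simp only at heq ⊢
  rw [← Table.at_agree h ha, ← Table.at_agree h hb, heq]

variable [Fintype X]

theorem mean_exists_pair_le {α : Type*} {T : List α} (P : α → α → X → Prop) {κ : ℝ≥0∞}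
    (h : ∀ t ∈ T, ∀ t' ∈ T, (mean fun x => if P t t' x then 1 else 0) ≤ κ) :
    (mean fun x => if ∃ t ∈ T, ∃ t' ∈ T, P t t' x then 1 else 0) ≤ (T.length : ℝ≥0∞) ^ 2 * κ := by
  have hcard : (T.toFinset.card : ℝ≥0∞) ≤ T.length := by exact_mod_cast T.toFinset_card_le
  calc _ ≤ mean fun x => ∑ t ∈ T.toFinset, ∑ t' ∈ T.toFinset,
        if P t t' x then (1 : ℝ≥0∞) else 0 := by
        refine mean_mono fun x => ?_
        split_ifs with hx
        · obtain ⟨t, ht, t', ht', hx⟩ := hx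
          refine le_trans ?_ (Finset.single_le_sum (fun _ _ => zero_le) (List.mem_toFinset.2 ht))
          refine le_trans ?_ (Finset.single_le_sum (fun _ _ => zero_le) (List.mem_toFinset.2 ht'))
          rw [if_pos hx]
        · exact zero_le
    _ = ∑ t ∈ T.toFinset, ∑ t' ∈ T.toFinset, mean fun x => if P t t' x then (1 : ℝ≥0∞) else 0 := by
        rw [mean_sum]
        exact Finset.sum_congr rfl fun t _ => mean_sum _ _
    _ ≤ ∑ t ∈ T.toFinset, ∑ t' ∈ T.toFinset, κ :=
        Finset.sum_le_sum fun t ht => Finset.sum_le_sum fun t' ht' =>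
          h t (List.mem_toFinset.1 ht) t' (List.mem_toFinset.1 ht')
    _ = (T.toFinset.card : ℝ≥0∞) * (T.toFinset.card * κ) := by simp
    _ ≤ _ := by
        rw [sq, mul_assoc]
        gcongr

/-- The average of `G` over the points and encodings that agree with the table. -/
noncomputable def mass (ν : X → Scalar pp) (T : Table X pp) (G : X → Enc pp → ℝ≥0∞) : ℝ≥0∞ :=
  mean fun x => mean fun ψ => if (T.at ν x).Agree ψ then G x ψ else 0

/-- The random experiment `G`, for each value of the challenge bit, started with a uniformly random
point and random encodings that agree with the table, has up to an error `δ` the outcome of a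
random experiment that does not depend on the challenge bit. -/
def Sim (ν : Bool → X → Scalar pp) (T : Table X pp) (G : Bool → X → Enc pp → PMF Bool)
    (δ : ℝ≥0∞) : Prop :=
  ∃ g : PMF Bool, ∀ b c, T.weight * g c ≤ mass (ν b) T (fun x ψ => G b x ψ c) + T.weight * δ

theorem mass_mono {ν : X → Scalar pp} {T : Table X pp} {G G' : X → Enc pp → ℝ≥0∞}
    (h : ∀ x ψ, (T.at ν x).Agree ψ → G x ψ ≤ G' x ψ) : mass ν T G ≤ mass ν T G' :=
  mean_mono fun x => mean_mono fun ψ => by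
    split_ifs with h'
    · exact h x ψ h'
    · exact le_rfl

namespace Sim

variable {ν : Bool → X → Scalar pp} {T : Table X pp} {G G' : Bool → X → Enc pp → PMF Bool}
  {δ δ' : ℝ≥0∞}

theorem mono (h : Sim ν T G δ) (hδ : δ ≤ δ') : Sim ν T G δ' := by
  obtain ⟨g, hg⟩ := h
  exact ⟨g, fun b c => (hg b c).trans (by gcongr)⟩

theorem congr (h : Sim ν T G δ)
    (hG : ∀ b x ψ, (T.at (ν b) x).Agree ψ → G b x ψ = G' b x ψ) : Sim ν T G' δ := by
  obtain ⟨g, hg⟩ := h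
  refine ⟨g, fun b c => (hg b c).trans ?_⟩
  gcongr
  exact mass_mono fun x ψ hx => by rw [hG b x ψ hx]

/-- Public random choices. -/
theorem bind {ι : Type} (μ : PMF ι) (G : ι → Bool → X → Enc pp → PMF Bool)
    (h : ∀ i ∈ μ.support, Sim ν T (G i) δ) :
    Sim ν T (fun b x ψ => μ.bind fun i => G i b x ψ) δ := by
  have h' : ∀ i, ∃ g : PMF Bool, i ∈ μ.support →
      ∀ b c, T.weight * g c ≤ mass (ν b) T (fun x ψ => G i b x ψ c) + T.weight * δ := by
    intro i
    by_cases hi : i ∈ μ.support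
    · obtain ⟨g, hg⟩ := h i hi
      exact ⟨g, fun _ => hg⟩
    · exact ⟨PMF.pure true, fun hi' => absurd hi' hi⟩
  choose g hg using h'
  refine ⟨μ.bind g, fun b c => ?_⟩
  have h1 : mass (ν b) T (fun x ψ => (μ.bind fun i => G i b x ψ) c) =
      ∑' i, μ i * mass (ν b) T (fun x ψ => G i b x ψ c) := by
    simp only [mass, PMF.bind_apply, ← mean_mul_left, ← mean_tsum]
    congr 1; ext x; congr 1; ext ψ
    split_ifs <;> simp
  have h2 : T.weight * δ = ∑' i, μ i * (T.weight * δ) := by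
    rw [ENNReal.tsum_mul_right, μ.tsum_coe, one_mul]
  rw [h1, PMF.bind_apply, ← ENNReal.tsum_mul_left, h2, ← ENNReal.tsum_add]
  refine ENNReal.tsum_le_tsum fun i => ?_
  by_cases hi : i ∈ μ.support
  · rw [← mul_add, mul_left_comm]
    gcongr
    exact hg i hi b c
  · simp [(PMF.apply_eq_zero_iff μ i).2 hi]

/-- The encoding of a symbolic exponent is its string in the table, if it has one, and otherwise a
fresh random string. -/
theorem encode (hT : T.Distinct) (hlen : T.length < 2 ^ pp.m) (i : Grp) (e : Elt X pp)
    (G : Str pp → Bool → X → Enc pp → PMF Bool)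
    (hknown : ∀ s, (i, e, s) ∈ T → Sim ν T (G s) δ)
    (hfresh : ∀ s, Entries.Distinct ((i, e, s) :: T) → Sim ν ((i, e, s) :: T) (G s) δ) :
    Sim ν T (fun b x ψ => G (ψ i (ev (ν b) e x)) b x ψ) δ := by
  by_cases he : ∃ s, (i, e, s) ∈ T
  · obtain ⟨s, hs⟩ := he
    refine (hknown s hs).congr fun b x ψ h => ?_
    rw [Table.at_agree h hs]
  · have hcount : (T.map Prod.fst).count i < 2 ^ pp.m := by
      refine lt_of_le_of_lt List.count_le_length ?_
      simpa using hlen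
    set n : ℕ := 2 ^ pp.m - (T.map Prod.fst).count i with hn
    have hcard : ((T.strings i)ᶜ).card = n := by
      rw [Finset.card_compl, hT.card_strings, card_str]
    have hne : ((T.strings i)ᶜ).Nonempty := by
      rw [← Finset.card_pos, hcard]; omega
    have hd : ∀ s, s ∉ T.strings i → Entries.Distinct ((i, e, s) :: T) := by
      intro s hs
      refine List.pairwise_cons.2 ⟨?_, hT⟩
      rintro ⟨j, e', s'⟩ h hj
      simp only at hj
      subst hj
      constructor
      · rintro rfl; exact he ⟨_, h⟩
      · rintro rfl; exact hs (Entries.mem_strings.2 ⟨_, h⟩)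
    have h' : ∀ s, ∃ g : PMF Bool, s ∉ T.strings i → ∀ b c,
        Table.weight ((i, e, s) :: T) * g c ≤ mass (ν b) ((i, e, s) :: T)
          (fun x ψ => G s b x ψ c) + Table.weight ((i, e, s) :: T) * δ := by
      intro s
      by_cases hs : s ∈ T.strings i
      · exact ⟨PMF.pure true, fun hs' => absurd hs hs'⟩
      · obtain ⟨g, hg⟩ := hfresh s (hd s hs)
        exact ⟨g, fun _ => hg⟩
    choose g hg using h'
    have hw : ∀ s, Table.weight ((i, e, s) :: T) = T.weight * (n : ℝ≥0∞)⁻¹ := fun s => rfl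
    have hn0 : (n : ℝ≥0∞) ≠ 0 := by rw [Nat.cast_ne_zero]; omega
    refine ⟨(PMF.uniformOfFinset _ hne).bind g, fun b c => ?_⟩
    have h1 : ((PMF.uniformOfFinset _ hne).bind g) c =
        ∑ s ∈ (T.strings i)ᶜ, (n : ℝ≥0∞)⁻¹ * g s c := by
      rw [PMF.bind_apply, tsum_fintype]
      simp only [PMF.uniformOfFinset_apply, hcard, ite_mul, zero_mul]
      rw [← Finset.sum_filter]
      congr 1
      ext s; simp
    have h2 : T.weight * δ = ∑ s ∈ (T.strings i)ᶜ, Table.weight ((i, e, s) :: T) * δ := by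
      simp only [hw, Finset.sum_const, hcard, nsmul_eq_mul]
      rw [mul_assoc, mul_left_comm (n : ℝ≥0∞), ← mul_assoc (n : ℝ≥0∞),
        ENNReal.mul_inv_cancel hn0 (by simp), one_mul]
    -- Encodings that agree with `T` agree with exactly one extension of `T` by `(i, e, s)`. Those
    -- for which `s` is already in the table are dropped, which is harmless for a lower bound.
    have h3 : ∑ s ∈ (T.strings i)ᶜ, mass (ν b) ((i, e, s) :: T) (fun x ψ => G s b x ψ c) ≤
        mass (ν b) T fun x ψ => G (ψ i (ev (ν b) e x)) b x ψ c := by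
      simp only [mass]
      rw [← mean_sum]
      refine mean_mono fun x => ?_
      rw [← mean_sum]
      refine mean_mono fun ψ => ?_
      have h4 : ∀ s, (if (Table.at ((i, e, s) :: T) (ν b) x).Agree ψ then G s b x ψ c else 0) =
          if s = ψ i (ev (ν b) e x) then
            (if (T.at (ν b) x).Agree ψ then G s b x ψ c else 0) else 0 := by
        intro s
        have : (Table.at ((i, e, s) :: T) (ν b) x).Agree ψ ↔
            s = ψ i (ev (ν b) e x) ∧ (T.at (ν b) x).Agree ψ := by
          rw [eq_comm]
          exact Values.agree_cons
        simp only [this, ite_and]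
      simp only [h4]
      refine (Finset.sum_le_sum_of_subset (Finset.subset_univ _)).trans ?_
      simp
    rw [h1, Finset.mul_sum]
    calc _ ≤ ∑ s ∈ (T.strings i)ᶜ, (mass (ν b) ((i, e, s) :: T) (fun x ψ => G s b x ψ c) +
          Table.weight ((i, e, s) :: T) * δ) := by
          refine Finset.sum_le_sum fun s hs => ?_
          rw [← mul_assoc, ← hw s]
          exact hg s (by simpa using hs) b c
      _ ≤ _ := by
          rw [Finset.sum_add_distrib, ← h2]
          gcongr

/-- The encodings of a family of symbolic exponents. -/
theorem encode_fin (n : ℕ) (e : Fin n → Grp × Elt X pp) :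
    ∀ (T : Table X pp) (_ : T.Distinct) (_ : T.length + n ≤ 2 ^ pp.m)
      (G : (Fin n → Str pp) → Bool → X → Enc pp → PMF Bool)
      (_ : ∀ w (T' : Table X pp), T'.Distinct → T'.length ≤ T.length + n →
        (∀ t ∈ T', t ∈ T ∨ ∃ j, (t.1, t.2.1) = e j) → Sim ν T' (G w) δ),
    Sim ν T (fun b x ψ => G (fun j => ψ (e j).1 (ev (ν b) (e j).2 x)) b x ψ) δ := by
  induction n with
  | zero =>
    intro T hT hlen G h
    refine (h Fin.elim0 T hT le_rfl fun t ht => Or.inl ht).congr fun b x ψ _ => ?_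
    congr 1
    ext j; exact j.elim0
  | succ n ih =>
    intro T hT hlen G h
    have key : ∀ (s : Str pp) (T' : Table X pp), T'.Distinct → T'.length ≤ T.length + 1 →
        (∀ t ∈ T', t ∈ T ∨ (t.1, t.2.1) = e 0) →
        Sim ν T' (fun b x ψ => G (Fin.cons s fun j : Fin n =>
          ψ (e j.succ).1 (ev (ν b) (e j.succ).2 x)) b x ψ) δ := by
      intro s T' hT' hlen' hsub
      refine ih (fun j => e j.succ) T' hT' (by omega) (fun w => G (Fin.cons s w)) ?_
      intro w T'' hT'' hlen'' hsub''
      refine h _ T'' hT'' (by omega) fun t ht => ?_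
      rcases hsub'' t ht with h1 | ⟨j, hj⟩
      · rcases hsub t h1 with h2 | h2
        · exact Or.inl h2
        · exact Or.inr ⟨0, h2⟩
      · exact Or.inr ⟨_, hj⟩
    refine (encode (G := fun s b x ψ => G (Fin.cons s fun j : Fin n =>
      ψ (e j.succ).1 (ev (ν b) (e j.succ).2 x)) b x ψ) hT (by omega) (e 0).1 (e 0).2
      (fun s _ => key s T hT (by omega) fun t ht => Or.inl ht)
      (fun s hs => key s _ hs (by simp) ?_)).congr fun b x ψ _ => ?_
    · intro t ht
      rcases List.mem_cons.1 ht with rfl | ht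
      · exact Or.inr rfl
      · exact Or.inl ht
    · congr 1
      ext j : 1
      refine Fin.cases rfl (fun j => rfl) j

theorem encode_family {J : Type} [Fintype J] (e : J → Grp × Elt X pp) (hT : T.Distinct)
    (hlen : T.length + Fintype.card J ≤ 2 ^ pp.m)
    (G : (J → Str pp) → Bool → X → Enc pp → PMF Bool)
    (h : ∀ w (T' : Table X pp), T'.Distinct → T'.length ≤ T.length + Fintype.card J →
      (∀ t ∈ T', t ∈ T ∨ ∃ j, (t.1, t.2.1) = e j) → Sim ν T' (G w) δ) :
    Sim ν T (fun b x ψ => G (fun j => ψ (e j).1 (ev (ν b) (e j).2 x)) b x ψ) δ := by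
  have := encode_fin (ν := ν) (δ := δ) (Fintype.card J) (fun j => e ((Fintype.equivFin J).symm j))
    T hT hlen (fun w => G fun j => w (Fintype.equivFin J j)) ?_
  · refine this.congr fun b x ψ _ => ?_
    congr 1
    ext j : 1
    simp
  · intro w T' hT' hlen' hsub
    refine h _ T' hT' hlen' fun t ht => (hsub t ht).imp_right ?_
    rintro ⟨j, hj⟩
    exact ⟨_, hj⟩

variable [Nonempty X]

/-- A string that the adversary has not obtained before belongs to a group only with small
probability. -/
theorem unknown (hT : T.Distinct) {i : Grp} {s : Str pp} (hs : s ∉ T.strings i)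
    (h : Sim ν T G δ) (hG : ∀ b x ψ, (T.at (ν b) x).Agree ψ → s ∉ Set.range (ψ i) →
      G b x ψ = G' b x ψ) :
    Sim ν T G'
      (δ + pp.p * ((2 ^ pp.m - (T.map Prod.fst).count i : ℕ) : ℝ≥0∞)⁻¹) := by
  obtain ⟨g, hg⟩ := h
  refine ⟨g, fun b c => (hg b c).trans ?_⟩
  set η : ℝ≥0∞ := pp.p * ((2 ^ pp.m - (T.map Prod.fst).count i : ℕ) : ℝ≥0∞)⁻¹
  have h1 : mass (ν b) T (fun x ψ => G b x ψ c) ≤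
      mass (ν b) T (fun x ψ => G' b x ψ c) + T.weight * η := by
    calc _ ≤ mean fun x => (mean (fun ψ => if (T.at (ν b) x).Agree ψ then G' b x ψ c else 0) +
          mean fun ψ : Enc pp =>
            if (T.at (ν b) x).Agree ψ ∧ s ∈ Set.range (ψ i) then (1 : ℝ≥0∞) else 0) := by
          refine mean_mono fun x => ?_
          rw [← mean_add]
          refine mean_mono fun ψ => ?_
          by_cases h1 : (T.at (ν b) x).Agree ψ
          · by_cases h2 : s ∈ Set.range (ψ i)
            · rw [if_pos h1, if_pos h1, if_pos ⟨h1, h2⟩]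
              exact (PMF.coe_le_one _ _).trans le_add_self
            · simp only [if_pos h1, hG b x ψ h1 h2]
              exact le_self_add
          · rw [if_neg h1]; exact zero_le
      _ ≤ mean (fun x => mean (fun ψ => if (T.at (ν b) x).Agree ψ then G' b x ψ c else 0)) +
          T.weight * η := by
          rw [mean_add]
          gcongr
          refine mean_le_one_of_le fun x => ?_
          by_cases hx : ∃ ψ, (T.at (ν b) x).Agree ψ
          · obtain ⟨ψ, hψ⟩ := hx
            have := Values.prob_mem_range_le _ (Table.distinct_of_agree hT hψ)
              (i := i) (s := s) (by rwa [Table.at_strings])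
            rwa [Table.at_map_fst] at this
          · push Not at hx
            simp [hx, mean]
  calc _ ≤ mass (ν b) T (fun x ψ => G' b x ψ c) + T.weight * η + T.weight * δ := by gcongr
    _ = _ := by ring

/-- At the end, the encodings agree with the table for all points at which no two different
symbolic exponents of the table take the same value. -/
theorem guess (hT : T.Distinct) (c : Bool) {κ : ℝ≥0∞}
    (hκ : ∀ b, ∀ t ∈ T, ∀ t' ∈ T, t.1 = t'.1 → t.2.1 ≠ t'.2.1 →
      (mean fun x => if ev (ν b) t.2.1 x = ev (ν b) t'.2.1 x then 1 else 0) ≤ κ) :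
    Sim ν T (fun _ _ _ => PMF.pure c) ((T.length : ℝ≥0∞) ^ 2 * κ) := by
  refine ⟨PMF.pure c, fun b c' => ?_⟩
  by_cases hc : c' = c
  swap
  · simp [PMF.pure_apply, hc]
  subst hc
  simp only [PMF.pure_apply, if_true, mul_one]
  have h1 : ∀ x, (∃ t ∈ T, ∃ t' ∈ T, t.1 = t'.1 ∧ t.2.1 ≠ t'.2.1 ∧
      ev (ν b) t.2.1 x = ev (ν b) t'.2.1 x) ∨ (T.at (ν b) x).Distinct := by
    intro x
    rw [or_iff_not_imp_left]
    intro h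
    push Not at h
    rw [Entries.Distinct, Table.at, List.pairwise_map]
    exact hT.imp_of_mem fun ha hb hab hij => ⟨h _ ha _ hb hij (hab hij).1, (hab hij).2⟩
  have h2 := mean_exists_pair_le (T := T) (fun t t' x => t.1 = t'.1 ∧ t.2.1 ≠ t'.2.1 ∧
      ev (ν b) t.2.1 x = ev (ν b) t'.2.1 x) (κ := κ) fun t ht t' ht' => by
    by_cases h : t.1 = t'.1 ∧ t.2.1 ≠ t'.2.1
    · refine le_trans (mean_mono fun x => ?_) (hκ b t ht t' ht' h.1 h.2)
      simp [h]
    · have : ∀ x, ¬ (t.1 = t'.1 ∧ t.2.1 ≠ t'.2.1 ∧ ev (ν b) t.2.1 x = ev (ν b) t'.2.1 x) :=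
        fun x hx => h ⟨hx.1, hx.2.1⟩
      simp [this, mean]
  have h3 : ∀ x, T.weight ≤ (mean fun ψ => if (T.at (ν b) x).Agree ψ then (1 : ℝ≥0∞) else 0) +
      T.weight * if ∃ t ∈ T, ∃ t' ∈ T, t.1 = t'.1 ∧ t.2.1 ≠ t'.2.1 ∧
        ev (ν b) t.2.1 x = ev (ν b) t'.2.1 x then 1 else 0 := by
    intro x
    rcases h1 x with h | h
    · rw [if_pos h, mul_one]
      exact le_add_self
    · have := (T.at (ν b) x).prob_eq_weight h
      rw [Table.at_map_fst] at this
      exact this.ge.trans le_self_add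
  calc T.weight = mean fun _ : X => T.weight := (mean_const _).symm
    _ ≤ _ := mean_mono h3
    _ ≤ _ := by
        rw [mean_add, mean_mul_left]
        refine add_le_add le_rfl (mul_le_mul_right ?_ _)
        refine (le_of_eq ?_).trans h2
        congr!

/-- At the challenge the adversary learns a function of the hidden point. The point is resampled
accordingly: `θ c x` is uniformly random for random `c` and `x`, and the experiment goes on for
each fixed `c`. This fails only if entries of the table coincide for that `c`. -/
theorem reveal {C : Type} [Fintype C] [Nonempty C] (θ : C → X → X)
    (hθ : ∀ f : X → ℝ≥0∞, (mean fun c => mean fun x => f (θ c x)) = mean f)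
    (hT : T.Distinct) {κ : ℝ≥0∞}
    (hκ : ∀ t ∈ T, ∀ t' ∈ T, t.2.1.1 ≠ t'.2.1.1 →
      (mean fun x => if t.2.1.1 x = t'.2.1.1 x then 1 else 0) ≤ κ)
    (h : ∀ c, (T.comp (θ c)).Distinct →
      Sim (fun b x => ν b (θ c x)) (T.comp (θ c)) (fun b x ψ => G b (θ c x) ψ) δ) :
    Sim ν T G (δ + (T.length : ℝ≥0∞) ^ 2 * κ) := by
  have h1 : ∀ c, (∃ t ∈ T, ∃ t' ∈ T, t.2.1 ≠ t'.2.1 ∧ Elt.comp t.2.1 (θ c) = Elt.comp t'.2.1 (θ c)) ∨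
      (T.comp (θ c)).Distinct := by
    intro c
    rw [or_iff_not_imp_left]
    intro h
    push Not at h
    rw [Entries.Distinct, Table.comp, List.pairwise_map]
    exact hT.imp_of_mem fun ha hb hab hij => ⟨h _ ha _ hb (hab hij).1, (hab hij).2⟩
  -- If two entries coincide identically for `c`, they have the same value at `θ c x` for all `x`.
  have h2 := mean_exists_pair_le (T := T) (fun t t' c => t.2.1 ≠ t'.2.1 ∧
      Elt.comp t.2.1 (θ c) = Elt.comp t'.2.1 (θ c)) (κ := κ) fun t ht t' ht' => by
    by_cases h : t.2.1.1 = t'.2.1.1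
    · have : ∀ c, ¬ (t.2.1 ≠ t'.2.1 ∧ Elt.comp t.2.1 (θ c) = Elt.comp t'.2.1 (θ c)) := by
        rintro c ⟨h1, h2⟩
        exact h1 (Prod.ext h (congrArg Prod.snd h2 :))
      simp [this, mean]
    · refine le_trans (mean_mono fun c => ?_) ((hθ _).trans_le (hκ t ht t' ht' h))
      split_ifs with hc
      · have : ∀ x, t.2.1.1 (θ c x) = t'.2.1.1 (θ c x) := fun x =>
          congrFun (congrArg Prod.fst hc.2 :) x
        simp [this, mean_const]
      · exact zero_le
  have h' : ∀ c, ∃ g : PMF Bool, (T.comp (θ c)).Distinct → ∀ b a, T.weight * g a ≤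
      mass (fun x => ν b (θ c x)) (T.comp (θ c)) (fun x ψ => G b (θ c x) ψ a) + T.weight * δ := by
    intro c
    by_cases hc : (T.comp (θ c)).Distinct
    · obtain ⟨g, hg⟩ := h c hc
      refine ⟨g, fun _ => ?_⟩
      rwa [Table.weight, Table.comp_map_fst] at hg
    · exact ⟨PMF.pure true, fun hc' => absurd hc' hc⟩
  choose g hg using h'
  refine ⟨(PMF.uniformOfFintype C).bind g, fun b a => ?_⟩
  rw [bind_uniform_apply, ← mean_mul_left]
  have h3 : ∀ c, mass (fun x => ν b (θ c x)) (T.comp (θ c)) (fun x ψ => G b (θ c x) ψ a) =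
      mean fun x => (fun x => mean fun ψ => if (T.at (ν b) x).Agree ψ then G b x ψ a else 0)
        (θ c x) := by
    intro c
    simp only [mass, Table.at_comp]
  have h4 : (mean fun c => mass (fun x => ν b (θ c x)) (T.comp (θ c))
      fun x ψ => G b (θ c x) ψ a) = mass (ν b) T fun x ψ => G b x ψ a := by
    simp only [h3]
    exact hθ fun x => mean fun ψ => if (T.at (ν b) x).Agree ψ then G b x ψ a else 0
  calc _ ≤ mean fun c => (mass (fun x => ν b (θ c x)) (T.comp (θ c))
          (fun x ψ => G b (θ c x) ψ a) + T.weight * δ) + T.weight *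
        (if ∃ t ∈ T, ∃ t' ∈ T, t.2.1 ≠ t'.2.1 ∧ Elt.comp t.2.1 (θ c) = Elt.comp t'.2.1 (θ c)
          then 1 else 0) := by
        refine mean_mono fun c => ?_
        rcases h1 c with h | h
        · rw [if_pos h]
          exact (mul_le_mul_right ((g c).coe_le_one a) _).trans le_add_self
        · exact (hg c h b a).trans le_self_add
    _ ≤ mass (ν b) T (fun x ψ => G b x ψ a) + T.weight * δ +
        T.weight * ((T.length : ℝ≥0∞) ^ 2 * κ) := by
        rw [mean_add, mean_add, mean_mul_left _ fun c => ite _ _ _, mean_const, h4]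
        refine add_le_add le_rfl (mul_le_mul_right ?_ _)
        refine (le_of_eq ?_).trans h2
        congr!
    _ = _ := by ring

end Sim

end

section

/-! ### Secret sharing along access trees -/

namespace AccessTree

noncomputable instance Leaf.fintype : (T : AccessTree) → Fintype T.Leaf
  | leaf _ => inferInstanceAs (Fintype Unit)
  | gate _ n _ _ c =>
    letI : ∀ i, Fintype (c i).Leaf := fun i => Leaf.fintype (c i)
    inferInstanceAs (Fintype (Σ i : Fin n, (c i).Leaf))

theorem card_leaf_le_size (T : AccessTree) : Fintype.card T.Leaf ≤ T.size := by
  induction T with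
  | leaf a => exact le_of_eq (Fintype.card_unit)
  | gate k n hk hn c ih =>
    have : Fintype.card (gate k n hk hn c).Leaf = ∑ i, Fintype.card (c i).Leaf := by
      rw [← Fintype.card_sigma]
      rfl
    rw [this, size]
    exact (Finset.sum_le_sum fun i _ => ih i).trans (Nat.le_add_left _ _)

theorem att_mem_attrs (T : AccessTree) (y : T.Leaf) : T.att y ∈ T.attrs := by
  induction T with
  | leaf a => simp [att, attrs]
  | gate k n hk hn c ih =>
    obtain ⟨i, y⟩ := y
    simp only [attrs, Finset.mem_biUnion, Finset.mem_univ, true_and]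
    exact ⟨i, ih i y⟩

theorem card_attrs_le_size (T : AccessTree) : T.attrs.card ≤ T.size := by
  induction T with
  | leaf a => simp [attrs, size]
  | gate k n hk hn c ih =>
    rw [size, attrs]
    exact (Finset.card_biUnion_le.trans (Finset.sum_le_sum fun i _ => ih i)).trans
      (Nat.le_add_left _ _)

/-- The positions of the coins of the secret sharing. -/
def Pos : AccessTree → Type
  | leaf _ => Empty
  | gate k n _ _ c => Fin (k - 1) ⊕ Σ i : Fin n, (c i).Pos

noncomputable instance Pos.fintype : (T : AccessTree) → Fintype T.Pos
  | leaf _ => inferInstanceAs (Fintype Empty)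
  | gate k n _ _ c =>
    letI : ∀ i, Fintype (c i).Pos := fun i => Pos.fintype (c i)
    inferInstanceAs (Fintype (Fin (k - 1) ⊕ Σ i : Fin n, (c i).Pos))

theorem card_pos_lt_size (T : AccessTree) : Fintype.card T.Pos < T.size := by
  induction T with
  | leaf a =>
    have : Fintype.card (leaf a).Pos = 0 := Fintype.card_empty
    rw [this, size]
    exact one_pos
  | gate k n hk hn c ih =>
    have : Fintype.card (gate k n hk hn c).Pos = k - 1 + ∑ i, Fintype.card (c i).Pos := by
      have e : (gate k n hk hn c).Pos ≃ Fin (k - 1) ⊕ Σ i : Fin n, (c i).Pos := Equiv.refl _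
      rw [Fintype.card_congr e, Fintype.card_sum, Fintype.card_fin, Fintype.card_sigma]
    rw [this, size]
    have h1 : ∑ i, (Fintype.card (c i).Pos + 1) ≤ ∑ i, (c i).size :=
      Finset.sum_le_sum fun i _ => ih i
    rw [Finset.sum_add_distrib] at h1
    simp at h1
    omega

variable {F : Type}

/-- The coins with given values at their positions. -/
def ofPos : (T : AccessTree) → (T.Pos → F) → T.Coeffs F
  | leaf _, _ => ()
  | gate _ _ _ _ c, g => (fun j => g (.inl j), fun i => (c i).ofPos fun z => g (.inr ⟨i, z⟩))

/-- The values of the coins at the positions. -/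
def toPos : (T : AccessTree) → T.Coeffs F → T.Pos → F
  | leaf _, _, z => nomatch z
  | gate _ _ _ _ _, (a, _), .inl j => a j
  | gate _ _ _ _ c, (_, d), .inr ⟨i, z⟩ => (c i).toPos (d i) z

theorem ofPos_toPos (T : AccessTree) (d : T.Coeffs F) : T.ofPos (T.toPos d) = d := by
  induction T with
  | leaf a => rfl
  | gate k n hk hn c ih =>
    obtain ⟨a, d⟩ := d
    refine Prod.ext rfl ?_
    funext i
    exact ih i (d i)

theorem toPos_ofPos (T : AccessTree) (g : T.Pos → F) : T.toPos (T.ofPos g) = g := by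
  induction T with
  | leaf a => funext z; exact nomatch z
  | gate k n hk hn c ih =>
    funext z
    rcases z with j | ⟨i, z⟩
    · rfl
    · exact congrFun (ih i fun z => g (.inr ⟨i, z⟩)) z

/-- Coins are families of field elements indexed by the positions. -/
def posEquiv (T : AccessTree) : (T.Pos → F) ≃ T.Coeffs F :=
  ⟨T.ofPos, T.toPos, T.toPos_ofPos, T.ofPos_toPos⟩

theorem share_ofPos_linear [CommRing F] (T : AccessTree) (a s s' : F) (g g' : T.Pos → F)
    (y : T.Leaf) : T.share (T.ofPos (a • g + g')) (a * s + s') y =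
      a * T.share (T.ofPos g) s y + T.share (T.ofPos g') s' y := by
  induction T generalizing s s' with
  | leaf b => rfl
  | gate k n hk hn c ih =>
    obtain ⟨i, y⟩ := y
    simp only [ofPos, share]
    rw [← ih i]
    congr 1
    have h : ∀ j : Fin (k - 1), (a • g + g') (.inl j) * (((i : ℕ) + 1 : ℕ) : F) ^ ((j : ℕ) + 1) =
        a * (g (.inl j) * (((i : ℕ) + 1 : ℕ) : F) ^ ((j : ℕ) + 1)) +
          g' (.inl j) * (((i : ℕ) + 1 : ℕ) : F) ^ ((j : ℕ) + 1) := fun j => by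
      have : (a • g + g') (.inl j) = a * g (.inl j) + g' (.inl j) := rfl
      rw [this]
      ring
    rw [Finset.sum_congr rfl fun j _ => h j, Finset.sum_add_distrib, ← Finset.mul_sum]
    ring

theorem share_ofPos_zero [CommRing F] (T : AccessTree) (y : T.Leaf) :
    T.share (T.ofPos (0 : T.Pos → F)) 0 y = 0 := by
  have := T.share_ofPos_linear (-1 : F) 0 0 0 0 y
  simpa using this

theorem share_ofPos_smul [CommRing F] (T : AccessTree) (a s : F) (g : T.Pos → F)
    (y : T.Leaf) : T.share (T.ofPos (a • g)) (a * s) y = a * T.share (T.ofPos g) s y := by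
  have := T.share_ofPos_linear a s 0 g 0 y
  simpa [share_ofPos_zero] using this

/-- The secrecy of the sharing: attributes that do not satisfy the tree get shares that vanish for
a suitable sharing of `1`. At each gate the polynomial is chosen with zeros at the children that
the attributes satisfy, of which there are fewer than the threshold. -/
theorem exists_share_eq_zero [Field F] (T : AccessTree) (S : Finset Attr)
    (hT : ¬ T.Satisfies S) (hF : ∀ i : ℕ, 0 < i → i ≤ T.size → (i : F) ≠ 0) :
    ∃ g : T.Pos → F, ∀ y, T.att y ∈ S → T.share (T.ofPos g) 1 y = 0 := by
  induction T with
  | leaf a =>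
    refine ⟨0, fun y hy => ?_⟩
    exact absurd hy hT
  | gate k n hk hn c ih =>
    have hsize : ∀ i, (c i).size ≤ (gate k n hk hn c).size := fun i => by
      rw [size]
      exact (Finset.single_le_sum (f := fun i => (c i).size) (fun _ _ => Nat.zero_le _)
        (Finset.mem_univ i)).trans (Nat.le_add_left _ _)
    have hpos : ∀ T : AccessTree, 1 ≤ T.size := fun T => by
      cases T <;> simp [size]
    have hn' : n ≤ (gate k n hk hn c).size := by
      rw [size]
      have : ∑ _i : Fin n, 1 ≤ ∑ i, (c i).size := Finset.sum_le_sum fun i _ => hpos _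
      simp at this
      omega
    set U : Finset (Fin n) := Finset.univ.filter fun i => (c i).Satisfies S with hU
    have hUk : U.card < k := by
      by_contra h
      exact hT ⟨U, not_lt.1 h, fun i hi => (Finset.mem_filter.1 hi).2⟩
    let z : Fin n → F := fun i => (((i : ℕ) + 1 : ℕ) : F)
    have hz : ∀ i, z i ≠ 0 := fun i => hF _ (Nat.succ_pos _) (by have := i.2; omega)
    -- The polynomial of the gate, with constant term `1` and degree at most `k - 1`.
    let P : Polynomial F := ∏ i ∈ U, (1 - Polynomial.C (z i)⁻¹ * Polynomial.X)
    have hPdeg : P.natDegree < k := by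
      refine lt_of_le_of_lt ((Polynomial.natDegree_prod_le _ _).trans ?_) hUk
      rw [Finset.card_eq_sum_ones]
      refine Finset.sum_le_sum fun i _ => ?_
      refine (Polynomial.natDegree_sub_le _ _).trans ?_
      simp only [Polynomial.natDegree_one, zero_le, sup_of_le_right]
      exact (Polynomial.natDegree_C_mul_le _ _).trans Polynomial.natDegree_X_le
    have hP0 : P.coeff 0 = 1 := by
      rw [Polynomial.coeff_zero_eq_eval_zero, Polynomial.eval_prod]
      simp
    have hPz : ∀ i ∈ U, P.eval (z i) = 0 := by
      intro i hi
      rw [Polynomial.eval_prod]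
      refine Finset.prod_eq_zero hi ?_
      simp [hz i]
    have hPeval : ∀ i, 1 + ∑ j : Fin (k - 1), P.coeff ((j : ℕ) + 1) * z i ^ ((j : ℕ) + 1) =
        P.eval (z i) := by
      intro i
      rw [Polynomial.eval_eq_sum_range' hPdeg]
      obtain ⟨k, rfl⟩ : ∃ l, k = l + 1 := ⟨k - 1, by omega⟩
      rw [Finset.sum_range_succ', hP0]
      simp only [pow_zero, mul_one]
      rw [add_comm, Finset.sum_range]
      rfl
    have hex : ∀ i, ∃ g : (c i).Pos → F, ∀ y, (c i).att y ∈ S →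
        (c i).share ((c i).ofPos g) (P.eval (z i)) y = 0 := by
      intro i
      by_cases hi : (c i).Satisfies S
      · refine ⟨0, fun y _ => ?_⟩
        rw [hPz i (Finset.mem_filter.2 ⟨Finset.mem_univ _, hi⟩), share_ofPos_zero]
      · obtain ⟨g, hg⟩ := ih i hi fun j hj hj' => hF j hj (hj'.trans (hsize i))
        refine ⟨P.eval (z i) • g, fun y hy => ?_⟩
        have := (c i).share_ofPos_smul (P.eval (z i)) 1 g y
        rw [hg y hy, mul_zero] at this
        simpa using this
    choose g hg using hex
    refine ⟨fun w => match w with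
      | .inl j => P.coeff ((j : ℕ) + 1)
      | .inr ⟨i, w⟩ => g i w, ?_⟩
    rintro ⟨i, y⟩ hy
    have := hg i y hy
    rw [← hPeval] at this
    exact this

end AccessTree

end

set_option synthInstance.maxSize 1000

section

/-! ### The challenger with coins that are drawn in advance -/

/-- The secret coins of the challenger for one query: logarithms of hash values, the exponent `r`
and the exponents `r_j` of a secret key, the exponent `s` and the coefficients of the sharing of a
ciphertext. -/
abbrev Cell (pp : Params) (N : ℕ) : Type :=
  (Fin N → Scalar pp) × Scalar pp × (Fin N → Scalar pp) × Scalar pp × (Fin N → Scalar pp)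

/-- The secret coins for all queries. -/
abbrev Tape (pp : Params) (N : ℕ) : Type := Fin N → Cell pp N

/-- The places in a cell at which the coins for the elements of `J` are found; they are different
if `J` has at most `N` elements, and `0` otherwise. -/
noncomputable def slot (N : ℕ) [NeZero N] (J : Type) [Fintype J] (j : J) : Fin N :=
  if h : Fintype.card J ≤ N then Fin.castLE h (Fintype.equivFin J j) else 0

theorem slot_injective {N : ℕ} [NeZero N] {J : Type} [Fintype J] (h : Fintype.card J ≤ N) :
    Function.Injective (slot N J) := by
  intro i j hij
  simpa [slot, h] using hij

variable {pp : Params} {N : ℕ}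

noncomputable instance : AddCommGroup (Cell pp N) := inferInstance

noncomputable instance : Fintype (Cell pp N) := inferInstance

noncomputable instance : Fintype (Tape pp N) := Pi.instFintype

/-- The hash table, extended to the attributes of `S` by given values. -/
noncomputable def fillHash (H : HashTable pp) (S : Finset Attr) (v : S → Scalar pp) :
    HashTable pp := fun a =>
  match H a with
  | some x => some x
  | none => if ha : a ∈ S then some (v ⟨a, ha⟩) else none

/-- The secret key with given coins. -/
noncomputable def keyWith (E : Encoding pp) (mk : MasterKey pp) (H : HashTable pp)
    (u : Identity pp) (S : Finset Attr) (r : Scalar pp) (ρ : S → Scalar pp) : SecretKey pp S where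
  D := E.ψ .G2 ((mk.α + r) / (mk.β : Scalar pp))
  Dj := fun j => E.ψ .G2 (r + hashVal H j * ρ j * mk.evalP 0)
  Dj' := fun j => E.ψ .G1 (ρ j)
  Dj'' := fun j => E.ψ .G1 (ρ j * mk.evalP u)

/-- The ciphertext with given coins. -/
noncomputable def cipherWith (E : Encoding pp) (mk : MasterKey pp) (H : HashTable pp)
    (μ : Scalar pp) (T : AccessTree) (s : Scalar pp) (q : T.Pos → Scalar pp) :
    Ciphertext pp T where
  Ct := E.ψ .GT (μ + mk.α * s)
  C := E.ψ .G1 ((mk.β : Scalar pp) * s)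
  Cy := fun y => E.ψ .G1 (T.share (T.ofPos q) s y)
  Cy' := fun y => E.ψ .G2 (hashVal H (T.att y) * T.share (T.ofPos q) s y)

theorem cell_bind {γ : Type} {J₁ J₂ J₃ : Type} [Fintype J₁] [Fintype J₂] [Fintype J₃]
    [DecidableEq J₁] [DecidableEq J₂] [DecidableEq J₃]
    (e₁ : J₁ → Fin N) (e₂ : J₂ → Fin N) (e₃ : J₃ → Fin N) (h₁ : Function.Injective e₁)
    (h₂ : Function.Injective e₂) (h₃ : Function.Injective e₃)
    (G : (J₁ → Scalar pp) → Scalar pp → (J₂ → Scalar pp) → Scalar pp → (J₃ → Scalar pp) → PMF γ) :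
    ((PMF.uniformOfFintype (Cell pp N)).bind fun c =>
      G (fun j => c.1 (e₁ j)) c.2.1 (fun j => c.2.2.1 (e₂ j)) c.2.2.2.1
        (fun j => c.2.2.2.2 (e₃ j))) =
    (PMF.uniformOfFintype (J₁ → Scalar pp)).bind fun h =>
      (PMF.uniformOfFintype (Scalar pp)).bind fun r =>
        (PMF.uniformOfFintype (J₂ → Scalar pp)).bind fun ρ =>
          (PMF.uniformOfFintype (Scalar pp)).bind fun s =>
            (PMF.uniformOfFintype (J₃ → Scalar pp)).bind fun q => G h r ρ s q := by
  rw [← uniform_map_comp (F := Scalar pp) e₁ h₁, ← uniform_map_comp (F := Scalar pp) e₂ h₂,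
    ← uniform_map_comp (F := Scalar pp) e₃ h₃]
  simp only [uniform_prod, PMF.bind_bind, PMF.pure_bind, PMF.bind_map]
  rfl

theorem uniform_coeffs (T : AccessTree) :
    PMF.uniformOfFintype (T.Coeffs (Scalar pp)) =
      (PMF.uniformOfFintype (T.Pos → Scalar pp)).map T.ofPos :=
  (uniform_map_equiv T.posEquiv).symm

theorem uniform_tape_bind {γ : Type} (k : Fin N) (G : Tape pp N → PMF γ) :
    (PMF.uniformOfFintype (Tape pp N)).bind G =
      (PMF.uniformOfFintype (Cell pp N)).bind fun c =>
        (PMF.uniformOfFintype (Tape pp N)).bind fun τ => G (Function.update τ k c) := by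
  have h : (PMF.uniformOfFintype (Cell pp N × Tape pp N)).map
      (fun x => Function.update x.2 k x.1) = PMF.uniformOfFintype (Tape pp N) := by
    refine uniform_map_of_transitive _ fun τ τ' => ?_
    let z : Cell pp N × Tape pp N := ((τ' - τ) k, τ' - τ)
    refine ⟨Equiv.addRight z, fun x => ?_⟩
    have : Function.update (x + z).2 k (x + z).1 = Function.update x.2 k x.1 + (τ' - τ) := by
      funext j
      by_cases hj : j = k
      · subst hj; simp [z]
      · simp [z, hj]
    simp only [Equiv.coe_addRight, this]
    constructor <;> intro h
    · have := congrArg (· - (τ' - τ)) h; simpa using this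
    · rw [h]; abel
  conv_lhs => rw [← h]
  rw [uniform_prod]
  simp only [PMF.bind_map, PMF.bind_bind, PMF.pure_bind, Function.comp_def]

variable [NeZero N]

/-- The answer of the challenger with the secret coins of the cell `c`. -/
noncomputable def answerWith (c : Cell pp N) (E : Encoding pp) (mk : MasterKey pp) (b : Bool)
    (σ : State pp) : (q : Query pp) → PMF (q.Answer × State pp)
  | .hash a =>
    let H := fillHash σ.H {a} fun j => c.1 (slot N _ j)
    pure (E.ψ .G2 (hashVal H a), { σ with H := H })
  | .keygen u S =>
    if ∀ c ∈ σ.chal, Compatible c.1 c.2 u S then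
      let H := fillHash σ.H S fun j => c.1 (slot N _ j)
      pure (some (keyWith E mk H u S c.2.1 fun j => c.2.2.1 (slot N _ j)),
        { σ with H := H, issued := (u, S) :: σ.issued })
    else pure (none, σ)
  | .challenge M₀ M₁ T RL =>
    match E.log .GT M₀, E.log .GT M₁ with
    | some μ₀, some μ₁ =>
      if σ.chal = none ∧ ∀ k ∈ σ.issued, Compatible T RL k.1 k.2 then do
        let K ← proxyRekey mk σ.users RL
        match K with
        | some K =>
          let H := fillHash σ.H T.attrs fun j => c.1 (slot N _ j)
          pure (some (cipherWith E mk H (if b then μ₁ else μ₀) T c.2.2.2.1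
            fun j => c.2.2.2.2 (slot N _ j), K),
            { σ with H := H, pxk := some K, chal := some (T, RL) })
        | none => pure (none, σ)
      else pure (none, σ)
    | _, _ => pure (none, σ)
  | q => answer E mk b σ q

/-- The coins of an answer may be drawn in advance, if the query is not too long. -/
theorem answer_eq (E : Encoding pp) (mk : MasterKey pp) (b : Bool) (σ : State pp) (q : Query pp)
    (hq : q.cost ≤ N) :
    answer E mk b σ q =
      (PMF.uniformOfFintype (Cell pp N)).bind fun c => answerWith c E mk b σ q := by
  have hid : Function.Injective (id : Fin N → Fin N) := fun _ _ h => h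
  cases q with
  | hash a =>
    have h₁ : Function.Injective (slot N ({a} : Finset Attr)) :=
      slot_injective (by simpa [Query.cost] using hq)
    have := cell_bind (pp := pp) (slot N _) id id h₁ hid hid fun h _ _ _ _ =>
      (pure (E.ψ .G2 (hashVal (fillHash σ.H {a} h) a), { σ with H := fillHash σ.H {a} h }) :
        PMF (Str pp × State pp))
    refine Eq.trans ?_ this.symm
    simp only [PMF.bind_const]
    simp only [answer, hashExtend]
    exact PMF.bind_bind _ _ _ |>.trans (by congr 1; funext v; exact PMF.pure_bind _ _)
  | keygen u S =>
    simp only [answer, answerWith]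
    split_ifs with hc
    · have hS : Fintype.card S ≤ N := by
        simp only [Query.cost, Fintype.card_coe] at hq ⊢; omega
      have := cell_bind (pp := pp) (slot N _) (slot N _) id (slot_injective hS)
        (slot_injective hS) hid fun h r ρ _ _ =>
        (pure (some (keyWith E mk (fillHash σ.H S h) u S r ρ),
          { σ with H := fillHash σ.H S h, issued := (u, S) :: σ.issued }) :
          PMF (Option (SecretKey pp S) × State pp))
      refine Eq.trans ?_ this.symm
      simp only [PMF.bind_const]
      simp only [hashExtend, keyGen]
      refine (PMF.bind_bind _ _ _).trans ?_
      congr 1; funext v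
      refine (PMF.pure_bind _ _).trans ?_
      refine (PMF.bind_bind _ _ _).trans ?_
      congr 1; funext r
      refine (PMF.bind_bind _ _ _).trans ?_
      congr 1; funext ρ
      exact PMF.pure_bind _ _
    · exact (PMF.bind_const _ _).symm
  | challenge M₀ M₁ T RL =>
    simp only [answer, answerWith]
    cases h0 : E.log .GT M₀ with
    | none => exact (PMF.bind_const _ _).symm
    | some μ₀ =>
    cases h1 : E.log .GT M₁ with
    | none => exact (PMF.bind_const _ _).symm
    | some μ₁ =>
    by_cases hc : σ.chal = none ∧ ∀ k ∈ σ.issued, Compatible T RL k.1 k.2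
    · simp only [if_pos hc]
      refine Eq.trans ?_ (PMF.bind_comm _ _ _)
      refine congrArg (PMF.bind _) ?_
      funext K
      cases K with
      | none => exact (PMF.bind_const _ _).symm
      | some K =>
        simp only [Query.cost] at hq
        have hA : Fintype.card T.attrs ≤ N := by
          rw [Fintype.card_coe]
          have := T.card_attrs_le_size
          omega
        have hP : Fintype.card T.Pos ≤ N := by
          have := T.card_pos_lt_size
          omega
        have := cell_bind (pp := pp) (slot N _) id (slot N _) (slot_injective hA)
          hid (slot_injective hP) fun h _ _ s q =>
          (pure (some (cipherWith E mk (fillHash σ.H T.attrs h) (if b then μ₁ else μ₀) T s q, K),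
            { σ with H := fillHash σ.H T.attrs h, pxk := some K, chal := some (T, RL) }) :
            PMF (Option (Ciphertext pp T × ProxyKey pp) × State pp))
        refine Eq.trans ?_ this.symm
        simp only [PMF.bind_const]
        simp only [hashExtend, encrypt]
        refine (PMF.bind_bind _ _ _).trans ?_
        congr 1; funext v
        refine (PMF.pure_bind _ _).trans ?_
        refine (PMF.bind_bind _ _ _).trans ?_
        congr 1; funext s
        refine (PMF.bind_bind _ _ _).trans ?_
        rw [uniform_coeffs]
        refine (PMF.bind_map _ _ _).trans ?_
        congr 1; funext q
        exact PMF.pure_bind _ _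
    · simp only [if_neg hc]
      exact (PMF.bind_const _ _).symm
  | _ => exact (PMF.bind_const _ _).symm

/-- The coins for the query with number `k`; the value beyond the end of the tape is irrelevant. -/
def cellAt (τ : Tape pp N) (k : ℕ) : Cell pp N := if h : k < N then τ ⟨k, h⟩ else 0

/-- The guess of an adversary, if the secret coins of the challenger are on the tape; the next
query has the number `k`. -/
noncomputable def playWith (τ : Tape pp N) (E : Encoding pp) (mk : MasterKey pp) (b : Bool) :
    Adversary pp → ℕ → State pp → PMF Bool
  | .guess b', _, _ => PMF.pure b'
  | .query q next, k, σ =>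
    (answerWith (cellAt τ k) E mk b σ q).bind fun r => playWith τ E mk b (next r.1) (k + 1) r.2

theorem playWith_congr {τ τ' : Tape pp N} (E : Encoding pp) (mk : MasterKey pp) (b : Bool)
    (A : Adversary pp) (k : ℕ) (σ : State pp) (h : ∀ j, k ≤ j → cellAt τ j = cellAt τ' j) :
    playWith τ E mk b A k σ = playWith τ' E mk b A k σ := by
  induction A generalizing k σ with
  | guess b' => rfl
  | query q next ih =>
    simp only [playWith, h k le_rfl]
    congr 1; funext r
    exact ih r.1 (k + 1) r.2 fun j hj => h j (by omega)

theorem play_eq (E : Encoding pp) (mk : MasterKey pp) (b : Bool) (A : Adversary pp) (k n : ℕ)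
    (hk : k + n ≤ N) (hA : A.CostLE n) (σ : State pp) :
    play E mk b A σ =
      (PMF.uniformOfFintype (Tape pp N)).bind fun τ => playWith τ E mk b A k σ := by
  induction A generalizing k n σ with
  | guess b' => exact (PMF.bind_const _ _).symm
  | query q next ih =>
    obtain ⟨hq, hnext⟩ := hA
    have hq1 : 1 ≤ q.cost := by cases q <;> simp only [Query.cost] <;> omega
    have hkN : k < N := by omega
    rw [uniform_tape_bind ⟨k, hkN⟩]
    have h1 : ∀ c, ((PMF.uniformOfFintype (Tape pp N)).bind fun τ =>
        playWith (Function.update τ ⟨k, hkN⟩ c) E mk b (.query q next) k σ) =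
        (answerWith c E mk b σ q).bind fun r => play E mk b (next r.1) r.2 := by
      intro c
      have h2 : ∀ τ : Tape pp N, playWith (Function.update τ ⟨k, hkN⟩ c) E mk b
          (.query q next) k σ = (answerWith c E mk b σ q).bind fun r =>
            playWith τ E mk b (next r.1) (k + 1) r.2 := by
        intro τ
        have h3 : cellAt (Function.update τ ⟨k, hkN⟩ c) k = c := by simp [cellAt, hkN]
        simp only [playWith, h3]
        congr 1; funext r
        refine playWith_congr _ _ _ _ _ _ fun j hj => ?_
        simp only [cellAt]
        split_ifs with hjN
        · rw [Function.update_of_ne]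
          simp only [ne_eq, Fin.mk.injEq]; omega
        · rfl
      simp only [h2]
      rw [PMF.bind_comm]
      congr 1; funext r
      exact (ih r.1 (k + 1) (n - q.cost) (by omega) (hnext r.1) r.2).symm
    simp only [h1, play]
    rw [answer_eq (N := N) E mk b σ q (by omega), PMF.bind_bind]

end

section

/-! ### Hidden variables and obtainable exponents -/

/-- The values of all hidden variables except `β`: the exponent `α`, the coefficients of the
revocation polynomial and the coins of the challenger. -/
abbrev Vec (pp : Params) (N : ℕ) : Type :=
  Scalar pp × (Fin (pp.t + 1) → Scalar pp) × Tape pp N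

/-- The values of all hidden variables. -/
abbrev Pt (pp : Params) (N : ℕ) : Type := (ZMod pp.p)ˣ × Vec pp N

variable {pp : Params} {N : ℕ}

namespace Pt

/-- The exponent `β`. -/
def β (x : Pt pp N) : Scalar pp := x.1

/-- The exponent `α`. -/
def α (x : Pt pp N) : Scalar pp := x.2.1

/-- The coefficients of the revocation polynomial. -/
def P (x : Pt pp N) : Fin (pp.t + 1) → Scalar pp := x.2.2.1

/-- The logarithm of the hash value at the place `v`. -/
def h (v : Fin N × Fin N) (x : Pt pp N) : Scalar pp := (x.2.2.2 v.1).1 v.2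

/-- The exponent `r` of the key of cell `k`. -/
def r (k : Fin N) (x : Pt pp N) : Scalar pp := (x.2.2.2 k).2.1

/-- The exponents `r_j` of the key of cell `k`. -/
def ρ (k l : Fin N) (x : Pt pp N) : Scalar pp := (x.2.2.2 k).2.2.1 l

/-- The exponent `s` of the ciphertext of cell `k`. -/
def s (k : Fin N) (x : Pt pp N) : Scalar pp := (x.2.2.2 k).2.2.2.1

/-- The coefficients of the sharing of the ciphertext of cell `k`. -/
def q (k : Fin N) (x : Pt pp N) : Fin N → Scalar pp := (x.2.2.2 k).2.2.2.2

end Pt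

/-- The value at `u` of the polynomial with coefficients `P`. -/
def polyEval (P : Fin (pp.t + 1) → Scalar pp) (u : Scalar pp) : Scalar pp :=
  ∑ i, P i * u ^ (i : ℕ)

/-- The share of the leaf `y` in the ciphertext of cell `k`. -/
noncomputable def shareAt [NeZero N] (T : AccessTree) (k : Fin N) (y : T.Leaf) (x : Pt pp N) :
    Scalar pp :=
  T.share (T.ofPos fun z => x.q k (slot N _ z)) (x.s k) y

/-- What the adversary knows about the state of the challenger: the state, with hidden variables
in place of their values. -/
structure Sym (pp : Params) (N : ℕ) where
  /-- the places of the hash values that have been determined -/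
  H : Attr → Option (Fin N × Fin N)
  /-- the secret keys, by their cells -/
  keys : Fin N → Option (Identity pp × Finset Attr)
  /-- the list of the secret keys -/
  issued : List (Identity pp × Finset Attr)
  /-- the points of the stored proxy key -/
  pxk : Option (Finset (Identity pp))
  /-- the revocation polynomial, in terms of the hidden variables -/
  P : (Fin (pp.t + 1) → Scalar pp) → Fin (pp.t + 1) → Scalar pp
  /-- the challenge, with the cell of the challenge ciphertext -/
  chal : Option (AccessTree × Finset (Identity pp) × Fin N)

/-- The value of the revocation polynomial at `u`. -/
def Sym.poly (st : Sym pp N) (u : Scalar pp) (x : Pt pp N) : Scalar pp := polyEval (st.P x.P) u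

/-- Functions of the revocation polynomial only. -/
def PolyOnly (a : Pt pp N → Scalar pp) : Prop :=
  ∃ a' : (Fin (pp.t + 1) → Scalar pp) → Scalar pp, a = fun x => a' x.P

section

variable [NeZero N]

/-- Exponents of elements of `G2` that span those that the adversary can obtain. Conversion
multiplies them by functions of the revocation polynomial; for the components of the challenge
ciphertext it is not available. -/
inductive Gen₂ (st : Sym pp N) : (Pt pp N → Scalar pp) → Prop
  | one {a : Pt pp N → Scalar pp} (ha : PolyOnly a) : Gen₂ st a
  | inv {a : Pt pp N → Scalar pp} (ha : PolyOnly a) : Gen₂ st fun x => a x * x.β⁻¹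
  | hash {a : Pt pp N → Scalar pp} (ha : PolyOnly a) (v : Fin N × Fin N) :
      Gen₂ st fun x => a x * x.h v
  | key {a : Pt pp N → Scalar pp} (ha : PolyOnly a) {k : Fin N} {κ : Identity pp × Finset Attr}
      (hk : st.keys k = some κ) : Gen₂ st fun x => a x * ((x.α + x.r k) * x.β⁻¹)
  | keyAttr {a : Pt pp N → Scalar pp} (ha : PolyOnly a) {k : Fin N}
      {κ : Identity pp × Finset Attr} (hk : st.keys k = some κ) (j : κ.2) {v : Fin N × Fin N}
      (hv : st.H j = some v) :
      Gen₂ st fun x => a x * (x.r k + x.h v * x.ρ k (slot N _ j) * st.poly 0 x)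
  | cipher {T : AccessTree} {RL : Finset (Identity pp)} {k : Fin N}
      (hT : st.chal = some (T, RL, k)) (y : T.Leaf) {v : Fin N × Fin N}
      (hv : st.H (T.att y) = some v) : Gen₂ st fun x => x.h v * shareAt T k y x

/-- Exponents of elements of `G1` that span those that the adversary can obtain. -/
inductive Gen₁ (st : Sym pp N) : (Pt pp N → Scalar pp) → Prop
  | iso {g : Pt pp N → Scalar pp} (hg : Gen₂ st g) : Gen₁ st g
  | beta : Gen₁ st fun x => x.β
  | key (k l : Fin N) : Gen₁ st fun x => x.ρ k l
  | keyUser {k : Fin N} {κ : Identity pp × Finset Attr} (hk : st.keys k = some κ) (j : κ.2) :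
      Gen₁ st fun x => x.ρ k (slot N _ j) * st.poly κ.1 x
  | cipher {T : AccessTree} {RL : Finset (Identity pp)} {k : Fin N}
      (hT : st.chal = some (T, RL, k)) : Gen₁ st fun x => x.β * x.s k
  | share {T : AccessTree} {RL : Finset (Identity pp)} {k : Fin N}
      (hT : st.chal = some (T, RL, k)) (y : T.Leaf) : Gen₁ st fun x => shareAt T k y x

/-- The obtainable exponents in the three groups, without the masked challenge message. -/
noncomputable def Sym.span (st : Sym pp N) : Grp → Submodule (Scalar pp) (Pt pp N → Scalar pp)
  | .G1 => Submodule.span _ {g | Gen₁ st g}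
  | .G2 => Submodule.span _ {g | Gen₂ st g}
  | .GT => Submodule.span _ {g | (∃ g₁ g₂, Gen₁ st g₁ ∧ Gen₂ st g₂ ∧ g = g₁ * g₂) ∨
      g = fun x => x.α}

end

/-! ### The mask of the challenge message is not obtainable -/

/-- An action of scalars on the hidden variables for which all generators are homogeneous. The
weights of `β`, `α`, `h`, `r`, `ρ`, `s` are `1000`, `10`, `100`, `10`, `-90`, `1`: the two terms of
`r + h ρ P(0)` have the same weight, and the mask `α s`, of weight `11`, shares its weight only with
those products of generators that matter for it. -/
def torus (c : (ZMod pp.p)ˣ) (x : Pt pp N) : Pt pp N :=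
  let w (e : ℤ) : Scalar pp := ((c ^ e : (ZMod pp.p)ˣ) : Scalar pp)
  (c ^ (1000 : ℤ) * x.1, w 10 * x.2.1, x.2.2.1, fun k =>
    (w 100 • (x.2.2.2 k).1, w 10 * (x.2.2.2 k).2.1, w (-90) • (x.2.2.2 k).2.2.1,
      w 1 * (x.2.2.2 k).2.2.2.1, w 1 • (x.2.2.2 k).2.2.2.2))

/-- The function `f` is homogeneous of weight `e`. -/
def Homog (e : ℤ) (f : Pt pp N → Scalar pp) : Prop :=
  ∀ c x, f (torus c x) = ((c ^ e : (ZMod pp.p)ˣ) : Scalar pp) * f x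

namespace Homog

variable {e e' : ℤ} {f f' : Pt pp N → Scalar pp}

theorem mul (h : Homog e f) (h' : Homog e' f') : Homog (e + e') fun x => f x * f' x :=
  fun c x => by
    simp only [h c x, h' c x]
    rw [zpow_add, Units.val_mul]
    ring

theorem add (h : Homog e f) (h' : Homog e f') : Homog e fun x => f x + f' x :=
  fun c x => by simp only [h c x, h' c x, mul_add]

theorem congr (h : Homog e f) (he : e = e') : Homog e' f := he ▸ h

theorem of_polyOnly {a : Pt pp N → Scalar pp} (ha : PolyOnly a) : Homog 0 a := fun c x => by
  obtain ⟨a, rfl⟩ := ha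
  simp only [zpow_zero, Units.val_one, one_mul]
  rfl

theorem inv_β : Homog (-1000) fun x : Pt pp N => x.β⁻¹ := fun c x => by
  simp only [Pt.β, torus, Units.val_mul, mul_inv]
  rw [zpow_neg, Units.val_inv_eq_inv_val]

theorem β : Homog 1000 (Pt.β : Pt pp N → _) := fun _ _ => rfl
theorem α : Homog 10 (Pt.α : Pt pp N → _) := fun _ _ => rfl
theorem h (v : Fin N × Fin N) : Homog 100 (Pt.h v : Pt pp N → _) := fun _ _ => rfl
theorem r (k : Fin N) : Homog 10 (Pt.r k : Pt pp N → _) := fun _ _ => rfl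
theorem ρ (k l : Fin N) : Homog (-90) (Pt.ρ k l : Pt pp N → _) := fun _ _ => rfl
theorem s (k : Fin N) : Homog 1 (Pt.s k : Pt pp N → _) := fun _ _ => rfl

theorem shareAt [NeZero N] (T : AccessTree) (k : Fin N) (y : T.Leaf) :
    Homog 1 (shareAt T k y : Pt pp N → _) := fun _ _ => T.share_ofPos_smul _ _ _ y

theorem poly (st : Sym pp N) (u : Scalar pp) : Homog 0 (st.poly u) :=
  of_polyOnly ⟨fun P => polyEval (st.P P) u, rfl⟩

end Homog

/-- Averaging with a character of the torus kills the functions of the wrong weights. -/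
theorem sum_units_zpow {p : ℕ} [Fact p.Prime] {e : ℤ} (he : e ≠ 0) (he' : |e| < p - 1) :
    ∑ c : (ZMod p)ˣ, ((c ^ e : (ZMod p)ˣ) : ZMod p) = 0 := by
  obtain ⟨g, hg⟩ := IsCyclic.exists_generator (α := (ZMod p)ˣ)
  have hord : orderOf g = p - 1 := by
    rw [orderOf_eq_card_of_forall_mem_zpowers hg, Nat.card_eq_fintype_card, ZMod.card_units]
  have h1 : ((g ^ e : (ZMod p)ˣ) : ZMod p) ≠ 1 := by
    intro h
    have h2 : g ^ e = 1 := Units.ext h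
    rw [← orderOf_dvd_iff_zpow_eq_one, hord] at h2
    have h3 := Int.le_of_dvd (abs_pos.2 he) ((dvd_abs _ _).2 h2)
    have := (Fact.out : p.Prime).one_le
    push_cast [this] at h3
    omega
  have h2 : ∑ c : (ZMod p)ˣ, ((c ^ e : (ZMod p)ˣ) : ZMod p) =
      ((g ^ e : (ZMod p)ˣ) : ZMod p) * ∑ c : (ZMod p)ˣ, ((c ^ e : (ZMod p)ˣ) : ZMod p) := by
    rw [Finset.mul_sum, ← Equiv.sum_comp (Equiv.mulLeft g)]
    simp [mul_zpow]
  have h3 : (1 - ((g ^ e : (ZMod p)ˣ) : ZMod p)) *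
      ∑ c : (ZMod p)ˣ, ((c ^ e : (ZMod p)ˣ) : ZMod p) = 0 := by
    rw [sub_mul, one_mul, sub_eq_zero]; exact h2
  exact (mul_eq_zero.1 h3).resolve_left (sub_ne_zero.2 h1.symm)

/-- A point with `β = 1` at which the variables `s` and `q` of only the cell `k` do not vanish. -/
def basePoint (k : Fin N) (α : Scalar pp) (P : Fin (pp.t + 1) → Scalar pp)
    (h : Fin N × Fin N → Scalar pp) (r : Fin N → Scalar pp) (ρ : Fin N → Fin N → Scalar pp)
    (q : Fin N → Scalar pp) : Pt pp N :=
  (1, α, P, fun k' => (fun l => h (k', l), r k', ρ k', if k' = k then 1 else 0, q))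

section Base

variable {st : Sym pp N} {k : Fin N} (α : Scalar pp) (P : Fin (pp.t + 1) → Scalar pp)
    (h : Fin N × Fin N → Scalar pp) (r : Fin N → Scalar pp) (ρ : Fin N → Fin N → Scalar pp)
    (q : Fin N → Scalar pp)

theorem basePoint_α : (basePoint k α P h r ρ q).α = α := rfl
theorem basePoint_β : (basePoint k α P h r ρ q).β = 1 := rfl
theorem basePoint_h (v : Fin N × Fin N) : (basePoint k α P h r ρ q).h v = h v := rfl
theorem basePoint_r (k' : Fin N) : (basePoint k α P h r ρ q).r k' = r k' := rfl
theorem basePoint_ρ (k' l : Fin N) : (basePoint k α P h r ρ q).ρ k' l = ρ k' l := rfl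
theorem basePoint_s : (basePoint k α P h r ρ q).s k = 1 := if_pos rfl
theorem basePoint_poly (u : Scalar pp) :
    st.poly u (basePoint k α P h r ρ q) = polyEval (st.P P) u := rfl
end Base

variable [NeZero N]

/-- The weights of the generators, with their form where the weight alone does not exclude that a
product with the generator has the weight of the mask. -/
theorem Gen₂.weight {st : Sym pp N} {g : Pt pp N → Scalar pp} (hg : Gen₂ st g) :
    ∃ e, Homog e g ∧ (e = 0 ∨ e = -1000 ∨ e = 100 ∨
      (e = -990 ∧ ∃ a k κ, PolyOnly a ∧ st.keys k = some κ ∧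
        g = fun x => a x * ((x.α + x.r k) * x.β⁻¹)) ∨
      (e = 10 ∧ ∃ a k κ, ∃ j : (κ : Identity pp × Finset Attr).2, ∃ v, PolyOnly a ∧
        st.keys k = some κ ∧ st.H j = some v ∧
        g = fun x => a x * (x.r k + x.h v * x.ρ k (slot N _ j) * st.poly 0 x)) ∨
      (e = 101 ∧ ∃ T RL k y v, st.chal = some (T, RL, k) ∧ st.H (T.att y) = some v ∧
        g = fun x => x.h v * shareAt T k y x)) := by
  cases hg with
  | one ha => exact ⟨0, .of_polyOnly ha, by simp⟩
  | inv ha => exact ⟨-1000, ((Homog.of_polyOnly ha).mul .inv_β).congr (by norm_num), by simp⟩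
  | hash ha v => exact ⟨100, ((Homog.of_polyOnly ha).mul (.h v)).congr (by norm_num), by simp⟩
  | @key a ha k κ hk =>
    exact ⟨-990, ((Homog.of_polyOnly ha).mul ((Homog.α.add (.r k)).mul .inv_β)).congr (by norm_num),
      by right; right; right; left; exact ⟨rfl, a, k, κ, ha, hk, rfl⟩⟩
  | @keyAttr a ha k κ hk j v hv =>
    refine ⟨10, ((Homog.of_polyOnly ha).mul ((Homog.r k).add
      ((((Homog.h v).mul (.ρ k (slot N _ j))).mul (.poly st 0)).congr (by norm_num)))).congr
        (by norm_num), by right; right; right; right; left; exact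
        ⟨rfl, a, k, κ, j, v, ha, hk, hv, rfl⟩⟩
  | @cipher T RL k hT y v hv =>
    exact ⟨101, ((Homog.h v).mul (.shareAt T k y)).congr (by norm_num),
      by right; right; right; right; right; exact ⟨rfl, T, RL, k, y, v, hT, hv, rfl⟩⟩

/-- The weights of the generators of `G1`, as for `G2`. -/
theorem Gen₁.weight {st : Sym pp N} {g : Pt pp N → Scalar pp} (hg : Gen₁ st g) :
    ∃ e, Homog e g ∧ (e = 0 ∨ e = -1000 ∨ e = 100 ∨ e = -990 ∨ e = 10 ∨ e = 101 ∨ e = 1000 ∨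
      (e = -90 ∧ ((∃ k l, g = fun x => x.ρ k l) ∨ ∃ k κ, ∃ j : (κ : Identity pp × Finset Attr).2,
        st.keys k = some κ ∧ g = fun x => x.ρ k (slot N _ j) * st.poly κ.1 x)) ∨
      (e = 1001 ∧ ∃ T RL k, st.chal = some (T, RL, k) ∧ g = fun x => x.β * x.s k) ∨
      (e = 1 ∧ ∃ T RL k y, st.chal = some (T, RL, k) ∧ g = fun x => shareAt T k y x)) := by
  cases hg with
  | iso hg =>
    obtain ⟨e, he, h⟩ := hg.weight
    exact ⟨e, he, by tauto⟩
  | beta => exact ⟨1000, .β, by simp⟩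
  | key k l =>
    refine ⟨-90, .ρ k l, ?_⟩
    right; right; right; right; right; right; right; left
    exact ⟨rfl, Or.inl ⟨k, l, rfl⟩⟩
  | @keyUser k κ hk j =>
    refine ⟨-90, ((Homog.ρ k (slot N _ j)).mul (.poly st _)).congr (by norm_num), ?_⟩
    right; right; right; right; right; right; right; left
    exact ⟨rfl, Or.inr ⟨k, κ, j, hk, rfl⟩⟩
  | @cipher T RL k hT =>
    refine ⟨1001, (Homog.β.mul (.s k)).congr (by norm_num), ?_⟩
    right; right; right; right; right; right; right; right; left
    exact ⟨rfl, T, RL, k, hT, rfl⟩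
  | @share T RL k hT y =>
    refine ⟨1, .shareAt T k y, ?_⟩
    right; right; right; right; right; right; right; right; right
    exact ⟨rfl, T, RL, k, y, hT, rfl⟩

/-- The conditions under which the challenge ciphertext hides the message: different attributes
have different hash values, the attributes of keys have been hashed, the revocation polynomial is
known at the revoked users only, and the issued keys are compatible with the challenge. -/
structure Sym.Secure (st : Sym pp N) (T : AccessTree) (RL : Finset (Identity pp)) (k : Fin N) :
    Prop where
  chal : st.chal = some (T, RL, k)
  size : T.size < pp.p
  card_pos : Fintype.card T.Pos ≤ N
  hash_inj : ∀ a a' v, st.H a = some v → st.H a' = some v → a = a'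
  hash_key : ∀ k κ, st.keys k = some κ → ∀ a ∈ κ.2, st.H a ≠ none
  poly_zero : ∀ P, polyEval (st.P P) 0 = P 0
  poly_revoked : ∀ u ∈ RL, ∀ P P', polyEval (st.P P) (u : Scalar pp) = polyEval (st.P P') u
  compatible : ∀ k κ, st.keys k = some κ → Compatible T RL κ.1 κ.2

variable {st : Sym pp N} {T : AccessTree} {RL : Finset (Identity pp)} {k : Fin N}

/-- By the secrecy of the sharing, there is a sharing of the secret `1` in which a key of a user who
is not revoked gets the shares `0`. -/
theorem Sym.Secure.exists_coins (hs : st.Secure T RL k) (k' : Fin N) :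
    ∃ q : Fin N → Scalar pp, ∀ κ, st.keys k' = some κ → κ.1 ∉ RL → ∀ y, T.att y ∈ κ.2 →
      T.share (T.ofPos fun z => q (slot N _ z)) 1 y = 0 := by
  cases hk : st.keys k' with
  | none => exact ⟨0, by simp⟩
  | some κ =>
    by_cases hu : κ.1 ∈ RL
    · refine ⟨0, ?_⟩
      rintro κ' h hu'
      rw [Option.some.injEq] at h
      subst h
      exact absurd hu hu'
    · have hS := (hs.compatible _ _ hk).resolve_left hu
      have hF : ∀ i : ℕ, 0 < i → i ≤ T.size → (i : Scalar pp) ≠ 0 := by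
        intro i hi hi' h
        rw [ZMod.natCast_eq_zero_iff] at h
        have := Nat.le_of_dvd hi h
        have := hs.size
        omega
      obtain ⟨g, hg⟩ := T.exists_share_eq_zero κ.2 hS hF
      refine ⟨Function.extend (slot N _) g 0, ?_⟩
      rintro κ' h - y hy
      rw [Option.some.injEq] at h
      subst h
      simp only [(slot_injective hs.card_pos).extend_apply]
      exact hg y hy

/-- Evaluation at a point. -/
def evalAt (x : Pt pp N) : (Pt pp N → Scalar pp) →ₗ[Scalar pp] Scalar pp := LinearMap.proj x

/-- The functional that separates the mask `α s` from the obtainable exponents. The coins `q k'` are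
those of a sharing of the secret `1` in which the leaves of the attributes of the key `k'` get the
share `0`. It evaluates at a point at which, among the functions of weight `11`, only the mask and
the products of `β s` with the first components of keys do not vanish, corrects the value at the
latter for each key `k'` at a point with `r k' = 1`, and so on for the products of shares with the
components `r + h ρ P(0)` of keys. The last correction is a difference of values for two choices of
the hidden coefficients. As the values of the revocation polynomial at the revoked users do not
depend on them, the components `ρ P(u)` of the keys of these users drop out. -/
noncomputable def separator (st : Sym pp N) (k : Fin N) (q : Fin N → Fin N → Scalar pp) :
    (Pt pp N → Scalar pp) →ₗ[Scalar pp] Scalar pp :=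
  evalAt (basePoint k 1 (Pi.single 0 1) 0 0 0 0) -
    ∑ k', (st.keys k').elim 0 fun κ =>
      evalAt (basePoint k 0 (Pi.single 0 1) 0 (Pi.single k' 1) 0 (q k')) -
        ∑ j : κ.2, (st.H j).elim 0 fun v =>
          evalAt (basePoint k 0 (Pi.single 0 1) (Pi.single v 1) 0
            (Pi.single k' (Pi.single (slot N _ j) 1)) (q k')) -
          evalAt (basePoint k 0 0 (Pi.single v 1) 0
            (Pi.single k' (Pi.single (slot N _ j) 1)) (q k'))

theorem separator_apply (q : Fin N → Fin N → Scalar pp) (f : Pt pp N → Scalar pp) :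
    separator st k q f = f (basePoint k 1 (Pi.single 0 1) 0 0 0 0) -
      ∑ k', (st.keys k').elim 0 fun κ =>
        f (basePoint k 0 (Pi.single 0 1) 0 (Pi.single k' 1) 0 (q k')) -
          ∑ j : κ.2, (st.H j).elim 0 fun v =>
            f (basePoint k 0 (Pi.single 0 1) (Pi.single v 1) 0
              (Pi.single k' (Pi.single (slot N _ j) 1)) (q k')) -
            f (basePoint k 0 0 (Pi.single v 1) 0
              (Pi.single k' (Pi.single (slot N _ j) 1)) (q k')) := by
  simp only [separator, LinearMap.sub_apply, LinearMap.sum_apply]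
  congr 1
  refine Finset.sum_congr rfl fun k' _ => ?_
  cases st.keys k' with
  | none => rfl
  | some κ =>
    simp only [Option.elim_some, LinearMap.sub_apply, LinearMap.sum_apply]
    congr 1
    refine Finset.sum_congr rfl fun j _ => ?_
    cases st.H j <;> rfl

theorem basePoint_shareAt (α : Scalar pp) (P : Fin (pp.t + 1) → Scalar pp)
    (h : Fin N × Fin N → Scalar pp) (r : Fin N → Scalar pp) (ρ : Fin N → Fin N → Scalar pp)
    (q : Fin N → Scalar pp) (y : T.Leaf) : shareAt T k y (basePoint k α P h r ρ q) =
    T.share (T.ofPos fun z => q (slot N _ z)) 1 y := by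
  rw [shareAt, basePoint_s]
  rfl

theorem separator_mask (q : Fin N → Fin N → Scalar pp) :
    separator st k q (fun x => x.α * x.s k) = 1 := by
  rw [separator_apply, Finset.sum_eq_zero]
  · simp [basePoint_α, basePoint_s]
  · intro k' _
    cases st.keys k' with
    | none => rfl
    | some κ =>
      simp only [basePoint_α, zero_mul, sub_self, Option.elim_some, zero_sub, neg_eq_zero]
      refine Finset.sum_eq_zero fun j _ => ?_
      cases st.H j <;> rfl

theorem separator_key (q : Fin N → Fin N → Scalar pp) {a : Pt pp N → Scalar pp} (ha : PolyOnly a)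
    {k₀ : Fin N} {κ : Identity pp × Finset Attr} (hk : st.keys k₀ = some κ) :
    separator st k q (fun x => x.β * x.s k * (a x * ((x.α + x.r k₀) * x.β⁻¹))) = 0 := by
  obtain ⟨a, rfl⟩ := ha
  have h1 : ∀ α P h r ρ q, (basePoint (pp := pp) (N := N) k α P h r ρ q).P = P :=
    fun _ _ _ _ _ _ => rfl
  rw [separator_apply, Finset.sum_eq_single k₀]
  · rw [hk, Option.elim_some, Finset.sum_eq_zero]
    · simp [basePoint_α, basePoint_s, basePoint_β, basePoint_r, h1]
    · intro j _
      cases st.H j with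
      | none => rfl
      | some v => simp [basePoint_α, basePoint_s, basePoint_β, basePoint_r]
  · intro k' _ hk'
    cases st.keys k' with
    | none => rfl
    | some κ =>
      rw [Option.elim_some, Finset.sum_eq_zero]
      · simp [basePoint_α, basePoint_r, hk'.symm]
      · intro j _
        cases st.H j with
        | none => rfl
        | some v => simp [basePoint_α, basePoint_r]
  · simp

theorem separator_keyAttr (hs : st.Secure T RL k) (q : Fin N → Fin N → Scalar pp)
    {a : Pt pp N → Scalar pp} (ha : PolyOnly a) {k₀ : Fin N} {κ : Identity pp × Finset Attr}
    (hk : st.keys k₀ = some κ) (j : κ.2) {v : Fin N × Fin N} (hv : st.H j = some v)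
    (y : T.Leaf) :
    separator st k q (fun x => shareAt T k y x *
      (a x * (x.r k₀ + x.h v * x.ρ k₀ (slot N _ j) * st.poly 0 x))) = 0 := by
  obtain ⟨a, rfl⟩ := ha
  have h1 : ∀ α P h r ρ q, (basePoint (pp := pp) (N := N) k α P h r ρ q).P = P :=
    fun _ _ _ _ _ _ => rfl
  rw [separator_apply]
  simp only [basePoint_r, basePoint_h, basePoint_ρ, basePoint_shareAt, basePoint_poly,
    hs.poly_zero, h1]
  rw [Finset.sum_eq_single k₀]
  · rw [hk, Option.elim_some, Finset.sum_eq_single j]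
    · simp [hv]
    · intro j' _ hj'
      cases hj : st.H j' with
      | none => rfl
      | some v' =>
        have hvv : v ≠ v' := by
          rintro rfl
          exact hj' (Subtype.ext (hs.hash_inj _ _ _ hj hv))
        simp [hvv]
    · simp
  · intro k' _ hk'
    cases st.keys k' with
    | none => rfl
    | some κ =>
      rw [Option.elim_some, Finset.sum_eq_zero]
      · simp [hk'.symm]
      · intro j _
        cases st.H j with
        | none => rfl
        | some v => simp [hk'.symm]
  · simp

theorem separator_cipher_of_eq {q : Fin N → Fin N → Scalar pp} {y : T.Leaf} {v : Fin N × Fin N}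
    {g : Pt pp N → Scalar pp} {k₀ l : Fin N} (c : (Fin (pp.t + 1) → Scalar pp) → Scalar pp)
    (h : ∀ κ, st.keys k₀ = some κ → ∀ j : κ.2, st.H j = some v → slot N _ j = l →
      T.share (T.ofPos fun z => q k₀ (slot N _ z)) 1 y * (c (Pi.single 0 1) - c 0) = 0)
    (hg : g = fun x => x.ρ k₀ l * c x.P) :
    separator st k q (fun x => g x * (x.h v * shareAt T k y x)) = 0 := by
  subst hg
  have h1 : ∀ α P h r ρ q, (basePoint (pp := pp) (N := N) k α P h r ρ q).P = P :=
    fun _ _ _ _ _ _ => rfl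
  rw [separator_apply]
  simp only [basePoint_h, basePoint_ρ, basePoint_shareAt, h1]
  rw [Finset.sum_eq_zero]
  · simp
  · intro k' _
    cases hk : st.keys k' with
    | none => rfl
    | some κ =>
      rw [Option.elim_some, Finset.sum_eq_zero]
      · simp
      · intro j _
        cases hj : st.H j with
        | none => rfl
        | some v' =>
          rw [Option.elim_some]
          by_cases hk' : k₀ = k'
          · subst hk'
            by_cases hv : v = v'
            · subst hv
              by_cases hl : l = slot N _ j
              · have := h κ hk j hj hl.symm
                simp only [hl, Pi.single_eq_same, one_mul]
                rw [← this]
                ring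
              · simp [hl]
            · simp [hv]
          · simp [hk']

theorem separator_cipher (hs : st.Secure T RL k) {q : Fin N → Fin N → Scalar pp}
    (hq : ∀ k' κ, st.keys k' = some κ → κ.1 ∉ RL → ∀ y, T.att y ∈ κ.2 →
      T.share (T.ofPos fun z => q k' (slot N _ z)) 1 y = 0)
    {y : T.Leaf} {v : Fin N × Fin N} (hv : st.H (T.att y) = some v) {g : Pt pp N → Scalar pp}
    (hg : (∃ k l, g = fun x => x.ρ k l) ∨ ∃ k κ, ∃ j : (κ : Identity pp × Finset Attr).2,
        st.keys k = some κ ∧ g = fun x => x.ρ k (slot N _ j) * st.poly κ.1 x) :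
    separator st k q (fun x => g x * (x.h v * shareAt T k y x)) = 0 := by
  rcases hg with ⟨k₀, l, rfl⟩ | ⟨k₀, κ, j, hk, rfl⟩
  · exact separator_cipher_of_eq (k₀ := k₀) (l := l) (fun _ => 1) (by simp) (by simp)
  · refine separator_cipher_of_eq (fun P => polyEval (st.P P) κ.1) ?_ rfl
    intro κ' hκ' j' hj' _
    rw [hk, Option.some.injEq] at hκ'
    subst hκ'
    by_cases hu : κ.1 ∈ RL
    · rw [hs.poly_revoked _ hu _ 0, sub_self, mul_zero]
    · rw [hq _ _ hk hu, zero_mul]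
      rw [hs.hash_inj _ _ _ hv hj']
      exact j'.2

/-- The mask of the challenge message is not obtainable. -/
theorem Sym.Secure.mask_notMem (hs : st.Secure T RL k) (hp : 5000 < pp.p) :
    (fun x : Pt pp N => x.α * x.s k) ∉ st.span .GT := by
  choose q hq using hs.exists_coins
  -- `W` composes the separator with the projection to the functions of weight `11`, which is
  -- an average over the torus; it distinguishes the occurring weights as they differ by less
  -- than `p - 1`.
  let W : (Pt pp N → Scalar pp) →ₗ[Scalar pp] Scalar pp :=
    ∑ c : (ZMod pp.p)ˣ, ((c ^ (-11 : ℤ) : (ZMod pp.p)ˣ) : Scalar pp) •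
      (separator st k q ∘ₗ LinearMap.funLeft (Scalar pp) (Scalar pp) (torus c))
  have hW : ∀ e f, Homog e f → W f =
      (∑ c : (ZMod pp.p)ˣ, ((c ^ (e - 11) : (ZMod pp.p)ˣ) : Scalar pp)) *
        separator st k q f := by
    intro e f hf
    simp only [W, LinearMap.sum_apply, LinearMap.smul_apply, LinearMap.comp_apply, smul_eq_mul]
    rw [Finset.sum_mul]
    refine Finset.sum_congr rfl fun c _ => ?_
    have : LinearMap.funLeft (Scalar pp) (Scalar pp) (torus c) f =
        ((c ^ e : (ZMod pp.p)ˣ) : Scalar pp) • f := by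
      ext x
      exact hf c x
    rw [this, map_smul, smul_eq_mul, sub_eq_add_neg, zpow_add, Units.val_mul]
    ring
  have hW0 : ∀ e f, Homog e f → e ≠ 11 → |e - 11| < 4000 → W f = 0 := by
    intro e f hf he he'
    rw [hW e f hf, sum_units_zpow (by omega) (by omega), zero_mul]
  have hmask : W (fun x : Pt pp N => x.α * x.s k) ≠ 0 := by
    rw [hW 11 _ ((Homog.α.mul (.s k)).congr (by norm_num)), separator_mask]
    simp only [sub_self, zpow_zero, Units.val_one, Finset.sum_const, Finset.card_univ,
      ZMod.card_units, nsmul_eq_mul, mul_one]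
    rw [Nat.cast_sub pp.prime.one_le]
    simp
  intro hmem
  apply hmask
  have hker : st.span .GT ≤ LinearMap.ker W := by
    refine Submodule.span_le.2 ?_
    rintro g (⟨g₁, g₂, hg₁, hg₂, rfl⟩ | rfl)
    · obtain ⟨e₁, h₁, hc₁⟩ := hg₁.weight
      obtain ⟨e₂, h₂, hc₂⟩ := hg₂.weight
      have h12 : Homog (e₁ + e₂) (g₁ * g₂) := h₁.mul h₂
      by_cases he : e₁ + e₂ = 11
      swap
      · exact hW0 _ _ h12 he (by rw [abs_lt]; omega)
      · have hz : separator st k q (g₁ * g₂) = 0 := by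
          -- The pairing values `β s · (α + r) / β`, `q_y · (r + h ρ P(0))` and `ρ · h q_y`.
          have h3 : (e₁ = 1001 ∧ e₂ = -990) ∨ (e₁ = 1 ∧ e₂ = 10) ∨ (e₁ = -90 ∧ e₂ = 101) := by
            omega
          rcases h3 with ⟨rfl, rfl⟩ | ⟨rfl, rfl⟩ | ⟨rfl, rfl⟩
          · rcases hc₁ with h | h | h | h | h | h | h | ⟨h, hc₁⟩ | ⟨h, hc₁⟩ | ⟨h, hc₁⟩ <;>
              try (exfalso; omega)
            rcases hc₂ with h | h | h | ⟨h, hc₂⟩ | ⟨h, hc₂⟩ | ⟨h, hc₂⟩ <;> try (exfalso; omega)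
            obtain ⟨T', RL', k', hT', rfl⟩ := hc₁
            obtain ⟨a, k₀, κ, ha, hk, rfl⟩ := hc₂
            rw [hs.chal] at hT'
            cases hT'
            exact separator_key q ha hk
          · rcases hc₁ with h | h | h | h | h | h | h | ⟨h, hc₁⟩ | ⟨h, hc₁⟩ | ⟨h, hc₁⟩ <;>
              try (exfalso; omega)
            rcases hc₂ with h | h | h | ⟨h, hc₂⟩ | ⟨h, hc₂⟩ | ⟨h, hc₂⟩ <;> try (exfalso; omega)
            obtain ⟨T', RL', k', y, hT', rfl⟩ := hc₁
            obtain ⟨a, k₀, κ, j, v, ha, hk, hv, rfl⟩ := hc₂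
            rw [hs.chal] at hT'
            cases hT'
            exact separator_keyAttr hs q ha hk j hv y
          · rcases hc₁ with h | h | h | h | h | h | h | ⟨h, hc₁⟩ | ⟨h, hc₁⟩ | ⟨h, hc₁⟩ <;>
              try (exfalso; omega)
            rcases hc₂ with h | h | h | ⟨h, hc₂⟩ | ⟨h, hc₂⟩ | ⟨h, hc₂⟩ <;> try (exfalso; omega)
            obtain ⟨T', RL', k', y, v, hT', hv, rfl⟩ := hc₂
            rw [hs.chal] at hT'
            cases hT'
            exact separator_cipher hs hq hv hc₁
        show W _ = 0
        rw [hW _ _ h12, hz, mul_zero]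
    · exact hW0 10 _ .α (by norm_num) (by norm_num)
  exact hker hmem

end

section

/-! ### Functions of low degree -/

theorem LinePoly.comp {F E E' : Type*} [Field F] [AddCommGroup E] [Module F E] [AddCommGroup E']
    [Module F E'] {d : ℕ} {f : E → F} (hf : LinePoly d f) (φ : E' → E)
    (hφ : ∀ a b, ∃ a' b', ∀ t : F, φ (a + t • b) = a' + t • b') :
    LinePoly d fun x => f (φ x) := fun a b => by
  obtain ⟨a', b', h⟩ := hφ a b
  obtain ⟨q, hq, h'⟩ := hf a' b'
  exact ⟨q, hq, fun t => by simp only [h, h']⟩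

variable {pp : Params} {N : ℕ}

/-- The functions that after multiplication by `β ^ e` are polynomials of degree at most `d`. -/
def lowDeg (pp : Params) (N e d : ℕ) : Submodule (Scalar pp) (Pt pp N → Scalar pp) where
  carrier := {f | ∃ q : Scalar pp × Vec pp N → Scalar pp, LinePoly d q ∧
    ∀ x : Pt pp N, q (x.1, x.2) = x.β ^ e * f x}
  add_mem' := by
    rintro f g ⟨q, hq, h⟩ ⟨q', hq', h'⟩
    exact ⟨q + q', hq.add hq', fun x => by simp [h, h', mul_add]⟩
  zero_mem' := ⟨fun _ => 0, LinePoly.const 0, fun x => by simp⟩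
  smul_mem' := by
    rintro c f ⟨q, hq, h⟩
    exact ⟨c • q, hq.smul c, fun x => by simp [h]; ring⟩

section LowDeg

variable {e e' d d' : ℕ} {f g : Pt pp N → Scalar pp}

theorem lowDeg_mono (hf : f ∈ lowDeg pp N e d) (hd : d ≤ d') : f ∈ lowDeg pp N e d' := by
  obtain ⟨q, hq, h⟩ := hf
  exact ⟨q, hq.mono hd, h⟩

theorem lowDeg_mul (hf : f ∈ lowDeg pp N e d) (hg : g ∈ lowDeg pp N e' d') :
    (fun x => f x * g x) ∈ lowDeg pp N (e + e') (d + d') := by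
  obtain ⟨q, hq, h⟩ := hf
  obtain ⟨q', hq', h'⟩ := hg
  exact ⟨q * q', hq.mul hq', fun x => by rw [Pi.mul_apply, h, h', pow_add]; ring⟩

theorem lowDeg_add (hf : f ∈ lowDeg pp N e d) (hg : g ∈ lowDeg pp N e d) :
    (fun x => f x + g x) ∈ lowDeg pp N e d := Submodule.add_mem _ hf hg

theorem lowDeg_of_linear (φ : Vec pp N →ₗ[Scalar pp] Scalar pp) :
    (fun x : Pt pp N => φ x.2) ∈ lowDeg pp N 0 1 :=
  ⟨fun y => φ y.2, (LinePoly.linear φ).comp _ fun a b => ⟨a.2, b.2, fun _ => rfl⟩,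
    fun x => by simp⟩

theorem lowDeg_const (c : Scalar pp) : (fun _ : Pt pp N => c) ∈ lowDeg pp N 0 d :=
  ⟨fun _ => c, .const c, fun x => by simp⟩

theorem linePoly_fst : LinePoly 1 fun y : Scalar pp × Vec pp N => y.1 :=
  LinePoly.linear (LinearMap.fst (Scalar pp) (Scalar pp) (Vec pp N))

theorem lowDeg_β : (Pt.β : Pt pp N → _) ∈ lowDeg pp N 0 1 :=
  ⟨fun y => y.1, linePoly_fst, fun x => by simp [Pt.β]⟩

theorem lowDeg_invβ : (fun x : Pt pp N => x.β⁻¹) ∈ lowDeg pp N 1 0 :=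
  ⟨fun _ => 1, .const 1, fun x => by
    rw [pow_one]
    exact (mul_inv_cancel₀ x.1.ne_zero).symm⟩

theorem lowDeg_raise (hf : f ∈ lowDeg pp N e d) : f ∈ lowDeg pp N (e + 1) (d + 1) := by
  obtain ⟨q, hq, h⟩ := hf
  refine ⟨q * fun y => y.1, hq.mul linePoly_fst, fun x => ?_⟩
  rw [Pi.mul_apply, h, pow_succ]
  simp only [Pt.β]
  ring

theorem lowDeg_α : (Pt.α : Pt pp N → _) ∈ lowDeg pp N 0 1 :=
  lowDeg_of_linear (LinearMap.fst _ _ _)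

theorem lowDeg_h (v : Fin N × Fin N) : (Pt.h v : Pt pp N → _) ∈ lowDeg pp N 0 1 :=
  lowDeg_of_linear ⟨⟨fun y => (y.2.2 v.1).1 v.2, fun _ _ => rfl⟩, fun _ _ => rfl⟩

theorem lowDeg_r (k : Fin N) : (Pt.r k : Pt pp N → _) ∈ lowDeg pp N 0 1 :=
  lowDeg_of_linear ⟨⟨fun y => (y.2.2 k).2.1, fun _ _ => rfl⟩, fun _ _ => rfl⟩

theorem lowDeg_ρ (k l : Fin N) : (Pt.ρ k l : Pt pp N → _) ∈ lowDeg pp N 0 1 :=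
  lowDeg_of_linear ⟨⟨fun y => (y.2.2 k).2.2.1 l, fun _ _ => rfl⟩, fun _ _ => rfl⟩

theorem lowDeg_s (k : Fin N) : (Pt.s k : Pt pp N → _) ∈ lowDeg pp N 0 1 :=
  lowDeg_of_linear ⟨⟨fun y => (y.2.2 k).2.2.2.1, fun _ _ => rfl⟩, fun _ _ => rfl⟩

theorem lowDeg_shareAt [NeZero N] (T : AccessTree) (k : Fin N) (y : T.Leaf) :
    (shareAt T k y : Pt pp N → _) ∈ lowDeg pp N 0 1 := by
  refine lowDeg_of_linear (φ := ⟨⟨fun z : Vec pp N =>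
    T.share (T.ofPos fun w => (z.2.2 k).2.2.2.2 (slot N _ w)) (z.2.2 k).2.2.2.1 y, ?_⟩, ?_⟩)
  · intro a b
    have := T.share_ofPos_linear (1 : Scalar pp) (a.2.2 k).2.2.2.1 (b.2.2 k).2.2.2.1
      (fun w => (a.2.2 k).2.2.2.2 (slot N _ w)) (fun w => (b.2.2 k).2.2.2.2 (slot N _ w)) y
    rw [one_smul, one_mul, one_mul] at this
    exact this
  · intro c a
    exact T.share_ofPos_smul _ _ _ y

/-- A function of low degree that does not vanish identically has few zeros. -/
theorem lowDeg_mean_zero_le (hf : f ∈ lowDeg pp N e d) (h0 : f ≠ 0) :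
    (mean fun x => if f x = 0 then 1 else 0) ≤ (4 * d : ℕ) * (pp.p : ℝ≥0∞)⁻¹ := by
  obtain ⟨q, hq, h⟩ := hf
  obtain ⟨x₀, hx₀⟩ := Function.ne_iff.1 h0
  have hβ : ∀ x : Pt pp N, x.β ^ e ≠ 0 := fun x => pow_ne_zero _ x.1.ne_zero
  have hq0 : q (x₀.1, x₀.2) ≠ 0 := by
    rw [h]; exact mul_ne_zero (hβ _) hx₀
  have h1 := hq.card_zeros_le hq0
  rw [Fintype.card_prod, ZMod.card] at h1
  set Z := (Finset.univ.filter fun x : Pt pp N => f x = 0).card with hZ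
  have h2 : Z ≤ (Finset.univ.filter fun y => q y = 0).card := by
    refine Finset.card_le_card_of_injOn (fun x : Pt pp N => ((x.1 : Scalar pp), x.2)) ?_ ?_
    · intro x hx
      simp only [Finset.coe_filter, Finset.mem_univ, true_and, Set.mem_ofPred_eq] at hx ⊢
      rw [h, hx, mul_zero]
    · intro x _ y _ hxy
      simp only [Prod.mk.injEq] at hxy
      exact Prod.ext (Units.ext hxy.1) hxy.2
  have hcard : Fintype.card (Pt pp N) = (pp.p - 1) * Fintype.card (Vec pp N) := by
    rw [Fintype.card_prod, ZMod.card_units]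
  have aux : ∀ {p Z V : ℕ}, 2 ≤ p → (p - 1) * Z ≤ d * (p * V) →
      Z * p ≤ 4 * d * ((p - 1) * V) := by
    intro p Z V hp h
    obtain ⟨p, rfl⟩ : ∃ p', p = p' + 2 := ⟨p - 2, by omega⟩
    simp only [Nat.add_succ_sub_one] at h ⊢
    have h5 : (p + 1) * (Z * (p + 2)) ≤ (p + 1) * (4 * d * ((p + 1) * V)) := by
      calc (p + 1) * (Z * (p + 2)) = (p + 2) * ((p + 1) * Z) := by ring
        _ ≤ (p + 2) * (d * ((p + 2) * V)) := Nat.mul_le_mul_left _ h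
        _ = ((p + 2) * (p + 2)) * (d * V) := by ring
        _ ≤ ((2 * (p + 1)) * (2 * (p + 1))) * (d * V) := by
            gcongr <;> omega
        _ = _ := by ring
    exact Nat.le_of_mul_le_mul_left h5 (Nat.succ_pos _)
  have h3 : Z * pp.p ≤ 4 * d * Fintype.card (Pt pp N) := by
    rw [hcard]
    exact aux pp.prime.two_le ((Nat.mul_le_mul_left (pp.p - 1) h2).trans h1)
  have hp0 : (pp.p : ℝ≥0∞) ≠ 0 := by
    rw [Nat.cast_ne_zero]; exact pp.prime.ne_zero
  have hc0 : (Fintype.card (Pt pp N) : ℝ≥0∞) ≠ 0 := by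
    rw [Nat.cast_ne_zero]; exact Fintype.card_ne_zero
  rw [mean_ite_eq_card, ← hZ, ← div_eq_mul_inv]
  refine ENNReal.div_le_of_le_mul ?_
  rw [mul_right_comm, ← div_eq_mul_inv]
  rw [ENNReal.le_div_iff_mul_le (Or.inl hp0) (Or.inl (by simp))]
  exact_mod_cast h3

end LowDeg

/-! ### Disclosure of values of the revocation polynomial -/

theorem polyEval_add (P P' : Fin (pp.t + 1) → Scalar pp) (u : Scalar pp) :
    polyEval (P + P') u = polyEval P u + polyEval P' u := by
  simp [polyEval, add_mul, Finset.sum_add_distrib]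

theorem polyEval_smul (c : Scalar pp) (P : Fin (pp.t + 1) → Scalar pp) (u : Scalar pp) :
    polyEval (c • P) u = c * polyEval P u := by
  simp [polyEval, Finset.mul_sum, mul_assoc]

/-- The values at the points of `U` and at `0` of the revocation polynomial. -/
def valuesAt (U : Finset (Identity pp)) :
    (Fin (pp.t + 1) → Scalar pp) →ₗ[Scalar pp] (U → Scalar pp) × Scalar pp where
  toFun P := (fun u => polyEval P ((u : Identity pp) : Scalar pp), polyEval P 0)
  map_add' P P' := by simp only [polyEval_add]; rfl
  map_smul' c P := by simp only [polyEval_smul]; rfl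

theorem valuesAt_surjective {U : Finset (Identity pp)} (hU : U.card ≤ pp.t) :
    Function.Surjective (valuesAt U) := by
  rintro ⟨c, c₀⟩
  let v : Option U → Scalar pp := fun o => o.elim 0 fun u => ((u : Identity pp) : Scalar pp)
  let w : Option U → Scalar pp := fun o => o.elim c₀ c
  have hv : Set.InjOn v (Finset.univ : Finset (Option U)) := by
    intro a _ b _ hab
    cases a with
    | none =>
      cases b with
      | none => rfl
      | some b => exact absurd hab.symm (Units.ne_zero _)
    | some a =>
      cases b with
      | none => exact absurd hab (Units.ne_zero _)
      | some b => exact congrArg some (Subtype.ext (Units.ext hab))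
  let p := Lagrange.interpolate Finset.univ v w
  have hdeg : p.natDegree < pp.t + 1 := by
    have h1 : p.degree < ((pp.t + 1 : ℕ) : WithBot ℕ) := by
      refine (Lagrange.degree_interpolate_lt _ hv).trans_le ?_
      simp only [Finset.card_univ, Fintype.card_option, Fintype.card_coe]
      exact_mod_cast Nat.succ_le_succ hU
    by_cases hp : p = 0
    · rw [hp]; simp
    · exact (Polynomial.natDegree_lt_iff_degree_lt hp).2 h1
  have heval : ∀ z, polyEval (fun i : Fin (pp.t + 1) => p.coeff i) z = p.eval z := by
    intro z
    rw [Polynomial.eval_eq_sum_range' hdeg, polyEval, Finset.sum_range]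
  refine ⟨fun i => p.coeff i, Prod.ext ?_ ?_⟩
  · funext u
    exact (heval _).trans (Lagrange.eval_interpolate_at_node w hv (Finset.mem_univ (some u)))
  · exact (heval _).trans (Lagrange.eval_interpolate_at_node w hv (Finset.mem_univ none))

/-- A polynomial that vanishes at `0` and has given values at the points of `U`, which depends
linearly on these values. -/
noncomputable def interpolant (U : Finset (Identity pp)) :
    (U → Scalar pp) →ₗ[Scalar pp] (Fin (pp.t + 1) → Scalar pp) :=
  if hU : U.card ≤ pp.t then
    (LinearMap.exists_rightInverse_of_surjective _
      (LinearMap.range_eq_top.2 (valuesAt_surjective hU))).choose ∘ₗ LinearMap.inl _ _ _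
  else 0

theorem valuesAt_interpolant {U : Finset (Identity pp)} (hU : U.card ≤ pp.t)
    (c : U → Scalar pp) : valuesAt U (interpolant U c) = (c, 0) := by
  rw [interpolant, dif_pos hU]
  have := (LinearMap.exists_rightInverse_of_surjective _
      (LinearMap.range_eq_top.2 (valuesAt_surjective hU))).choose_spec
  exact LinearMap.congr_fun this (c, 0)

/-- The revocation polynomial, changed such that it has the values `c` at the points of `U`, and
the same value at `0` as before. -/
noncomputable def revealP (U : Finset (Identity pp)) (c : U → Scalar pp)
    (P : Fin (pp.t + 1) → Scalar pp) : Fin (pp.t + 1) → Scalar pp :=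
  P + interpolant U (c - (valuesAt U P).1)

theorem polyEval_revealP_zero {U : Finset (Identity pp)} (hU : U.card ≤ pp.t)
    (c : U → Scalar pp) (P : Fin (pp.t + 1) → Scalar pp) :
    polyEval (revealP U c P) 0 = polyEval P 0 := by
  rw [revealP, polyEval_add]
  have : polyEval (interpolant U (c - (valuesAt U P).1)) 0 = 0 :=
    congrArg Prod.snd (valuesAt_interpolant hU (c - (valuesAt U P).1))
  rw [this, add_zero]

theorem polyEval_revealP {U : Finset (Identity pp)} (hU : U.card ≤ pp.t)
    (c : U → Scalar pp) (P : Fin (pp.t + 1) → Scalar pp) (u : U) :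
    polyEval (revealP U c P) ((u : Identity pp) : Scalar pp) = c u := by
  rw [revealP, polyEval_add]
  have : polyEval (interpolant U (c - (valuesAt U P).1)) ((u : Identity pp) : Scalar pp) =
      c u - polyEval P ((u : Identity pp) : Scalar pp) :=
    congrFun (congrArg Prod.fst (valuesAt_interpolant hU (c - (valuesAt U P).1))) u
  rw [this]
  ring

/-- A point with a changed revocation polynomial. -/
def Pt.mapP (φ : (Fin (pp.t + 1) → Scalar pp) → Fin (pp.t + 1) → Scalar pp) (x : Pt pp N) :
    Pt pp N := (x.1, x.2.1, φ x.2.2.1, x.2.2.2)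

/-- Disclosure of uniformly random values does not change the distribution of the hidden
variables. -/
theorem mean_mapP_revealP (U : Finset (Identity pp)) (f : Pt pp N → ℝ≥0∞) :
    (mean fun c : U → Scalar pp => mean fun x : Pt pp N => f (x.mapP (revealP U c))) = mean f := by
  have h1 : ∀ x : Pt pp N, (mean fun c => f (x.mapP (revealP U c))) =
      mean fun c => f (x.mapP fun P => P + interpolant U c) := by
    intro x
    rw [← mean_equiv (Equiv.subRight (valuesAt U x.2.2.1).1)
      fun c => f (x.mapP fun P => P + interpolant U c)]
    rfl
  rw [mean_comm]
  simp only [h1]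
  rw [mean_comm]
  have h2 : ∀ c, (mean fun x : Pt pp N => f (x.mapP fun P => P + interpolant U c)) = mean f := by
    intro c
    let e : Pt pp N ≃ Pt pp N :=
      { toFun := fun x => x.mapP fun P => P + interpolant U c
        invFun := fun x => x.mapP fun P => P - interpolant U c
        left_inv := fun x => by simp [Pt.mapP]
        right_inv := fun x => by simp [Pt.mapP] }
    exact mean_equiv e f
  simp only [h2, mean_const]

theorem lowDeg_mapP {e d : ℕ} {f : Pt pp N → Scalar pp} (hf : f ∈ lowDeg pp N e d)
    (U : Finset (Identity pp)) (c : U → Scalar pp) :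
    (fun x => f (x.mapP (revealP U c))) ∈ lowDeg pp N e d := by
  obtain ⟨q, hq, h⟩ := hf
  refine ⟨fun y => q (y.1, y.2.1, revealP U c y.2.2.1, y.2.2.2), hq.comp
    (fun y : Scalar pp × Vec pp N => (y.1, y.2.1, revealP U c y.2.2.1, y.2.2.2)) ?_, fun x => h (x.mapP (revealP U c))⟩
  intro a b
  refine ⟨(a.1, a.2.1, revealP U c a.2.2.1, a.2.2.2),
    (b.1, b.2.1, b.2.2.1 - interpolant U (valuesAt U b.2.2.1).1, b.2.2.2), fun t => ?_⟩
  refine Prod.ext rfl (Prod.ext rfl (Prod.ext ?_ rfl))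
  show revealP U c (a.2.2.1 + t • b.2.2.1) =
    revealP U c a.2.2.1 + t • (b.2.2.1 - interpolant U (valuesAt U b.2.2.1).1)
  simp only [revealP, map_add, map_smul, map_sub, Prod.fst_add, Prod.smul_fst, smul_sub]
  abel

end

section

variable {pp : Params} {N : ℕ}

/-! ### Symbolic states of the challenger -/

theorem polyOnly_one : PolyOnly (1 : Pt pp N → Scalar pp) := ⟨fun _ => 1, rfl⟩

theorem PolyOnly.mul {a b : Pt pp N → Scalar pp} (ha : PolyOnly a)
    (hb : PolyOnly b) : PolyOnly fun x => a x * b x := by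
  obtain ⟨a, rfl⟩ := ha
  obtain ⟨b, rfl⟩ := hb
  exact ⟨fun P => a P * b P, rfl⟩

theorem PolyOnly.mapP {a : Pt pp N → Scalar pp} (ha : PolyOnly a)
    (φ : (Fin (pp.t + 1) → Scalar pp) → Fin (pp.t + 1) → Scalar pp) :
    PolyOnly fun x => a (x.mapP φ) := by
  obtain ⟨a, rfl⟩ := ha
  exact ⟨fun P => a (φ P), rfl⟩

namespace Sym

/-- The master key at a point. -/
def masterKey (st : Sym pp N) (x : Pt pp N) : MasterKey pp := ⟨x.α, x.1, st.P x.P⟩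

/-- The proxy key for the points of `U`. -/
noncomputable def proxyKey (st : Sym pp N) (U : Finset (Identity pp)) (x : Pt pp N) :
    ProxyKey pp :=
  U.image fun u => (u, st.poly u x)

/-- The state of the challenger at a point. -/
noncomputable def state (st : Sym pp N) (x : Pt pp N) : State pp where
  H := fun a => (st.H a).map fun v => x.h v
  issued := st.issued
  pxk := st.pxk.map fun U => st.proxyKey U x
  chal := st.chal.map fun c => (c.1, c.2.1)

/-- The order of increasing knowledge, before and after a challenge. -/
structure Le (st st' : Sym pp N) : Prop where
  H : ∀ a v, st.H a = some v → st'.H a = some v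
  keys : ∀ k κ, st.keys k = some κ → st'.keys k = some κ
  P : st.P = st'.P
  chal : st.chal = none ∨ st.chal = st'.chal

theorem Le.poly {st st' : Sym pp N} (h : st.Le st') (u : Scalar pp) : st.poly u = st'.poly u := by
  unfold Sym.poly
  rw [h.P]

theorem Le.chal_some {st st' : Sym pp N} (h : st.Le st') {c} (hc : st.chal = some c) :
    st'.chal = some c := by
  rcases h.chal with h | h
  · rw [h] at hc; cases hc
  · rw [← h, hc]

section

variable [NeZero N]

theorem Le.gen₂ {st st' : Sym pp N} (h : st.Le st') {g : Pt pp N → Scalar pp} (hg : Gen₂ st g) :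
    Gen₂ st' g := by
  cases hg with
  | one ha => exact .one ha
  | inv ha => exact .inv ha
  | hash ha v => exact .hash ha v
  | key ha hk => exact .key ha (h.keys _ _ hk)
  | keyAttr ha hk j hv =>
    rw [h.poly]
    exact .keyAttr ha (h.keys _ _ hk) j (h.H _ _ hv)
  | cipher hT y hv => exact .cipher (h.chal_some hT) y (h.H _ _ hv)

theorem Le.gen₁ {st st' : Sym pp N} (h : st.Le st') {g : Pt pp N → Scalar pp} (hg : Gen₁ st g) :
    Gen₁ st' g := by
  cases hg with
  | iso hg => exact .iso (h.gen₂ hg)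
  | beta => exact .beta
  | key k l => exact .key k l
  | keyUser hk j =>
    rw [h.poly]
    exact .keyUser (h.keys _ _ hk) j
  | cipher hT => exact .cipher (h.chal_some hT)
  | share hT y => exact .share (h.chal_some hT) y

theorem Le.span_le {st st' : Sym pp N} (h : st.Le st') (i : Grp) : st.span i ≤ st'.span i := by
  cases i with
  | G1 => exact Submodule.span_mono fun g hg => h.gen₁ hg
  | G2 => exact Submodule.span_mono fun g hg => h.gen₂ hg
  | GT =>
    refine Submodule.span_mono ?_
    rintro g (⟨g₁, g₂, h₁, h₂, rfl⟩ | hg)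
    · exact .inl ⟨g₁, g₂, h.gen₁ h₁, h.gen₂ h₂, rfl⟩
    · exact .inr hg

theorem span_iso (st : Sym pp N) : st.span .G2 ≤ st.span .G1 :=
  Submodule.span_mono fun _ hg => .iso hg

theorem span_pair (st : Sym pp N) {f g : Pt pp N → Scalar pp} (hf : f ∈ st.span .G1)
    (hg : g ∈ st.span .G2) : f * g ∈ st.span .GT := by
  have h := Submodule.mul_mem_mul hf hg
  rw [Sym.span, Sym.span, Submodule.span_mul_span] at h
  refine Submodule.span_mono ?_ h
  rintro _ ⟨g₁, h₁, g₂, h₂, rfl⟩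
  exact .inl ⟨g₁, g₂, h₁, h₂, rfl⟩

/-- Conversion does not lead out of the obtainable exponents before the challenge. -/
theorem span_convert (st : Sym pp N) (hc : st.chal = none) {a f : Pt pp N → Scalar pp}
    (ha : PolyOnly a) (hf : f ∈ st.span .G2) : a * f ∈ st.span .G2 := by
  suffices h : st.span .G2 ≤ (st.span .G2).comap (LinearMap.mulLeft (Scalar pp) a) from h hf
  conv_lhs => rw [Sym.span]
  refine Submodule.span_le.2 fun g hg => Submodule.subset_span ?_
  simp only [LinearMap.mulLeft_apply, Set.mem_ofPred_eq] at hg ⊢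
  cases hg with
  | one hb => exact .one (ha.mul hb)
  | @inv b hb =>
    have := Gen₂.inv (st := st) (ha.mul hb)
    simpa only [mul_assoc, Pi.mul_def] using this
  | hash hb v =>
    have := Gen₂.hash (st := st) (ha.mul hb) v
    simpa only [mul_assoc, Pi.mul_def] using this
  | key hb hk =>
    have := Gen₂.key (ha.mul hb) hk
    simpa only [mul_assoc, Pi.mul_def] using this
  | keyAttr hb hk j hv =>
    have := Gen₂.keyAttr (ha.mul hb) hk j hv
    simpa only [mul_assoc, Pi.mul_def] using this
  | cipher hT => rw [hc] at hT; cases hT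

/-- A change of the revocation polynomial is a substitution in the obtainable exponents. -/
theorem span_mapP (st : Sym pp N) (hP : st.P = id)
    (φ : (Fin (pp.t + 1) → Scalar pp) → Fin (pp.t + 1) → Scalar pp) (i : Grp)
    {f : Pt pp N → Scalar pp} (hf : f ∈ st.span i) :
    (fun x => f (x.mapP φ)) ∈ ({ st with P := φ } : Sym pp N).span i := by
  set st' : Sym pp N := { st with P := φ } with hst
  have hpoly : ∀ u x, st.poly u (x.mapP φ) = st'.poly u x := by
    intro u x
    simp only [Sym.poly, hP, hst]
    rfl
  have h₂ : ∀ g, Gen₂ st g → Gen₂ st' fun x => g (x.mapP φ) := by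
    intro g hg
    cases hg with
    | one ha => exact .one (ha.mapP φ)
    | inv ha => exact .inv (ha.mapP φ)
    | hash ha v => exact .hash (ha.mapP φ) v
    | key ha hk => exact .key (st := st') (ha.mapP φ) hk
    | keyAttr ha hk j hv =>
      simp only [hpoly]
      exact .keyAttr (st := st') (ha.mapP φ) hk j hv
    | cipher hT y hv => exact .cipher (st := st') hT y hv
  have h₁ : ∀ g, Gen₁ st g → Gen₁ st' fun x => g (x.mapP φ) := by
    intro g hg
    cases hg with
    | iso hg => exact .iso (h₂ _ hg)
    | beta => exact .beta
    | key k l => exact .key k l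
    | keyUser hk j =>
      simp only [hpoly]
      exact .keyUser (st := st') hk j
    | cipher hT => exact .cipher (st := st') hT
    | share hT y => exact .share (st := st') hT y
  suffices h : st.span i ≤ (st'.span i).comap
      (LinearMap.funLeft (Scalar pp) (Scalar pp) fun x : Pt pp N => x.mapP φ) from h hf
  cases i with
  | G1 => exact Submodule.span_le.2 fun g hg => Submodule.subset_span (h₁ g hg)
  | G2 => exact Submodule.span_le.2 fun g hg => Submodule.subset_span (h₂ g hg)
  | GT =>
    refine Submodule.span_le.2 fun g hg => Submodule.subset_span ?_
    rcases hg with ⟨g₁, g₂, h₁', h₂', rfl⟩ | rfl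
    · exact .inl ⟨_, _, h₁ _ h₁', h₂ _ h₂', rfl⟩
    · exact .inr rfl

end

end Sym

/-- The bounds for the degrees of obtainable exponents. -/
def low (pp : Params) (N : ℕ) (D : ℕ) : Grp → Submodule (Scalar pp) (Pt pp N → Scalar pp)
  | .G1 => lowDeg pp N 1 D
  | .G2 => lowDeg pp N 1 D
  | .GT => lowDeg pp N 2 (2 * D)

theorem low_mono {D D' : ℕ} (h : D ≤ D') (i : Grp) : low pp N D i ≤ low pp N D' i := by
  cases i <;> intro f hf <;> exact lowDeg_mono hf (by omega)

theorem low_le {D : ℕ} (hD : 0 < D) (i : Grp) : low pp N D i ≤ lowDeg pp N 2 (2 * D) := by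
  cases i
  · exact fun f hf => lowDeg_mono (lowDeg_raise hf) (by omega)
  · exact fun f hf => lowDeg_mono (lowDeg_raise hf) (by omega)
  · exact le_rfl

theorem low_of_lowDeg {D d : ℕ} {i : Grp} {f : Pt pp N → Scalar pp} (hf : f ∈ lowDeg pp N 0 d)
    (hd : d + 2 ≤ D) : f ∈ low pp N D i := by
  cases i
  · exact lowDeg_mono (lowDeg_raise hf) (by omega)
  · exact lowDeg_mono (lowDeg_raise hf) (by omega)
  · exact lowDeg_mono (lowDeg_raise (lowDeg_raise hf)) (by omega)

/-- The bound for the probability that two different obtainable exponents have the same value. -/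
noncomputable def coll (pp : Params) (N : ℕ) : ℝ≥0∞ := (4 * (2 * (N + 4)) : ℕ) * (pp.p : ℝ≥0∞)⁻¹

theorem mean_zero_le_coll {k : ℕ} (hk : k ≤ N) {f : Pt pp N → Scalar pp}
    (hf : f ∈ lowDeg pp N 2 (2 * (k + 4))) (h0 : f ≠ 0) :
    (mean fun x => if f x = 0 then 1 else 0) ≤ coll pp N := by
  refine (lowDeg_mean_zero_le hf h0).trans ?_
  unfold coll
  gcongr

section

variable [NeZero N]

/-- Exponents that the adversary can obtain with less than `k` queries; the masked challenge
message can occur in the target group after the challenge. -/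
structure Obtainable (st : Sym pp N) (k : ℕ) (i : Grp) (e : Elt (Pt pp N) pp) : Prop where
  span : e.1 ∈ st.span i
  low : e.1 ∈ low pp N (k + 4) i
  mask : st.chal = none ∨ i ≠ .GT → e.2 = 0

theorem Obtainable.mono {st st' : Sym pp N} (h : st.Le st') {k k' : ℕ} (hk : k ≤ k') {i : Grp}
    {e : Elt (Pt pp N) pp} (he : Obtainable st k i e) : Obtainable st' k' i e where
  span := h.span_le i he.span
  low := low_mono (by omega) i he.low
  mask hc := he.mask <| hc.imp_left fun hc => by
    rcases h.chal with h | h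
    · exact h
    · rw [h, hc]

theorem Obtainable.add {st : Sym pp N} {k : ℕ} {i : Grp} {e e' : Elt (Pt pp N) pp}
    (he : Obtainable st k i e) (he' : Obtainable st k i e') : Obtainable st k i (e + e') where
  span := Submodule.add_mem _ he.span he'.span
  low := Submodule.add_mem _ he.low he'.low
  mask hc := by simp [he.mask hc, he'.mask hc]

theorem Obtainable.smul {st : Sym pp N} {k : ℕ} {i : Grp} {e : Elt (Pt pp N) pp}
    (he : Obtainable st k i e) (a : Scalar pp) : Obtainable st k i (a • e) where
  span := Submodule.smul_mem _ a he.span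
  low := Submodule.smul_mem _ a he.low
  mask hc := by simp [he.mask hc]

theorem Obtainable.iso {st : Sym pp N} {k : ℕ} {e : Elt (Pt pp N) pp}
    (he : Obtainable st k .G2 e) : Obtainable st k .G1 e where
  span := st.span_iso he.span
  low := he.low
  mask _ := he.mask (.inr (by simp))

theorem Obtainable.pair {st : Sym pp N} {k : ℕ} {e e' : Elt (Pt pp N) pp}
    (he : Obtainable st k .G1 e) (he' : Obtainable st k .G2 e') :
    Obtainable st k .GT (e.1 * e'.1, 0) where
  span := st.span_pair he.span he'.span
  low := lowDeg_mono (lowDeg_mul he.low he'.low) (by omega)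
  mask _ := rfl

theorem Obtainable.gen₂ {st : Sym pp N} {k : ℕ} {g : Pt pp N → Scalar pp} (hg : Gen₂ st g)
    (hl : g ∈ Piratte.low pp N (k + 4) .G2) : Obtainable st k .G2 (g, 0) where
  span := Submodule.subset_span hg
  low := hl
  mask _ := rfl

theorem Obtainable.gen₁ {st : Sym pp N} {k : ℕ} {g : Pt pp N → Scalar pp} (hg : Gen₁ st g)
    (hl : g ∈ Piratte.low pp N (k + 4) .G1) : Obtainable st k .G1 (g, 0) where
  span := Submodule.subset_span hg
  low := hl
  mask _ := rfl

/-- What holds for the symbolic state before the query with number `k`, if `ν` is the exponent of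
the masked challenge message. -/
structure Sym.Inv (st : Sym pp N) (ν : Bool → Pt pp N → Scalar pp) (k : ℕ) : Prop where
  hash_lt : ∀ a v, st.H a = some v → (v.1 : ℕ) < k
  hash_inj : ∀ a a' v, st.H a = some v → st.H a' = some v → a = a'
  key_lt : ∀ j κ, st.keys j = some κ → (j : ℕ) < k
  key_issued : ∀ j κ, st.keys j = some κ → κ ∈ st.issued
  hash_key : ∀ j κ, st.keys j = some κ → ∀ a ∈ κ.2, st.H a ≠ none
  poly_zero : ∀ P, polyEval (st.P P) 0 = P 0
  poly_low : ∀ u, st.poly u ∈ lowDeg pp N 0 1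
  before : st.chal = none → st.P = id
  after : ∀ T RL j, st.chal = some (T, RL, j) → T.size < pp.p ∧ Fintype.card T.Pos ≤ N ∧
    (∀ u ∈ RL, ∀ P P', polyEval (st.P P) (u : Scalar pp) = polyEval (st.P P') u) ∧
    (∀ κ ∈ st.issued, Compatible T RL κ.1 κ.2) ∧
    ∀ b, ∃ g ∈ st.span .GT, g ∈ low pp N (k + 4) .GT ∧ ν b = g + fun x => x.α * x.s j

theorem Sym.Inv.succ {st : Sym pp N} {ν : Bool → Pt pp N → Scalar pp} {k : ℕ} (h : st.Inv ν k) :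
    st.Inv ν (k + 1) where
  hash_lt a v hv := (h.hash_lt a v hv).trans k.lt_succ_self
  hash_inj := h.hash_inj
  key_lt j κ hκ := (h.key_lt j κ hκ).trans k.lt_succ_self
  key_issued := h.key_issued
  hash_key := h.hash_key
  poly_zero := h.poly_zero
  poly_low := h.poly_low
  before := h.before
  after T RL j hc := by
    obtain ⟨h1, h2, h3, h4, h5⟩ := h.after T RL j hc
    refine ⟨h1, h2, h3, h4, fun b => ?_⟩
    obtain ⟨g, hg, hl, hν⟩ := h5 b
    exact ⟨g, hg, low_mono (by omega) _ hl, hν⟩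

theorem Sym.Inv.secure {st : Sym pp N} {ν : Bool → Pt pp N → Scalar pp} {k : ℕ} (h : st.Inv ν k)
    {T : AccessTree} {RL : Finset (Identity pp)} {j : Fin N} (hc : st.chal = some (T, RL, j)) :
    st.Secure T RL j := by
  obtain ⟨h1, h2, h3, h4, -⟩ := h.after T RL j hc
  exact ⟨hc, h1, h2, h.hash_inj, h.hash_key, h.poly_zero, h3,
    fun j' κ hκ => h4 κ (h.key_issued j' κ hκ)⟩

/-- The invariants of the symbolic execution, for the state and for the table. -/
structure Inv (st : Sym pp N) (ν : Bool → Pt pp N → Scalar pp) (k : ℕ)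
    (T : Table (Pt pp N) pp) : Prop where
  state : st.Inv ν k
  distinct : T.Distinct
  obtainable : ∀ t ∈ T, Obtainable st k t.1 t.2.1

/-- Different obtainable exponents rarely have the same value: their difference is a function of
low degree that does not vanish identically, since the mask of the challenge message is not
obtainable. -/
theorem Inv.mean_eq_le {st : Sym pp N} {ν : Bool → Pt pp N → Scalar pp} {k : ℕ}
    {T : Table (Pt pp N) pp} (h : Inv st ν k T) (hk : k ≤ N) (hp : 5000 < pp.p) (b : Bool) :
    ∀ t ∈ T, ∀ t' ∈ T, t.1 = t'.1 → t.2.1 ≠ t'.2.1 →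
      (mean fun x => if ev (ν b) t.2.1 x = ev (ν b) t'.2.1 x then 1 else 0) ≤ coll pp N := by
  rintro ⟨i, ⟨f, c⟩, s⟩ ht ⟨i', ⟨f', c'⟩, s'⟩ ht' hi hne
  simp only at hi hne ⊢
  subst hi
  have o := h.obtainable _ ht
  have o' := h.obtainable _ ht'
  have heq : ∀ x, (ev (ν b) (f, c) x = ev (ν b) (f', c') x) ↔
      (f - f' + (c - c') • ν b) x = 0 := by
    intro x
    rw [← sub_eq_zero]
    simp only [ev, Pi.add_apply, Pi.sub_apply, Pi.smul_apply, smul_eq_mul]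
    ring_nf
  simp only [heq]
  have hl := Submodule.sub_mem _ (low_le (by omega) i o.low) (low_le (by omega) i o'.low)
  by_cases hc : c = c'
  · subst hc
    have hf : f - f' ≠ 0 := sub_ne_zero.2 fun hf => hne (by rw [hf])
    simp only [sub_self, zero_smul, add_zero]
    exact mean_zero_le_coll hk hl hf
  · -- If the masked message occurs, then equality of the exponents would express the mask by
    -- obtainable exponents.
    have hchal : ¬ (st.chal = none ∨ i ≠ .GT) := fun hm => hc ((o.mask hm).trans (o'.mask hm).symm)
    push Not at hchal
    obtain ⟨hchal, rfl⟩ := hchal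
    obtain ⟨⟨A, RL, j⟩, hA⟩ := Option.ne_none_iff_exists'.1 hchal
    obtain ⟨-, -, -, -, h5⟩ := h.state.after A RL j hA
    obtain ⟨g, hg, hgl, hν⟩ := h5 b
    have hlν : ν b ∈ lowDeg pp N 2 (2 * (k + 4)) := by
      rw [hν]
      refine Submodule.add_mem _ hgl (lowDeg_mono (lowDeg_raise (lowDeg_raise
        (lowDeg_mul lowDeg_α (lowDeg_s j)))) (by omega))
    refine mean_zero_le_coll hk (Submodule.add_mem _ hl (Submodule.smul_mem _ _ hlν)) ?_
    intro h0
    refine (h.state.secure hA).mask_notMem hp ?_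
    have hcc : c - c' ≠ 0 := sub_ne_zero.2 hc
    have : (fun x : Pt pp N => x.α * x.s j) = (c - c')⁻¹ • (f' - f) - g := by
      have h1 : (c - c') • ν b = f' - f := by
        rw [← sub_eq_zero, ← h0]; abel
      rw [← h1, smul_smul, inv_mul_cancel₀ hcc, one_smul, hν]
      abel
    rw [this]
    exact Submodule.sub_mem _ (Submodule.smul_mem _ _ (Submodule.sub_mem _ o'.span o.span)) hg

end

end

section

variable {pp : Params}

/-! ### Answers to queries -/

theorem Encoding.log_ψ (E : Encoding pp) (i : Grp) (a : Scalar pp) : E.log i (E.ψ i a) = some a :=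
  Function.partialInv_left (E.ψ i).injective a

theorem Encoding.log_eq_none (E : Encoding pp) {i : Grp} {s : Str pp}
    (hs : s ∉ Set.range (E.ψ i)) : E.log i s = none :=
  dif_neg hs

/-- A string in the table is recognized, and its logarithm is the value of its symbolic
exponent. -/
theorem log_agree {X : Type} {T : Table X pp} {ν : X → Scalar pp} {x : X} {ψ : Enc pp}
    (h : (T.at ν x).Agree ψ) {i : Grp} {e : Elt X pp} {s : Str pp} (hs : (i, e, s) ∈ T) :
    (Encoding.mk ψ).log i s = some (ev ν e x) := by
  rw [← Table.at_agree h hs]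
  exact Encoding.log_ψ _ _ _

/-- A random injection rarely hits a given string, as the strings are long. -/
theorem inv_sub_le (c : ℕ) (hc : c ≤ pp.p) :
    (pp.p : ℝ≥0∞) * ((2 ^ pp.m - c : ℕ) : ℝ≥0∞)⁻¹ ≤ (pp.p : ℝ≥0∞)⁻¹ := by
  have hp := pp.prime.two_le
  have hlen := pp.len
  have h1 : pp.p * pp.p ≤ 2 ^ pp.m - c := by
    have : pp.p * pp.p + pp.p ≤ pp.p ^ 3 := by nlinarith
    omega
  have hp0 : (pp.p : ℝ≥0∞) ≠ 0 := by
    rw [Nat.cast_ne_zero]; exact pp.prime.ne_zero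
  calc _ ≤ (pp.p : ℝ≥0∞) * ((pp.p * pp.p : ℕ) : ℝ≥0∞)⁻¹ := by gcongr
    _ = (pp.p : ℝ≥0∞)⁻¹ := by
      rw [Nat.cast_mul, ENNReal.mul_inv (.inl hp0) (.inl (by simp)), ← mul_assoc,
        ENNReal.mul_inv_cancel hp0 (by simp), one_mul]

theorem card_le_strings (pp : Params) : pp.p ≤ 2 ^ pp.m :=
  (Nat.le_self_pow (by norm_num) _).trans pp.len.le

variable {N : ℕ}

theorem Sym.Le.refl (st : Sym pp N) : st.Le st := ⟨fun _ _ h => h, fun _ _ h => h, rfl, .inr rfl⟩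

theorem cellAt_eq {τ : Tape pp N} {k : ℕ} (hk : k < N) : cellAt τ k = τ ⟨k, hk⟩ := dif_pos hk

theorem hashVal_state {st : Sym pp N} {a : Attr} {v : Fin N × Fin N} (hv : st.H a = some v) (x : Pt pp N) :
    hashVal (st.state x).H a = x.h v := by
  simp only [hashVal, Sym.state, hv, Option.map_some, Option.getD_some]

variable [NeZero N]

/-- The rest of the game from the query with number `k`, for the two challenge bits, at a given
point and with given encodings. -/
noncomputable def cont (st : Sym pp N) (A : Adversary pp) (k : ℕ) (b : Bool) (x : Pt pp N)
    (ψ : Enc pp) : PMF Bool :=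
  playWith x.2.2.2 ⟨ψ⟩ (st.masterKey x) b A k (st.state x)

theorem cont_query {st st' : Sym pp N} {q : Query pp} {next : q.Answer → Adversary pp} {k : ℕ}
    {b : Bool} {x : Pt pp N} {ψ : Enc pp} {a : q.Answer}
    (hq : answerWith (cellAt x.2.2.2 k) ⟨ψ⟩ (st.masterKey x) b (st.state x) q =
      PMF.pure (a, st'.state x)) (hP : st.P = st'.P) :
    cont st (.query q next) k b x ψ = cont st' (next a) (k + 1) b x ψ := by
  simp only [cont, playWith, hq, PMF.pure_bind]
  rw [Sym.masterKey, hP]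
  rfl

section

variable {st st' : Sym pp N} {ν : Bool → Pt pp N → Scalar pp} {k k' : ℕ} {T : Table (Pt pp N) pp}
  {δ : ℝ≥0∞}

theorem Inv.mono (h : Inv st ν k T) (hs : st'.Inv ν k') (hle : st.Le st') (hk : k ≤ k') :
    Inv st' ν k' T :=
  ⟨hs, h.distinct, fun t ht => (h.obtainable t ht).mono hle hk⟩

theorem Inv.succ (h : Inv st ν k T) : Inv st ν (k + 1) T :=
  h.mono h.state.succ (.refl st) k.le_succ

/-- The adversary receives the encodings of obtainable exponents. -/
theorem Inv.family {J : Type} [Fintype J] (h : Inv st ν k T) (e : J → Grp × Elt (Pt pp N) pp)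
    (he : ∀ j, Obtainable st k (e j).1 (e j).2) (hlen : T.length + Fintype.card J ≤ pp.p)
    (A : (J → Str pp) → Adversary pp)
    (hA : ∀ w T', Inv st ν k T' → T'.length ≤ T.length + Fintype.card J →
      Sim ν T' (cont st (A w) k) δ) :
    Sim ν T (fun b x ψ => cont st (A fun j => ψ (e j).1 (ev (ν b) (e j).2 x)) k b x ψ) δ := by
  refine Sim.encode_family e h.distinct (hlen.trans (card_le_strings pp))
    (fun w => cont st (A w) k) fun w T' hT' hl hmem => hA w T' ⟨h.state, hT', ?_⟩ hl
  rintro ⟨i, e', s⟩ ht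
  rcases hmem _ ht with ht | ⟨j, hj⟩
  · exact h.obtainable _ ht
  · have := he j
    rw [← hj] at this
    exact this

/-- What is known about the rest of the game after the answer to the query `q` with number `k`,
if the table had length `l` before the query. -/
def Next (q : Query pp) (next : q.Answer → Adversary pp) (N : ℕ) [NeZero N] (k l : ℕ)
    (δ : ℝ≥0∞) : Prop :=
  ∀ (a : q.Answer) (st' : Sym pp N) (ν' : Bool → Pt pp N → Scalar pp) (T' : Table (Pt pp N) pp),
    Inv st' ν' (k + 1) T' → T'.length ≤ l + 3 * q.cost → Sim ν' T' (cont st' (next a) (k + 1)) δ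

variable {q : Query pp} {next : q.Answer → Adversary pp}

/-- An answer that does not depend on the hidden variables. -/
theorem Next.const (hn : Next q next N k T.length δ) (h : Inv st' ν (k + 1) T) (a : q.Answer)
    (hG : ∀ b x ψ, (T.at (ν b) x).Agree ψ →
      cont st (.query q next) k b x ψ = cont st' (next a) (k + 1) b x ψ) :
    Sim ν T (cont st (.query q next) k) δ :=
  (hn a st' ν T h (Nat.le_add_right _ _)).congr fun b x ψ hx => (hG b x ψ hx).symm

/-- An answer that consists of encodings of obtainable exponents. -/
theorem Next.family (hn : Next q next N k T.length δ) (h : Inv st' ν (k + 1) T) {J : Type}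
    [Fintype J] (e : J → Grp × Elt (Pt pp N) pp)
    (he : ∀ j, Obtainable st' (k + 1) (e j).1 (e j).2)
    (hlen : T.length + 3 * q.cost ≤ pp.p) (hJ : Fintype.card J ≤ 3 * q.cost)
    (a : (J → Str pp) → q.Answer)
    (hG : ∀ b x ψ, (T.at (ν b) x).Agree ψ → cont st (.query q next) k b x ψ =
      cont st' (next (a fun j => ψ (e j).1 (ev (ν b) (e j).2 x))) (k + 1) b x ψ) :
    Sim ν T (cont st (.query q next) k) δ :=
  (h.family e he (by omega) (fun w => next (a w)) fun w T' hT' hl =>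
    hn (a w) st' ν T' hT' (by omega)).congr fun b x ψ hx => (hG b x ψ hx).symm

/-- A query with a string that the adversary has not received is refused, unless the adversary
has guessed the encoding of a group element. -/
theorem Next.unknown (hn : Next q next N k T.length δ) (h : Inv st ν k T)
    (hlen : T.length ≤ pp.p) {i : Grp} {s : Str pp} (hs : s ∉ T.strings i) (a : q.Answer)
    (hG : ∀ b x ψ, (T.at (ν b) x).Agree ψ → s ∉ Set.range (ψ i) →
      cont st (.query q next) k b x ψ = cont st (next a) (k + 1) b x ψ) :
    Sim ν T (cont st (.query q next) k) (δ + (pp.p : ℝ≥0∞)⁻¹) := by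
  refine (Sim.unknown h.distinct hs (hn a st ν T h.succ (Nat.le_add_right _ _))
    fun b x ψ hx hr => (hG b x ψ hx hr).symm).mono ?_
  gcongr
  refine inv_sub_le _ ((List.count_le_length).trans ?_)
  simpa using hlen

end

section

variable {st : Sym pp N} {ν : Bool → Pt pp N → Scalar pp} {k : ℕ} {T : Table (Pt pp N) pp}
  {δ : ℝ≥0∞}

theorem sim_mul (h : Inv st ν k T) (i : Grp) (x y : Str pp)
    (next : (Query.mul i x y).Answer → Adversary pp) (hlen : T.length + 3 ≤ pp.p)
    (hn : Next (.mul i x y) next N k T.length δ) :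
    Sim ν T (cont st (.query (.mul i x y) next) k) (δ + (pp.p : ℝ≥0∞)⁻¹) := by
  by_cases hx : x ∈ T.strings i
  swap
  · refine hn.unknown h (by omega) hx none fun b z ψ _ hr => cont_query ?_ rfl
    simp only [answerWith, answer, Encoding.log_eq_none ⟨ψ⟩ hr]
    rfl
  obtain ⟨e, he⟩ := Entries.mem_strings.1 hx
  by_cases hy : y ∈ T.strings i
  swap
  · refine hn.unknown h (by omega) hy none fun b z ψ hz hr => cont_query ?_ rfl
    simp only [answerWith, answer, Encoding.log_eq_none ⟨ψ⟩ hr, log_agree hz he]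
    rfl
  obtain ⟨e', he'⟩ := Entries.mem_strings.1 hy
  refine (hn.family h.succ (J := Unit) (fun _ => (i, e + e')) (fun _ =>
    (h.succ.obtainable _ he).add (h.succ.obtainable _ he')) hlen (by simp [Query.cost])
    (fun w => some (w ())) fun b z ψ hz => cont_query ?_ rfl).mono le_self_add
  simp only [answerWith, answer, log_agree hz he, log_agree hz he']
  have : ev (ν b) (e + e') z = ev (ν b) e z + ev (ν b) e' z := by
    simp only [ev, Prod.fst_add, Prod.snd_add, Pi.add_apply]; ring
  rw [this]
  rfl

theorem sim_pow (h : Inv st ν k T) (i : Grp) (a : Scalar pp) (x : Str pp)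
    (next : (Query.pow i a x).Answer → Adversary pp) (hlen : T.length + 3 ≤ pp.p)
    (hn : Next (.pow i a x) next N k T.length δ) :
    Sim ν T (cont st (.query (.pow i a x) next) k) (δ + (pp.p : ℝ≥0∞)⁻¹) := by
  by_cases hx : x ∈ T.strings i
  swap
  · refine hn.unknown h (by omega) hx none fun b z ψ _ hr => cont_query ?_ rfl
    simp only [answerWith, answer, Encoding.log_eq_none ⟨ψ⟩ hr]
    rfl
  obtain ⟨e, he⟩ := Entries.mem_strings.1 hx
  refine (hn.family h.succ (J := Unit) (fun _ => (i, a • e)) (fun _ =>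
    (h.succ.obtainable _ he).smul a) hlen (by simp [Query.cost])
    (fun w => some (w ())) fun b z ψ hz => cont_query ?_ rfl).mono le_self_add
  simp only [answerWith, answer, log_agree hz he]
  have : ev (ν b) (a • e) z = a * ev (ν b) e z := by
    simp only [ev, Prod.smul_fst, Prod.smul_snd, Pi.smul_apply, smul_eq_mul]; ring
  rw [this]
  rfl

theorem sim_pair (h : Inv st ν k T) (x y : Str pp)
    (next : (Query.pair x y).Answer → Adversary pp) (hlen : T.length + 3 ≤ pp.p)
    (hn : Next (.pair x y) next N k T.length δ) :
    Sim ν T (cont st (.query (.pair x y) next) k) (δ + (pp.p : ℝ≥0∞)⁻¹) := by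
  by_cases hx : x ∈ T.strings .G1
  swap
  · refine hn.unknown h (by omega) hx none fun b z ψ _ hr => cont_query ?_ rfl
    simp only [answerWith, answer, Encoding.log_eq_none ⟨ψ⟩ hr]
    rfl
  obtain ⟨e, he⟩ := Entries.mem_strings.1 hx
  by_cases hy : y ∈ T.strings .G2
  swap
  · refine hn.unknown h (by omega) hy none fun b z ψ hz hr => cont_query ?_ rfl
    simp only [answerWith, answer, Encoding.log_eq_none ⟨ψ⟩ hr, log_agree hz he]
    rfl
  obtain ⟨e', he'⟩ := Entries.mem_strings.1 hy
  have o := h.succ.obtainable _ he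
  have o' := h.succ.obtainable _ he'
  refine (hn.family h.succ (J := Unit) (fun _ => (.GT, e.1 * e'.1, 0)) (fun _ =>
    o.pair o') hlen (by simp [Query.cost])
    (fun w => some (w ())) fun b z ψ hz => cont_query ?_ rfl).mono le_self_add
  simp only [answerWith, answer, log_agree hz he, log_agree hz he']
  have h1 : e.2 = 0 := o.mask (.inr (by simp))
  have h2 : e'.2 = 0 := o'.mask (.inr (by simp))
  have : ev (ν b) (e.1 * e'.1, 0) z = ev (ν b) e z * ev (ν b) e' z := by
    simp only [ev, h1, h2, Pi.mul_apply]; ring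
  rw [this]
  rfl

theorem sim_iso (h : Inv st ν k T) (x : Str pp)
    (next : (Query.iso x).Answer → Adversary pp) (hlen : T.length + 3 ≤ pp.p)
    (hn : Next (.iso x) next N k T.length δ) :
    Sim ν T (cont st (.query (.iso x) next) k) (δ + (pp.p : ℝ≥0∞)⁻¹) := by
  by_cases hx : x ∈ T.strings .G2
  swap
  · refine hn.unknown h (by omega) hx none fun b z ψ _ hr => cont_query ?_ rfl
    simp only [answerWith, answer, Encoding.log_eq_none ⟨ψ⟩ hr]
    rfl
  obtain ⟨e, he⟩ := Entries.mem_strings.1 hx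
  refine (hn.family h.succ (J := Unit) (fun _ => (.G1, e)) (fun _ =>
    (h.succ.obtainable _ he).iso) hlen (by simp [Query.cost])
    (fun w => some (w ())) fun b z ψ hz => cont_query ?_ rfl).mono le_self_add
  simp only [answerWith, answer, log_agree hz he]
  rfl

theorem sim_flip (h : Inv st ν k T) (next : (Query.flip (pp := pp)).Answer → Adversary pp)
    (hn : Next .flip next N k T.length δ) :
    Sim ν T (cont st (.query .flip next) k) δ := by
  refine (Sim.bind (PMF.uniformOfFintype Bool) (fun c => cont st (next c) (k + 1)) fun c _ =>
    hn c st ν T h.succ (Nat.le_add_right _ _)).congr fun b x ψ _ => ?_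
  simp only [cont, playWith, answerWith, answer]
  refine Eq.symm ((PMF.bind_bind _ _ _).trans ?_)
  congr 1; funext c
  exact PMF.pure_bind _ _

/-! ### The random oracle and secret keys -/

/-- The places of the hash values, if those at the attributes of `S` are determined with the coins
of the cell `k`. -/
noncomputable def Sym.fill (st : Sym pp N) (k : Fin N) (S : Finset Attr) :
    Attr → Option (Fin N × Fin N) := fun a =>
  match st.H a with
  | some v => some v
  | none => if ha : a ∈ S then some (k, slot N S ⟨a, ha⟩) else none

/-- The state in which the random oracle is determined at the attributes of `S`. -/
noncomputable def Sym.withHash (st : Sym pp N) (k : Fin N) (S : Finset Attr) : Sym pp N :=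
  { st with H := st.fill k S }

theorem Sym.fill_of_some {k : Fin N} {S : Finset Attr} {a : Attr} {v : Fin N × Fin N}
    (hv : st.H a = some v) : st.fill k S a = some v := by
  simp only [Sym.fill, hv]

theorem Sym.exists_fill {k : Fin N} {S : Finset Attr} {a : Attr} (ha : a ∈ S) :
    ∃ v, st.fill k S a = some v := by
  cases hv : st.H a with
  | some v => exact ⟨v, Sym.fill_of_some hv⟩
  | none => exact ⟨(k, slot N S ⟨a, ha⟩), by simp only [Sym.fill, hv, dif_pos ha]⟩

theorem Sym.fill_eq_some {k : Fin N} {S : Finset Attr} {a : Attr} {v : Fin N × Fin N}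
    (hv : st.fill k S a = some v) :
    st.H a = some v ∨ ∃ ha : a ∈ S, v = (k, slot N S ⟨a, ha⟩) := by
  cases hw : st.H a with
  | some w =>
    rw [Sym.fill_of_some hw] at hv
    exact .inl hv
  | none =>
    simp only [Sym.fill, hw] at hv
    split_ifs at hv with ha
    exact .inr ⟨ha, (Option.some.inj hv).symm⟩

theorem fillHash_state (hk : k < N) (S : Finset Attr) (x : Pt pp N) :
    fillHash (st.state x).H S (fun j => (cellAt x.2.2.2 k).1 (slot N S j)) =
      ((st.withHash ⟨k, hk⟩ S).state x).H := by
  funext a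
  simp only [fillHash, Sym.state, Sym.withHash, Sym.fill]
  cases hv : st.H a with
  | some v => rfl
  | none =>
    simp only [Option.map_none]
    by_cases ha : a ∈ S
    · simp only [dif_pos ha, Option.map_some, cellAt_eq hk]
      rfl
    · simp only [dif_neg ha, Option.map_none]

theorem Sym.le_withHash (k : Fin N) (S : Finset Attr) : st.Le (st.withHash k S) where
  H _ _ hv := Sym.fill_of_some hv
  keys _ _ hκ := hκ
  P := rfl
  chal := .inr rfl

theorem Sym.Inv.withHash (h : st.Inv ν k) (hk : k < N) {S : Finset Attr} (hS : S.card ≤ N) :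
    (st.withHash ⟨k, hk⟩ S).Inv ν (k + 1) where
  hash_lt a v hv := by
    rcases Sym.fill_eq_some hv with hv | ⟨ha, rfl⟩
    · exact (h.hash_lt a v hv).trans k.lt_succ_self
    · exact k.lt_succ_self
  hash_inj a a' v hv hv' := by
    rcases Sym.fill_eq_some hv with hv | ⟨ha, hv⟩ <;> rcases Sym.fill_eq_some hv' with hv' | ⟨ha', hv'⟩
    · exact h.hash_inj a a' v hv hv'
    · have := h.hash_lt a v hv
      rw [hv'] at this
      exact absurd this (lt_irrefl _)
    · have := h.hash_lt a' v hv'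
      rw [hv] at this
      exact absurd this (lt_irrefl _)
    · rw [hv, Prod.mk.injEq] at hv'
      have := slot_injective (N := N) (J := S) (by rwa [Fintype.card_coe]) hv'.2
      exact congrArg Subtype.val this
  key_lt j κ hκ := (h.key_lt j κ hκ).trans k.lt_succ_self
  key_issued := h.key_issued
  hash_key j κ hκ a ha := by
    obtain ⟨v, hv⟩ := Option.ne_none_iff_exists'.1 (h.hash_key j κ hκ a ha)
    have : (st.withHash ⟨k, hk⟩ S).H a = some v := Sym.fill_of_some hv
    rw [this]
    simp
  poly_zero := h.poly_zero
  poly_low := h.poly_low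
  before := h.before
  after A RL j hc := by
    obtain ⟨h1, h2, h3, h4, h5⟩ := h.succ.after A RL j hc
    refine ⟨h1, h2, h3, h4, fun b => ?_⟩
    obtain ⟨g, hg, hl⟩ := h5 b
    exact ⟨g, (Sym.le_withHash _ _).span_le _ hg, hl⟩

theorem sim_hash (h : Inv st ν k T) (hk : k < N) (a : Attr)
    (next : (Query.hash (pp := pp) a).Answer → Adversary pp) (hlen : T.length + 3 ≤ pp.p)
    (hn : Next (.hash a) next N k T.length δ) :
    Sim ν T (cont st (.query (.hash a) next) k) δ := by
  have hs := h.state.withHash hk (S := {a}) (by rw [Finset.card_singleton]; omega)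
  obtain ⟨v, hv⟩ := Sym.exists_fill (st := st) (k := ⟨k, hk⟩) (Finset.mem_singleton_self a)
  refine hn.family (h.mono hs (Sym.le_withHash _ _) k.le_succ) (J := Unit)
    (fun _ => (.G2, fun x => 1 * x.h v, 0)) (fun _ => .gen₂ (.hash polyOnly_one v) ?_)
    hlen (by simp [Query.cost]) (fun w => w ()) fun b z ψ hz => cont_query ?_ rfl
  · simp only [one_mul]
    exact low_of_lowDeg (lowDeg_h v) (by omega)
  · simp only [answerWith, fillHash_state hk, hashVal_state (st := st.withHash ⟨k, hk⟩ {a}) hv, ev]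
    simp only [one_mul, zero_mul, add_zero]
    rfl

/-- The state after a key for the user `u` and the attribute set `S` has been issued with the coins
of the cell `k`. -/
noncomputable def Sym.withKey (st : Sym pp N) (k : Fin N) (u : Identity pp) (S : Finset Attr) :
    Sym pp N :=
  { st.withHash k S with
    keys := Function.update st.keys k (some (u, S))
    issued := (u, S) :: st.issued }

theorem Sym.Inv.le_withKey (h : st.Inv ν k) (hk : k < N) (u : Identity pp) (S : Finset Attr) :
    (st.withHash ⟨k, hk⟩ S).Le (st.withKey ⟨k, hk⟩ u S) where
  H _ _ hv := hv
  keys j κ hκ := by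
    have hj := h.key_lt j κ hκ
    have : j ≠ ⟨k, hk⟩ := fun hj' => by rw [hj'] at hj; exact lt_irrefl _ hj
    exact (Function.update_of_ne this _ _).trans hκ
  P := rfl
  chal := .inr rfl

theorem Sym.withKey_keys {k : Fin N} {u : Identity pp} {S : Finset Attr} {j : Fin N}
    {κ : Identity pp × Finset Attr} (hκ : (st.withKey k u S).keys j = some κ) :
    (j = k ∧ κ = (u, S)) ∨ st.keys j = some κ := by
  by_cases hj : j = k
  · subst hj
    have : (st.withKey j u S).keys j = some (u, S) := Function.update_self _ _ _
    rw [this] at hκ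
    exact .inl ⟨rfl, (Option.some.inj hκ).symm⟩
  · have : (st.withKey k u S).keys j = st.keys j := Function.update_of_ne hj _ _
    rw [this] at hκ
    exact .inr hκ

theorem Sym.Inv.withKey (h : st.Inv ν k) (hk : k < N) {u : Identity pp} {S : Finset Attr}
    (hS : S.card ≤ N) (hc : ∀ T RL j, st.chal = some (T, RL, j) → Compatible T RL u S) :
    (st.withKey ⟨k, hk⟩ u S).Inv ν (k + 1) where
  hash_lt := (h.withHash hk hS).hash_lt
  hash_inj := (h.withHash hk hS).hash_inj
  key_lt j κ hκ := by
    rcases Sym.withKey_keys hκ with ⟨rfl, -⟩ | hκ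
    · exact k.lt_succ_self
    · exact (h.key_lt j κ hκ).trans k.lt_succ_self
  key_issued j κ hκ := by
    rcases Sym.withKey_keys hκ with ⟨-, rfl⟩ | hκ
    · exact List.mem_cons_self
    · exact List.mem_cons_of_mem _ (h.key_issued j κ hκ)
  hash_key j κ hκ a ha := by
    rcases Sym.withKey_keys hκ with ⟨-, rfl⟩ | hκ
    · obtain ⟨v, hv⟩ := Sym.exists_fill (st := st) (k := ⟨k, hk⟩) ha
      have : (st.withKey ⟨k, hk⟩ u S).H a = some v := hv
      rw [this]
      simp
    · exact (h.withHash hk hS).hash_key j κ hκ a ha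
  poly_zero := h.poly_zero
  poly_low := h.poly_low
  before := h.before
  after A RL j hA := by
    obtain ⟨h1, h2, h3, h4, h5⟩ := (h.withHash hk hS).after A RL j hA
    refine ⟨h1, h2, h3, ?_, fun b => ?_⟩
    · intro κ hκ
      rcases List.mem_cons.1 hκ with rfl | hκ
      · exact hc A RL j hA
      · exact h4 κ hκ
    · obtain ⟨g, hg, hl⟩ := h5 b
      exact ⟨g, (h.le_withKey hk u S).span_le _ hg, hl⟩

/-- The exponents of a secret key. -/
noncomputable def keyElt (st : Sym pp N) (k : Fin N) (u : Identity pp) (S : Finset Attr) :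
    Unit ⊕ S ⊕ S ⊕ S → Grp × Elt (Pt pp N) pp
  | .inl _ => (.G2, fun x => 1 * ((x.α + x.r k) * x.β⁻¹), 0)
  | .inr (.inl j) => (.G2, fun x => 1 * (x.r k +
      x.h ((st.fill k S j).getD (k, 0)) * x.ρ k (slot N _ j) * st.poly 0 x), 0)
  | .inr (.inr (.inl j)) => (.G1, fun x => x.ρ k (slot N _ j), 0)
  | .inr (.inr (.inr j)) => (.G1, fun x => x.ρ k (slot N _ j) * st.poly u x, 0)

theorem keyElt_obtainable (h : st.Inv ν k) (hk : k < N) (u : Identity pp) (S : Finset Attr)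
    (j : Unit ⊕ S ⊕ S ⊕ S) :
    Obtainable (st.withKey ⟨k, hk⟩ u S) (k + 1) (keyElt st ⟨k, hk⟩ u S j).1
      (keyElt st ⟨k, hk⟩ u S j).2 := by
  have hkey : (st.withKey ⟨k, hk⟩ u S).keys ⟨k, hk⟩ = some (u, S) := Function.update_self _ _ _
  rcases j with _ | j | j | j
  · refine .gen₂ (.key polyOnly_one hkey) ?_
    simp only [one_mul]
    exact lowDeg_mono (d := 1) (by
      simpa using lowDeg_mul (lowDeg_add lowDeg_α (lowDeg_r _)) lowDeg_invβ) (by omega)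
  · obtain ⟨v, hv⟩ := Sym.exists_fill (st := st) (k := ⟨k, hk⟩) j.2
    simp only [keyElt, hv, Option.getD_some]
    refine .gen₂ (.keyAttr polyOnly_one hkey j hv) ?_
    simp only [one_mul]
    exact low_of_lowDeg (lowDeg_add (lowDeg_mono (lowDeg_r _) (by omega))
      (lowDeg_mul (lowDeg_mul (lowDeg_h v) (lowDeg_ρ _ _)) (h.poly_low 0))) (by omega)
  · exact .gen₁ (.key _ _) (low_of_lowDeg (lowDeg_ρ _ _) (by omega))
  · exact .gen₁ (.keyUser hkey j)
      (low_of_lowDeg (lowDeg_mul (lowDeg_ρ _ _) (h.poly_low u)) (by omega))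

theorem sim_keygen (h : Inv st ν k T) (hk : k < N) (u : Identity pp) (S : Finset Attr)
    (next : (Query.keygen u S).Answer → Adversary pp) (hS : S.card ≤ N)
    (hlen : T.length + 3 * (1 + S.card) ≤ pp.p)
    (hn : Next (.keygen u S) next N k T.length δ) :
    Sim ν T (cont st (.query (.keygen u S) next) k) δ := by
  by_cases hc : ∀ T RL j, st.chal = some (T, RL, j) → Compatible T RL u S
  · have hs := h.state.withKey hk hS hc
    have hle : st.Le (st.withKey ⟨k, hk⟩ u S) := by
      have h1 := Sym.le_withHash (st := st) ⟨k, hk⟩ S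
      have h2 := h.state.le_withKey hk u S
      exact ⟨fun a v hv => h2.H a v (h1.H a v hv), fun a v hv => h2.keys a v hv, rfl, .inr rfl⟩
    refine hn.family (h.mono hs hle k.le_succ) (keyElt st ⟨k, hk⟩ u S)
      (keyElt_obtainable h.state hk u S) hlen ?_
      (fun w => some ⟨w (.inl ()), fun j => w (.inr (.inl j)), fun j => w (.inr (.inr (.inl j))),
        fun j => w (.inr (.inr (.inr j)))⟩) fun b z ψ hz => cont_query ?_ rfl
    · simp only [Fintype.card_sum, Fintype.card_unit, Fintype.card_coe, Query.cost]
      omega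
    · have hc' : ∀ c ∈ (st.state z).chal, Compatible c.1 c.2 u S := by
        intro c hcm
        simp only [Sym.state, Option.mem_def, Option.map_eq_some_iff] at hcm
        obtain ⟨⟨A, RL, j⟩, hA, rfl⟩ := hcm
        exact hc A RL j hA
      simp only [answerWith, if_pos hc', fillHash_state hk]
      simp only [cellAt_eq hk]
      refine congrArg PMF.pure (Prod.ext (congrArg some ?_) rfl)
      simp only [keyWith, keyElt, ev, zero_mul, add_zero, one_mul, SecretKey.mk.injEq]
      refine ⟨?_, ?_, rfl, rfl⟩
      · rw [div_eq_mul_inv]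
        rfl
      · funext j
        obtain ⟨v, hv⟩ := Sym.exists_fill (st := st) (k := ⟨k, hk⟩) j.2
        simp only [hv, Option.getD_some, hashVal_state (st := st.withHash ⟨k, hk⟩ S) hv]
        rfl
  · refine hn.const h.succ none fun b z ψ hz => cont_query ?_ rfl
    have hc' : ¬ ∀ c ∈ (st.state z).chal, Compatible c.1 c.2 u S := by
      intro hc'
      refine hc fun A RL j hA => hc' (A, RL) ?_
      simp [Sym.state, hA]
    simp only [answerWith, if_neg hc']
    rfl

end

end

section

variable {pp : Params}

/-! ### Proxy keys -/

theorem mapM_eq_map {α β : Type} {f : α → Option β} {g : α → β} (l : List α)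
    (h : ∀ a ∈ l, f a = some (g a)) : l.mapM f = some (l.map g) := by
  induction l with
  | nil => rfl
  | cons a l ih =>
    rw [List.mapM_cons, h a List.mem_cons_self, ih fun b hb => h b (List.mem_cons_of_mem _ hb)]
    rfl

theorem mapM_eq_none {α β : Type} {f : α → Option β} {l : List α} {a : α} (ha : a ∈ l)
    (h : f a = none) : l.mapM f = none := by
  induction l with
  | nil => cases ha
  | cons b l ih =>
    rw [List.mapM_cons]
    rcases List.mem_cons.1 ha with rfl | ha
    · rw [h]; rfl
    · rw [ih ha]
      cases f b <;> rfl

/-- The points of a new proxy key for the revocation list `RL`. -/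
noncomputable def rekeyPoints (users RL : Finset (Identity pp)) :
    PMF (Option (Finset (Identity pp))) :=
  if hF : RL.card ≤ pp.t ∧
      ((Finset.univ \ (users ∪ RL)).powersetCard (pp.t - RL.card)).Nonempty then
    (PMF.uniformOfFinset _ hF.2).map fun X => some (RL ∪ X)
  else PMF.pure none

theorem proxyRekey_eq (mk : MasterKey pp) (users RL : Finset (Identity pp)) :
    proxyRekey mk users RL = (rekeyPoints users RL).map
      (Option.map fun U : Finset (Identity pp) =>
        (U.image fun u : Identity pp => (u, mk.evalP u) : ProxyKey pp)) := by
  unfold proxyRekey rekeyPoints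
  split_ifs
  · rw [PMF.map_comp]
    rfl
  · rw [PMF.pure_map]
    rfl

theorem rekeyPoints_support {users RL U : Finset (Identity pp)}
    (hU : some U ∈ (rekeyPoints users RL).support) : RL ⊆ U ∧ U.card ≤ pp.t := by
  unfold rekeyPoints at hU
  split_ifs at hU with hF
  · simp only [PMF.support_map, Set.mem_image, PMF.mem_support_uniformOfFinset_iff,
      Finset.mem_powersetCard, Option.some.injEq] at hU
    obtain ⟨X, ⟨-, hX⟩, rfl⟩ := hU
    refine ⟨Finset.subset_union_left, (Finset.card_union_le _ _).trans ?_⟩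
    omega
  · simp at hU

variable {N : ℕ}

theorem pair_injective (f : Identity pp → Scalar pp) :
    Function.Injective fun u : Identity pp => (u, f u) := fun _ _ h => congrArg Prod.fst h

/-- The exponent with which the proxy converts. -/
noncomputable def Sym.convertExp (st : Sym pp N) (U : Finset (Identity pp)) (u : Scalar pp) :
    Pt pp N → Scalar pp :=
  ∑ v ∈ U, (u / (u - (v : Scalar pp)) *
    ∏ w ∈ U.erase v, (w : Scalar pp) / ((w : Scalar pp) - (v : Scalar pp))) • st.poly v

theorem sum_lambda (st : Sym pp N) (U : Finset (Identity pp)) (u : Scalar pp) (x : Pt pp N) :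
    ∑ i ∈ st.proxyKey U x, lambda (st.proxyKey U x) u i * i.2 = st.convertExp U u x := by
  have hinj := pair_injective fun v : Identity pp => st.poly v x
  conv_lhs => rw [Sym.proxyKey, Finset.sum_image fun a _ b _ h => hinj h]
  rw [Sym.convertExp, Finset.sum_apply]
  refine Finset.sum_congr rfl fun v _ => ?_
  rw [Pi.smul_apply, smul_eq_mul, lambda]
  have : (U.image fun v : Identity pp => (v, st.poly v x)).erase (v, st.poly v x) =
      (U.erase v).image fun v : Identity pp => (v, st.poly v x) :=
    (Finset.image_erase hinj U v).symm
  rw [this, Finset.prod_image fun a _ b _ h => hinj h]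

theorem lambdaUser_proxyKey (st : Sym pp N) (U : Finset (Identity pp)) (u : Scalar pp)
    (x : Pt pp N) : lambdaUser (st.proxyKey U x) u =
      ∏ v ∈ U, (v : Scalar pp) / ((v : Scalar pp) - u) := by
  rw [lambdaUser, Sym.proxyKey, Finset.prod_image fun a _ b _ h =>
    pair_injective (fun v : Identity pp => st.poly v x) h]

theorem polyOnly_convertExp (st : Sym pp N) (U : Finset (Identity pp)) (u : Scalar pp) :
    PolyOnly (st.convertExp U u) := by
  refine ⟨fun P => ∑ v ∈ U, (u / (u - (v : Scalar pp)) *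
    ∏ w ∈ U.erase v, (w : Scalar pp) / ((w : Scalar pp) - (v : Scalar pp))) *
      polyEval (st.P P) v, ?_⟩
  funext x
  simp only [Sym.convertExp, Finset.sum_apply, Pi.smul_apply, smul_eq_mul, Sym.poly]

theorem state_users (st : Sym pp N) (x : Pt pp N) :
    (st.state x).users = (st.issued.map Prod.fst).toFinset := rfl

theorem low_mapP {D : ℕ} {i : Grp} {f : Pt pp N → Scalar pp} (hf : f ∈ low pp N D i)
    (U : Finset (Identity pp)) (c : U → Scalar pp) :
    (fun x => f (x.mapP (revealP U c))) ∈ low pp N D i := by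
  cases i <;> exact lowDeg_mapP hf U c

variable [NeZero N]

section

variable {st : Sym pp N} {ν : Bool → Pt pp N → Scalar pp} {k : ℕ} {T : Table (Pt pp N) pp}
  {δ : ℝ≥0∞}

theorem Sym.Inv.convertExp_low (h : st.Inv ν k) (U : Finset (Identity pp)) (u : Scalar pp) :
    st.convertExp U u ∈ lowDeg pp N 0 1 :=
  Submodule.sum_mem _ fun v _ => Submodule.smul_mem _ _ (h.poly_low v)

theorem Obtainable.convert (h : st.Inv ν k) (hc : st.chal = none) {e : Elt (Pt pp N) pp}
    (he : Obtainable st k .G2 e) (U : Finset (Identity pp)) (u : Scalar pp) :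
    Obtainable st (k + 1) .G2 (st.convertExp U u * e.1, 0) where
  span := st.span_convert hc (polyOnly_convertExp st U u) he.span
  low := by
    have h1 := lowDeg_mul (h.convertExp_low U u) he.low
    rw [zero_add] at h1
    exact lowDeg_mono h1 (by omega)
  mask _ := rfl

theorem sim_convert (h : Inv st ν k T) (C : List (Str pp)) (u : Scalar pp)
    (next : (Query.convert C u).Answer → Adversary pp)
    (hlen : T.length + 3 * (1 + C.length) ≤ pp.p)
    (hn : Next (.convert C u) next N k T.length δ) :
    Sim ν T (cont st (.query (.convert C u) next) k) (δ + (pp.p : ℝ≥0∞)⁻¹) := by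
  by_cases hc : st.chal = none
  swap
  · refine (hn.const h.succ none fun b z ψ hz => cont_query ?_ rfl).mono le_self_add
    have hc' : (st.state z).chal ≠ none := by simpa [Sym.state] using hc
    simp only [answerWith, answer, if_neg hc']
    rfl
  have hc' : ∀ z, (st.state z).chal = none := by simp [Sym.state, hc]
  cases hU : st.pxk with
  | none =>
    refine (hn.const h.succ none fun b z ψ hz => cont_query ?_ rfl).mono le_self_add
    have hp : (st.state z).pxk = none := by simp [Sym.state, hU]
    simp only [answerWith, answer, if_pos (hc' z), hp]
    rfl
  | some U =>
  have hp : ∀ z, (st.state z).pxk = some (st.proxyKey U z) := by simp [Sym.state, hU]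
  by_cases hu : ∃ v ∈ U, (v : Scalar pp) = u
  · refine (hn.const h.succ none fun b z ψ hz => cont_query ?_ rfl).mono le_self_add
    have hu' : ∃ i ∈ st.proxyKey U z, (i.1 : Scalar pp) = u := by
      obtain ⟨v, hv, hvu⟩ := hu
      exact ⟨_, Finset.mem_image_of_mem _ hv, hvu⟩
    simp only [answerWith, answer, if_pos (hc' z), hp, convert]
    refine congrArg PMF.pure (Prod.ext (if_pos hu') rfl)
  have hu' : ∀ z, ¬ ∃ i ∈ st.proxyKey U z, (i.1 : Scalar pp) = u := by
    rintro z ⟨i, hi, hiu⟩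
    obtain ⟨v, hv, rfl⟩ := Finset.mem_image.1 hi
    exact hu ⟨v, hv, hiu⟩
  by_cases hC : ∃ s ∈ C, s ∉ T.strings .G2
  · obtain ⟨s, hs, hsT⟩ := hC
    refine hn.unknown h (by omega) hsT none fun b z ψ _ hr => cont_query ?_ rfl
    have hl := mapM_eq_none hs (Encoding.log_eq_none ⟨ψ⟩ hr)
    simp only [answerWith, answer, if_pos (hc' z), hp, convert]
    refine congrArg PMF.pure (Prod.ext ?_ rfl)
    refine (if_neg (hu' z)).trans ?_
    rw [hl]
    rfl
  push Not at hC
  have hex : ∀ s, ∃ e : Elt (Pt pp N) pp, s ∈ C → (Grp.G2, e, s) ∈ T := by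
    intro s
    by_cases hs : s ∈ C
    · obtain ⟨e, he⟩ := Entries.mem_strings.1 (hC s hs)
      exact ⟨e, fun _ => he⟩
    · exact ⟨0, fun h => absurd h hs⟩
  choose e he using hex
  have hmem : ∀ j : Fin C.length, (Grp.G2, e (C.get j), C.get j) ∈ T := fun j =>
    he _ (C.get_mem j)
  refine (hn.family h.succ (J := Fin C.length)
    (fun j => (.G2, st.convertExp U u * (e (C.get j)).1, 0))
    (fun j => (h.obtainable _ (hmem j)).convert h.state hc U u) hlen
    (by simp only [Fintype.card_fin, Query.cost]; omega)
    (fun w => some (List.ofFn w, ∏ v ∈ U, (v : Scalar pp) / ((v : Scalar pp) - u)))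
    fun b z ψ hz => cont_query ?_ rfl).mono le_self_add
  have hl : C.mapM ((Encoding.mk ψ).log .G2) = some (C.map fun s => ev (ν b) (e s) z) :=
    mapM_eq_map C fun s hs => log_agree hz (he s hs)
  simp only [answerWith, answer, if_pos (hc' z), hp, convert]
  refine congrArg PMF.pure (Prod.ext ?_ rfl)
  refine (if_neg (hu' z)).trans ?_
  rw [hl]
  simp only [Option.map_some, sum_lambda, lambdaUser_proxyKey, List.map_map]
  refine congrArg some (Prod.ext ?_ rfl)
  refine List.ext_getElem (by simp) fun j hj hj' => ?_
  simp only [List.getElem_map, List.getElem_ofFn, Function.comp_apply, List.get_eq_getElem]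
  have hj'' : j < C.length := by simpa using hj
  have h0 : (e C[j]).2 = 0 := (h.obtainable _ (hmem ⟨j, hj''⟩)).mask (.inr (by simp))
  simp only [ev, h0, Pi.mul_apply]
  congr 1
  ring

theorem Sym.Inv.withProxy (h : st.Inv ν k) (hc : st.chal = none) (o : Option (Finset (Identity pp))) :
    ({ st with pxk := o } : Sym pp N).Inv ν k where
  hash_lt := h.hash_lt
  hash_inj := h.hash_inj
  key_lt := h.key_lt
  key_issued := h.key_issued
  hash_key := h.hash_key
  poly_zero := h.poly_zero
  poly_low := h.poly_low
  before := h.before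
  after A RL j hA := by
    simp only [hc] at hA
    cases hA

theorem sim_rekey (h : Inv st ν k T) (RL : Finset (Identity pp))
    (next : (Query.rekey RL).Answer → Adversary pp)
    (hn : Next (.rekey RL) next N k T.length δ) :
    Sim ν T (cont st (.query (.rekey RL) next) k) δ := by
  by_cases hc : st.chal = none
  swap
  · refine hn.const h.succ () fun b z ψ hz => cont_query ?_ rfl
    have hc' : (st.state z).chal ≠ none := by simpa [Sym.state] using hc
    simp only [answerWith, answer, if_neg hc']
    rfl
  have hc' : ∀ z, (st.state z).chal = none := by simp [Sym.state, hc]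
  let st' : Option (Finset (Identity pp)) → Sym pp N := fun o =>
    { st with pxk := o.orElse fun _ => st.pxk }
  refine (Sim.bind (rekeyPoints (st.issued.map Prod.fst).toFinset RL)
    (fun o => cont (st' o) (next ()) (k + 1)) fun o _ => hn () (st' o) ν T
      (h.mono (h.state.succ.withProxy hc _) ⟨fun _ _ h => h, fun _ _ h => h, rfl, .inr rfl⟩
        k.le_succ) (Nat.le_add_right _ _)).congr fun b z ψ _ => ?_
  simp only [cont, playWith, answerWith, answer, if_pos (hc' z)]
  refine Eq.symm ((PMF.bind_bind _ _ _).trans ?_)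
  rw [proxyRekey_eq, PMF.bind_map, state_users]
  congr 1; funext o
  cases o with
  | none => exact PMF.pure_bind _ _
  | some U => exact PMF.pure_bind _ _

/-! ### The challenge -/

/-- The state after the challenge with the access tree `A` and the revocation list `RL`, if the
values `c` of the revocation polynomial at the points of `U` have been published. -/
noncomputable def Sym.withChallenge (st : Sym pp N) (k : Fin N) (A : AccessTree)
    (RL U : Finset (Identity pp)) (c : U → Scalar pp) : Sym pp N where
  H := st.fill k A.attrs
  keys := st.keys
  issued := st.issued
  pxk := some U
  P := revealP U c
  chal := some (A, RL, k)

/-- The exponent of the masked challenge message. -/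
def masked (μ₀ μ₁ : Elt (Pt pp N) pp) (k : Fin N)
    (φ : (Fin (pp.t + 1) → Scalar pp) → Fin (pp.t + 1) → Scalar pp) (b : Bool) (x : Pt pp N) :
    Scalar pp :=
  (if b then μ₁ else μ₀).1 (x.mapP φ) + x.α * x.s k

/-- The exponents of the challenge ciphertext; the first one is the masked message. -/
noncomputable def cipherElt (st : Sym pp N) (k : Fin N) (A : AccessTree) :
    Unit ⊕ Unit ⊕ A.Leaf ⊕ A.Leaf → Grp × Elt (Pt pp N) pp
  | .inl _ => (.GT, 0, 1)
  | .inr (.inl _) => (.G1, fun x => x.β * x.s k, 0)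
  | .inr (.inr (.inl y)) => (.G1, fun x => shareAt A k y x, 0)
  | .inr (.inr (.inr y)) => (.G2, fun x =>
      x.h ((st.fill k A.attrs (A.att y)).getD (k, 0)) * shareAt A k y x, 0)

theorem Sym.span_withChallenge (h : st.Inv ν k) (hc : st.chal = none) (k' : Fin N)
    (A : AccessTree) (RL U : Finset (Identity pp)) (c : U → Scalar pp) (i : Grp)
    {f : Pt pp N → Scalar pp} (hf : f ∈ st.span i) :
    (fun x => f (x.mapP (revealP U c))) ∈ (st.withChallenge k' A RL U c).span i := by
  refine Sym.Le.span_le ?_ i (st.span_mapP (h.before hc) (revealP U c) i hf)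
  exact ⟨fun _ _ hv => Sym.fill_of_some hv, fun _ _ hκ => hκ, rfl, .inl hc⟩

theorem Sym.Inv.withChallenge (h : st.Inv ν k) (hc : st.chal = none) (hk : k < N)
    {A : AccessTree} {RL U : Finset (Identity pp)} (c : U → Scalar pp) (hA : A.size < pp.p)
    (hAN : A.size ≤ N) (hRL : RL ⊆ U) (hU : U.card ≤ pp.t)
    (hcomp : ∀ κ ∈ st.issued, Compatible A RL κ.1 κ.2) {μ₀ μ₁ : Elt (Pt pp N) pp}
    (h₀ : Obtainable st k .GT μ₀) (h₁ : Obtainable st k .GT μ₁) :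
    (st.withChallenge ⟨k, hk⟩ A RL U c).Inv (masked μ₀ μ₁ ⟨k, hk⟩ (revealP U c)) (k + 1) := by
  have hw := h.withHash hk (A.card_attrs_le_size.trans hAN)
  have hPid : st.P = id := h.before hc
  refine ⟨hw.hash_lt, hw.hash_inj, hw.key_lt, h.key_issued, hw.hash_key, ?_, ?_, ?_, ?_⟩
  · intro P
    have := h.poly_zero P
    rw [hPid] at this
    exact (polyEval_revealP_zero hU c P).trans this
  · intro u
    have := lowDeg_mapP (h.poly_low u) U c
    unfold Sym.poly at this ⊢
    rw [hPid] at this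
    exact this
  · intro h'
    cases h'
  · intro A' RL' j hj
    have hj' : (A, RL, (⟨k, hk⟩ : Fin N)) = (A', RL', j) := Option.some.inj hj
    simp only [Prod.mk.injEq] at hj'
    obtain ⟨rfl, rfl, rfl⟩ := hj'
    refine ⟨hA, A.card_pos_lt_size.le.trans hAN, ?_, hcomp, ?_⟩
    · intro u hu P P'
      exact (polyEval_revealP hU c P ⟨u, hRL hu⟩).trans
        (polyEval_revealP hU c P' ⟨u, hRL hu⟩).symm
    · intro b
      have hb : Obtainable st k .GT (if b then μ₁ else μ₀) := by
        cases b
        · exact h₀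
        · exact h₁
      exact ⟨_, Sym.span_withChallenge h hc _ A RL U c _ hb.span,
        low_mono (by omega) _ (low_mapP hb.low U c), rfl⟩

theorem cipherElt_obtainable (hk : k < N) (A : AccessTree) (RL U : Finset (Identity pp))
    (c : U → Scalar pp) (j : Unit ⊕ Unit ⊕ A.Leaf ⊕ A.Leaf) :
    Obtainable (st.withChallenge ⟨k, hk⟩ A RL U c) (k + 1) (cipherElt st ⟨k, hk⟩ A j).1
      (cipherElt st ⟨k, hk⟩ A j).2 := by
  have hchal : (st.withChallenge ⟨k, hk⟩ A RL U c).chal = some (A, RL, ⟨k, hk⟩) := rfl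
  rcases j with _ | _ | y | y
  · refine ⟨Submodule.zero_mem _, Submodule.zero_mem _, ?_⟩
    rintro (h | h)
    · cases h
    · exact absurd rfl h
  · exact .gen₁ (.cipher hchal) (low_of_lowDeg (lowDeg_mul lowDeg_β (lowDeg_s _)) (by omega))
  · exact .gen₁ (.share hchal y) (low_of_lowDeg (lowDeg_shareAt A _ y) (by omega))
  · obtain ⟨v, hv⟩ := Sym.exists_fill (st := st) (k := ⟨k, hk⟩) (A.att_mem_attrs y)
    simp only [cipherElt, hv, Option.getD_some]
    exact .gen₂ (.cipher hchal y hv)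
      (low_of_lowDeg (lowDeg_mul (lowDeg_h v) (lowDeg_shareAt A _ y)) (by omega))

/-- As long as the table does not contain the masked message, its exponent is irrelevant. -/
theorem Sim.change_mask {X : Type} [Fintype X] [Nonempty X] {T : Table X pp}
    {ν ν' : Bool → X → Scalar pp} {G : Bool → X → Enc pp → PMF Bool}
    (hT : ∀ t ∈ T, t.2.1.2 = 0) (h : Sim ν' T G δ) : Sim ν T G δ := by
  obtain ⟨g, hg⟩ := h
  have hat : ∀ b x, T.at (ν b) x = T.at (ν' b) x := by
    intro b x
    refine List.map_congr_left fun t ht => ?_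
    simp only [ev, hT t ht, zero_mul]
  refine ⟨g, fun b c => (hg b c).trans (le_of_eq ?_)⟩
  simp only [mass, hat]

/-- The published proxy key, with disclosed values. -/
noncomputable def disclosed (U : Finset (Identity pp)) (c : U → Scalar pp) : ProxyKey pp :=
  U.image fun u => (u, if hu : u ∈ U then c ⟨u, hu⟩ else 0)

theorem proxyKey_withChallenge (k' : Fin N) (A : AccessTree) (RL U : Finset (Identity pp))
    (hU : U.card ≤ pp.t) (c : U → Scalar pp) (x : Pt pp N) :
    (st.withChallenge k' A RL U c).proxyKey U x = disclosed U c := by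
  refine Finset.image_congr fun u hu => ?_
  simp only [dif_pos (Finset.mem_coe.1 hu)]
  exact Prod.ext rfl (polyEval_revealP hU c _ ⟨u, hu⟩)

end

end

section

variable {pp : Params} {N : ℕ}

theorem masterKey_mapP {st : Sym pp N} (hP : st.P = id)
    (φ : (Fin (pp.t + 1) → Scalar pp) → Fin (pp.t + 1) → Scalar pp) (x : Pt pp N) :
    st.masterKey (x.mapP φ) = ⟨x.α, x.1, φ x.P⟩ := by
  simp only [Sym.masterKey, hP, id_eq]
  rfl

variable [NeZero N] {st : Sym pp N} {ν : Bool → Pt pp N → Scalar pp} {k : ℕ}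
  {T : Table (Pt pp N) pp} {δ : ℝ≥0∞}

/-- The rest of the game after an accepted challenge, with a new proxy key for the points
of `U`. -/
noncomputable def afterChallenge (st : Sym pp N) (hk : k < N) (ν : Bool → Pt pp N → Scalar pp)
    (μ₀ μ₁ : Elt (Pt pp N) pp) (A : AccessTree) (RL U : Finset (Identity pp))
    (next : Option (Ciphertext pp A × ProxyKey pp) → Adversary pp) (b : Bool) (x : Pt pp N)
    (ψ : Enc pp) : PMF Bool :=
  let H := ((st.withHash ⟨k, hk⟩ A.attrs).state x).H
  playWith x.2.2.2 ⟨ψ⟩ (st.masterKey x) b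
    (next (some (cipherWith ⟨ψ⟩ (st.masterKey x) H (if b then ev (ν b) μ₁ x else ev (ν b) μ₀ x) A
      (x.s ⟨k, hk⟩) fun j => x.q ⟨k, hk⟩ (slot N _ j), st.proxyKey U x))) (k + 1)
    { st.state x with H := H, pxk := some (st.proxyKey U x), chal := some (A, RL) }

/-- The new proxy key discloses values of the revocation polynomial, and the message in the
challenge ciphertext is masked by a new symbolic exponent. -/
theorem sim_afterChallenge (h : Inv st ν k T) (hk : k < N) (hp : 5000 < pp.p)
    (hc : st.chal = none) {M₀ M₁ : Str pp} {A : AccessTree} {RL U : Finset (Identity pp)}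
    (next : (Query.challenge M₀ M₁ A RL).Answer → Adversary pp)
    (hlen : T.length + 3 * (1 + A.size + RL.card) ≤ pp.p) (hAN : A.size ≤ N)
    (hn : Next (.challenge M₀ M₁ A RL) next N k T.length δ) (hRL : RL ⊆ U) (hU : U.card ≤ pp.t)
    (hcomp : ∀ κ ∈ st.issued, Compatible A RL κ.1 κ.2) {μ₀ μ₁ : Elt (Pt pp N) pp}
    (h₀ : Obtainable st k .GT μ₀) (h₁ : Obtainable st k .GT μ₁) :
    Sim ν T (afterChallenge st hk ν μ₀ μ₁ A RL U next)
      (δ + (T.length : ℝ≥0∞) ^ 2 * coll pp N) := by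
  refine Sim.reveal (C := U → Scalar pp) (fun c x => x.mapP (revealP U c)) ?_
    h.distinct ?_ fun c hd => ?_
  · intro f
    exact mean_mapP_revealP U f
  · intro t ht t' ht' hne
    have := mean_zero_le_coll hk.le (Submodule.sub_mem _
      (low_le (by omega) _ (h.obtainable t ht).low) (low_le (by omega) _ (h.obtainable t' ht').low))
      (sub_ne_zero.2 hne)
    simpa only [Pi.sub_apply, sub_eq_zero] using this
  set θ : Pt pp N → Pt pp N := fun x => x.mapP (revealP U c) with hθ
  have hlenθ : (T.comp θ).length = T.length := List.length_map _
  have hcost : (Query.challenge M₀ M₁ A RL).cost = 1 + A.size + RL.card := rfl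
  have hleaf := A.card_leaf_le_size
  have hcard : Fintype.card (Unit ⊕ Unit ⊕ A.Leaf ⊕ A.Leaf) ≤ 3 * (1 + A.size + RL.card) := by
    simp only [Fintype.card_sum, Fintype.card_unit]
    omega
  have hmask : ∀ i e, Obtainable st k i e → e.2 = 0 := fun i e he => he.mask (.inl hc)
  have hinv : Inv (st.withChallenge ⟨k, hk⟩ A RL U c) (masked μ₀ μ₁ ⟨k, hk⟩ (revealP U c)) (k + 1)
      (T.comp θ) := by
    refine ⟨h.state.withChallenge hc hk c (by omega) hAN hRL hU hcomp h₀ h₁, hd, ?_⟩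
    intro t ht
    obtain ⟨⟨i, e, s⟩, ht', rfl⟩ := List.mem_map.1 ht
    have he := h.obtainable _ ht'
    exact ⟨Sym.span_withChallenge h.state hc _ A RL U c _ he.span,
      low_mono (by omega) _ (low_mapP he.low U c), fun _ => (hmask _ _ he :)⟩
  refine Sim.change_mask (ν' := masked μ₀ μ₁ ⟨k, hk⟩ (revealP U c)) ?_ ?_
  · intro t ht
    obtain ⟨⟨i, e, s⟩, ht', rfl⟩ := List.mem_map.1 ht
    exact (hmask _ _ (h.obtainable _ ht') :)
  refine (hinv.family (cipherElt st ⟨k, hk⟩ A) (cipherElt_obtainable hk A RL U c) (by omega)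
    (fun w => next (some (⟨w (.inl ()), w (.inr (.inl ())), fun y => w (.inr (.inr (.inl y))),
      fun y => w (.inr (.inr (.inr y)))⟩, disclosed U c))) fun w T' hT' hl =>
    hn _ _ _ T' hT' (by rw [hcost]; omega)).congr fun b x ψ _ => ?_
  have hP : st.P = id := h.state.before hc
  have hkey : st.proxyKey U (θ x) = disclosed U c := by
    rw [← proxyKey_withChallenge (st := st) ⟨k, hk⟩ A RL U hU c x]
    simp only [Sym.proxyKey, Sym.poly, hP]
    rfl
  have hcipher : cipherWith ⟨ψ⟩ (st.masterKey (θ x))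
      ((st.withHash ⟨k, hk⟩ A.attrs).state (θ x)).H
      (if b then ev (ν b) μ₁ (θ x) else ev (ν b) μ₀ (θ x)) A ((θ x).s ⟨k, hk⟩)
      (fun j => (θ x).q ⟨k, hk⟩ (slot N _ j)) =
      (⟨ψ .GT (ev (masked μ₀ μ₁ ⟨k, hk⟩ (revealP U c) b) (cipherElt st ⟨k, hk⟩ A (.inl ())).2 x),
        ψ .G1 (ev (masked μ₀ μ₁ ⟨k, hk⟩ (revealP U c) b)
          (cipherElt st ⟨k, hk⟩ A (.inr (.inl ()))).2 x),
        fun y => ψ .G1 (ev (masked μ₀ μ₁ ⟨k, hk⟩ (revealP U c) b)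
          (cipherElt st ⟨k, hk⟩ A (.inr (.inr (.inl y)))).2 x),
        fun y => ψ .G2 (ev (masked μ₀ μ₁ ⟨k, hk⟩ (revealP U c) b)
          (cipherElt st ⟨k, hk⟩ A (.inr (.inr (.inr y)))).2 x)⟩ : Ciphertext pp A) := by
    rw [masterKey_mapP hP]
    simp only [cipherWith, cipherElt, ev, zero_mul, add_zero, Ciphertext.mk.injEq]
    refine ⟨?_, rfl, rfl, ?_⟩
    · congr 1
      simp only [hmask _ _ h₀, hmask _ _ h₁, zero_mul, add_zero, masked, Pi.zero_apply, zero_add,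
        one_mul]
      cases b <;> rfl
    · funext y
      obtain ⟨v, hv⟩ := Sym.exists_fill (st := st) (k := ⟨k, hk⟩) (A.att_mem_attrs y)
      simp only [hv, Option.getD_some,
        hashVal_state (st := st.withHash ⟨k, hk⟩ A.attrs) hv]
      rfl
  have hstate : (st.withChallenge ⟨k, hk⟩ A RL U c).state x =
      { st.state (θ x) with
        H := ((st.withHash ⟨k, hk⟩ A.attrs).state (θ x)).H
        pxk := some (disclosed U c)
        chal := some (A, RL) } := by
    have hpx : ((st.withChallenge ⟨k, hk⟩ A RL U c).state x).pxk = some (disclosed U c) :=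
      congrArg some (proxyKey_withChallenge (st := st) ⟨k, hk⟩ A RL U hU c x)
    rw [← hpx]
    rfl
  simp only [afterChallenge, cont]
  rw [hcipher, hkey, hstate, masterKey_mapP hP]
  rfl

theorem sim_challenge (h : Inv st ν k T) (hk : k < N) (hp : 5000 < pp.p) (M₀ M₁ : Str pp)
    (A : AccessTree) (RL : Finset (Identity pp))
    (next : (Query.challenge M₀ M₁ A RL).Answer → Adversary pp)
    (hlen : T.length + 3 * (1 + A.size + RL.card) ≤ pp.p) (hAN : A.size ≤ N)
    (hn : Next (.challenge M₀ M₁ A RL) next N k T.length δ) :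
    Sim ν T (cont st (.query (.challenge M₀ M₁ A RL) next) k)
      (δ + (pp.p : ℝ≥0∞)⁻¹ + (T.length : ℝ≥0∞) ^ 2 * coll pp N) := by
  by_cases hM₀ : M₀ ∈ T.strings .GT
  swap
  · refine (hn.unknown h (by omega) hM₀ none fun b z ψ _ hr => cont_query ?_ rfl).mono le_self_add
    simp only [answerWith, Encoding.log_eq_none ⟨ψ⟩ hr]
    rfl
  obtain ⟨μ₀, h₀⟩ := Entries.mem_strings.1 hM₀
  by_cases hM₁ : M₁ ∈ T.strings .GT
  swap
  · refine (hn.unknown h (by omega) hM₁ none fun b z ψ hz hr => cont_query ?_ rfl).mono le_self_add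
    simp only [answerWith, Encoding.log_eq_none ⟨ψ⟩ hr, log_agree hz h₀]
    rfl
  obtain ⟨μ₁, h₁⟩ := Entries.mem_strings.1 hM₁
  have hle : δ ≤ δ + (pp.p : ℝ≥0∞)⁻¹ + (T.length : ℝ≥0∞) ^ 2 * coll pp N :=
    le_self_add.trans le_self_add
  have hcz : ∀ z, ((st.state z).chal = none ∧ ∀ κ ∈ (st.state z).issued, Compatible A RL κ.1 κ.2) ↔
      (st.chal = none ∧ ∀ κ ∈ st.issued, Compatible A RL κ.1 κ.2) := by
    intro z
    simp [Sym.state]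
  by_cases hc : st.chal = none ∧ ∀ κ ∈ st.issued, Compatible A RL κ.1 κ.2
  swap
  · refine (hn.const h.succ none fun b z ψ hz => cont_query ?_ rfl).mono hle
    simp only [answerWith, log_agree hz h₀, log_agree hz h₁, if_neg (mt (hcz z).1 hc)]
    rfl
  let G : Option (Finset (Identity pp)) → Bool → Pt pp N → Enc pp → PMF Bool := fun o =>
    match o with
    | none => cont st (next none) (k + 1)
    | some U => afterChallenge st hk ν μ₀ μ₁ A RL U next
  refine (Sim.bind (rekeyPoints (st.issued.map Prod.fst).toFinset RL) G (fun o ho => ?_)).congr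
    fun b z ψ hz => ?_
  · cases o with
    | none => exact (hn none st ν T h.succ (Nat.le_add_right _ _)).mono hle
    | some U =>
      obtain ⟨hRL, hU⟩ := rekeyPoints_support ho
      refine (sim_afterChallenge h hk hp hc.1 next hlen hAN hn hRL hU hc.2
        (h.obtainable _ h₀) (h.obtainable _ h₁)).mono ?_
      gcongr
      exact le_self_add
  · simp only [cont, playWith, answerWith, log_agree hz h₀, log_agree hz h₁,
      if_pos ((hcz z).2 hc), fillHash_state hk]
    refine Eq.symm ((PMF.bind_bind _ _ _).trans ?_)
    rw [proxyRekey_eq, PMF.bind_map, state_users]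
    congr 1; funext o
    cases o with
    | none => exact PMF.pure_bind _ _
    | some U =>
      refine (PMF.pure_bind _ _).trans ?_
      simp only [cellAt_eq hk]
      rfl

/-! ### Symbolic execution of the game -/

theorem sim_guess (h : Inv st ν k T) (hk : k ≤ N) (hp : 5000 < pp.p) (c : Bool) :
    Sim ν T (cont st (.guess c) k) ((T.length : ℝ≥0∞) ^ 2 * coll pp N) :=
  Sim.guess h.distinct c (h.mean_eq_le hk hp)

/-- The rest of the game can be executed with a fixed, public distribution of the result, up to an
error for each query and for the final comparison of the exponents. -/
theorem sim_cont (hp : 5000 < pp.p) {L : ℕ} (hL : L ≤ pp.p) (A : Adversary pp)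
    (n : ℕ) (hA : A.CostLE n) {k : ℕ} (hk : k + n ≤ N) {st : Sym pp N}
    {ν : Bool → Pt pp N → Scalar pp} {T : Table (Pt pp N) pp} (h : Inv st ν k T)
    (hT : T.length + 3 * n ≤ L) :
    Sim ν T (cont st A k) (n * ((pp.p : ℝ≥0∞)⁻¹ + (L : ℝ≥0∞) ^ 2 * coll pp N) +
      (L : ℝ≥0∞) ^ 2 * coll pp N) := by
  induction A generalizing n k st ν T with
  | guess c =>
    refine (sim_guess h (by omega) hp c).mono (le_trans ?_ le_add_self)
    gcongr
    omega
  | query q next ih =>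
    obtain ⟨hq, hnext⟩ := hA
    have hq1 : 1 ≤ q.cost := by cases q <;> simp only [Query.cost] <;> omega
    set ε : ℝ≥0∞ := (pp.p : ℝ≥0∞)⁻¹ + (L : ℝ≥0∞) ^ 2 * coll pp N with hε
    set δ : ℝ≥0∞ := (n - q.cost : ℕ) * ε + (L : ℝ≥0∞) ^ 2 * coll pp N with hδ
    have hn : Next q next N k T.length δ := fun a st' ν' T' hT' hl =>
      ih a (n - q.cost) (hnext a) (by omega) hT' (by omega)
    have hlen : T.length + 3 * q.cost ≤ pp.p := by omega
    have hstep : δ + ε ≤ n * ε + (L : ℝ≥0∞) ^ 2 * coll pp N := by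
      have h1 : ((n - q.cost : ℕ) : ℝ≥0∞) + 1 ≤ n := by
        have : n - q.cost + 1 ≤ n := by omega
        exact_mod_cast this
      calc δ + ε = (((n - q.cost : ℕ) : ℝ≥0∞) + 1) * ε + (L : ℝ≥0∞) ^ 2 * coll pp N := by
            rw [hδ]; ring
        _ ≤ _ := by gcongr
    have hε₀ : δ ≤ δ + ε := le_self_add
    have hε₁ : δ + (pp.p : ℝ≥0∞)⁻¹ ≤ δ + ε := by
      gcongr
      exact le_self_add
    have hε₂ : δ + (pp.p : ℝ≥0∞)⁻¹ + (T.length : ℝ≥0∞) ^ 2 * coll pp N ≤ δ + ε := by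
      have hTL : (T.length : ℝ≥0∞) ≤ L := by
        have : T.length ≤ L := by omega
        exact_mod_cast this
      rw [add_assoc, hε]
      gcongr
    have hkN : k < N := by omega
    clear_value δ ε
    refine Sim.mono ?_ hstep
    cases q with
    | mul i x y => exact (sim_mul h i x y next hlen hn).mono hε₁
    | pow i a x => exact (sim_pow h i a x next hlen hn).mono hε₁
    | pair x y => exact (sim_pair h x y next hlen hn).mono hε₁
    | iso x => exact (sim_iso h x next hlen hn).mono hε₁
    | hash a => exact (sim_hash h hkN a next hlen hn).mono hε₀
    | flip => exact (sim_flip h next hn).mono hε₀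
    | keygen u S =>
      have : S.card ≤ N := by simp only [Query.cost] at hq; omega
      exact (sim_keygen h hkN u S next this hlen hn).mono hε₀
    | convert C u => exact (sim_convert h C u next hlen hn).mono hε₁
    | rekey RL => exact (sim_rekey h RL next hn).mono hε₀
    | challenge M₀ M₁ A RL =>
      have : A.size ≤ N := by simp only [Query.cost] at hq; omega
      exact (sim_challenge h hkN hp M₀ M₁ A RL next hlen this hn).mono hε₂

end

section

variable {pp : Params}

/-! ### The advantage of an adversary -/

/-- The outcome of the game with a fixed challenge bit. -/
noncomputable def guessDist (pp : Params) (A : PublicKey pp → Adversary pp) (b : Bool) :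
    PMF Bool :=
  (randomEncoding pp).bind fun E => (setup pp E).bind fun z =>
    (proxyRekey z.2 ∅ ∅).bind fun K =>
      play E z.2 b (A z.1) { H := fun _ => none, issued := [], pxk := K, chal := none }

theorem game_eq (A : PublicKey pp → Adversary pp) :
    game pp A = (PMF.uniformOfFintype Bool).bind fun b =>
      (guessDist pp A b).bind fun b' => PMF.pure (b' == b) := by
  simp only [guessDist, PMF.bind_bind]
  rw [PMF.bind_comm]
  refine congrArg (PMF.bind _) ?_
  funext E
  rw [PMF.bind_comm]
  refine congrArg (PMF.bind _) ?_
  funext z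
  rw [PMF.bind_comm]
  rfl

variable {N : ℕ}

/-- The symbolic state at the beginning of the game, with a proxy key for the points of `o`. -/
def Sym.initial (pp : Params) (N : ℕ) (o : Option (Finset (Identity pp))) : Sym pp N where
  H := fun _ => none
  keys := fun _ => none
  issued := []
  pxk := o
  P := id
  chal := none

theorem guessDist_apply [NeZero N] (A : PublicKey pp → Adversary pp) {n : ℕ} (hN : n ≤ N)
    (hA : ∀ pk, (A pk).CostLE n) (b c : Bool) :
    guessDist pp A b c = mean fun x : Pt pp N => mean fun ψ : Enc pp =>
      ((rekeyPoints ∅ ∅).bind fun o => cont (Sym.initial pp N o)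
        (A ⟨ψ .G1 1, ψ .G2 1, ψ .G1 x.β, ψ .GT x.α, ψ .G2 x.β⁻¹⟩) 0 b x ψ) c := by
  have h : guessDist pp A b = (PMF.uniformOfFintype (Enc pp)).bind fun ψ =>
      (PMF.uniformOfFintype (Pt pp N)).bind fun x =>
        (rekeyPoints ∅ ∅).bind fun o => cont (Sym.initial pp N o)
          (A ⟨ψ .G1 1, ψ .G2 1, ψ .G1 x.β, ψ .GT x.α, ψ .G2 x.β⁻¹⟩) 0 b x ψ := by
    rw [guessDist, randomEncoding_eq, PMF.bind_map]
    refine congrArg (PMF.bind _) (funext fun ψ => ?_)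
    simp only [uniform_prod, PMF.bind_bind, PMF.pure_bind]
    rw [PMF.bind_comm]
    refine (PMF.bind_bind _ _ _).trans (congrArg (PMF.bind _) (funext fun α => ?_))
    refine (PMF.bind_bind _ _ _).trans (congrArg (PMF.bind _) (funext fun β => ?_))
    refine (PMF.bind_bind _ _ _).trans (congrArg (PMF.bind _) (funext fun P => ?_))
    refine (PMF.pure_bind _ _).trans ?_
    rw [proxyRekey_eq, PMF.bind_map, PMF.bind_comm]
    refine congrArg (PMF.bind _) (funext fun o => ?_)
    exact play_eq (N := N) _ _ b _ 0 n (by omega) (hA _) _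
  rw [h, bind_uniform_apply]
  simp only [bind_uniform_apply]
  exact mean_comm _

variable [NeZero N]

theorem initial_inv (o : Option (Finset (Identity pp))) (ν : Bool → Pt pp N → Scalar pp) :
    Inv (Sym.initial pp N o) ν 0 [] where
  state :=
    { hash_lt := fun _ _ h => by cases h
      hash_inj := fun _ _ _ h => by cases h
      key_lt := fun _ _ h => by cases h
      key_issued := fun _ _ h => by cases h
      hash_key := fun _ _ h => by cases h
      poly_zero := fun P => by
        rw [polyEval, Finset.sum_eq_single 0]
        · simp [Sym.initial]
        · intro i _ hi
          have : (i : ℕ) ≠ 0 := fun h => hi (Fin.ext h)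
          simp [this]
        · simp
      poly_low := fun u => lowDeg_of_linear
        ⟨⟨fun y => polyEval y.2.1 u, fun _ _ => polyEval_add _ _ _⟩, fun _ _ =>
          polyEval_smul _ _ _⟩
      before := fun _ => rfl
      after := fun _ _ _ h => by cases h }
  distinct := List.Pairwise.nil
  obtainable := fun _ h => by cases h

/-- The exponents of the public key. -/
def publicElt (pp : Params) (N : ℕ) : Fin 5 → Grp × Elt (Pt pp N) pp
  | 0 => (.G1, 1, 0)
  | 1 => (.G2, 1, 0)
  | 2 => (.G1, fun x => x.β, 0)
  | 3 => (.GT, fun x => x.α, 0)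
  | 4 => (.G2, fun x => 1 * x.β⁻¹, 0)

theorem publicElt_obtainable (o : Option (Finset (Identity pp))) (j : Fin 5) :
    Obtainable (Sym.initial pp N o) 0 (publicElt pp N j).1 (publicElt pp N j).2 := by
  have h1 : (1 : Pt pp N → Scalar pp) ∈ lowDeg pp N 0 1 := lowDeg_const 1
  fin_cases j
  · exact .gen₁ (.iso (.one polyOnly_one)) (low_of_lowDeg h1 (by omega))
  · exact .gen₂ (.one polyOnly_one) (low_of_lowDeg h1 (by omega))
  · exact .gen₁ .beta (low_of_lowDeg lowDeg_β (by omega))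
  · exact ⟨Submodule.subset_span (.inr rfl), low_of_lowDeg lowDeg_α (by omega), fun _ => rfl⟩
  · refine .gen₂ (.inv polyOnly_one) ?_
    simp only [one_mul]
    exact lowDeg_mono lowDeg_invβ (by omega)

/-- The error of the symbolic execution against an adversary of cost `n`. -/
noncomputable def simError (pp : Params) (n : ℕ) : ℝ≥0∞ :=
  n * ((pp.p : ℝ≥0∞)⁻¹ + ((5 + 3 * n : ℕ) : ℝ≥0∞) ^ 2 * coll pp (n + 1)) +
    ((5 + 3 * n : ℕ) : ℝ≥0∞) ^ 2 * coll pp (n + 1)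

/-- The guess of the adversary has nearly the same distribution for both challenge bits. -/
theorem exists_guessDist_le (hp : 5000 < pp.p) (A : PublicKey pp → Adversary pp) {n : ℕ}
    (hn : 5 + 3 * n ≤ pp.p) (hA : ∀ pk, (A pk).CostLE n) :
    ∃ g : PMF Bool, ∀ b c, g c ≤ guessDist pp A b c + simError pp n := by
  let G : Option (Finset (Identity pp)) → Bool → Pt pp (n + 1) → Enc pp → PMF Bool :=
    fun o b x ψ => cont (Sym.initial pp (n + 1) o)
      (A ⟨ψ .G1 1, ψ .G2 1, ψ .G1 x.β, ψ .GT x.α, ψ .G2 x.β⁻¹⟩) 0 b x ψ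
  have hS : Sim (fun _ _ => 0) [] (fun b x ψ => (rekeyPoints ∅ ∅).bind fun o => G o b x ψ)
      (simError pp n) := by
    refine Sim.bind _ _ fun o _ => ?_
    have h := initial_inv (N := n + 1) o fun _ _ => 0
    refine (h.family (publicElt pp (n + 1)) (publicElt_obtainable o)
      (by simp only [List.length_nil, Fintype.card_fin]; omega)
      (fun w => A ⟨w 0, w 1, w 2, w 3, w 4⟩) fun w T' hT' hl => ?_).congr fun b x ψ _ => ?_
    · simp only [List.length_nil, Fintype.card_fin, zero_add] at hl
      exact sim_cont hp hn _ n (hA _) (by omega) hT' (by omega)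
    · simp only [publicElt, ev, zero_mul, add_zero, one_mul]
      rfl
  obtain ⟨g, hg⟩ := hS
  refine ⟨g, fun b c => ?_⟩
  have h := hg b c
  have hw : Table.weight ([] : Table (Pt pp (n + 1)) pp) = 1 := rfl
  rw [hw, one_mul, one_mul] at h
  refine h.trans (le_of_eq ?_)
  rw [guessDist_apply (N := n + 1) A (by omega) hA b c]
  congr 1
  refine congrArg mean (funext fun x => congrArg mean (funext fun ψ => if_pos ?_))
  intro t ht
  cases ht

theorem simError_ne_top (pp : Params) (n : ℕ) : simError pp n ≠ ⊤ := by
  have hp0 : (pp.p : ℝ≥0∞) ≠ 0 := by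
    rw [Nat.cast_ne_zero]; exact pp.prime.ne_zero
  have h1 : (pp.p : ℝ≥0∞)⁻¹ ≠ ⊤ := ENNReal.inv_ne_top.2 hp0
  have h2 : coll pp (n + 1) ≠ ⊤ := ENNReal.mul_ne_top (ENNReal.natCast_ne_top _) h1
  have h3 : ((5 + 3 * n : ℕ) : ℝ≥0∞) ^ 2 * coll pp (n + 1) ≠ ⊤ :=
    ENNReal.mul_ne_top (ENNReal.pow_ne_top (ENNReal.natCast_ne_top _)) h2
  exact ENNReal.add_ne_top.2
    ⟨ENNReal.mul_ne_top (ENNReal.natCast_ne_top _) (ENNReal.add_ne_top.2 ⟨h1, h3⟩), h3⟩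

open Polynomial in
/-- The error of the symbolic execution, multiplied by `p`. -/
noncomputable def errorPoly : ℝ[X] :=
  X * (1 + (5 + 3 * X) ^ 2 * (4 * (2 * (X + 1 + 4)))) + (5 + 3 * X) ^ 2 * (4 * (2 * (X + 1 + 4)))

theorem simError_toReal (pp : Params) (n : ℕ) :
    (simError pp n).toReal = errorPoly.eval (n : ℝ) * (pp.p : ℝ)⁻¹ := by
  have hp0 : (pp.p : ℝ≥0∞) ≠ 0 := by
    rw [Nat.cast_ne_zero]; exact pp.prime.ne_zero
  have h1 : (pp.p : ℝ≥0∞)⁻¹ ≠ ⊤ := ENNReal.inv_ne_top.2 hp0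
  have h2 : coll pp (n + 1) ≠ ⊤ := ENNReal.mul_ne_top (ENNReal.natCast_ne_top _) h1
  have h3 : ((5 + 3 * n : ℕ) : ℝ≥0∞) ^ 2 * coll pp (n + 1) ≠ ⊤ :=
    ENNReal.mul_ne_top (ENNReal.pow_ne_top (ENNReal.natCast_ne_top _)) h2
  rw [simError, ENNReal.toReal_add (ENNReal.mul_ne_top (ENNReal.natCast_ne_top _)
    (ENNReal.add_ne_top.2 ⟨h1, h3⟩)) h3, ENNReal.toReal_mul, ENNReal.toReal_add h1 h3]
  simp only [coll, ENNReal.toReal_mul, ENNReal.toReal_pow, ENNReal.toReal_natCast,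
    ENNReal.toReal_inv, errorPoly]
  simp
  ring

/-- The advantage is at most the error of the symbolic execution. -/
theorem abs_advantage_le (hp : 5000 < pp.p) (A : PublicKey pp → Adversary pp) {n : ℕ}
    (hn : 5 + 3 * n ≤ pp.p) (hA : ∀ pk, (A pk).CostLE n) :
    |advantage pp A| ≤ errorPoly.eval (n : ℝ) * (pp.p : ℝ)⁻¹ := by
  obtain ⟨g, hg⟩ := exists_guessDist_le hp A hn hA
  rw [← simError_toReal]
  have hsum : ∀ μ : PMF Bool, (μ true).toReal + (μ false).toReal = 1 := by
    intro μ
    rw [← ENNReal.toReal_add (μ.apply_ne_top _) (μ.apply_ne_top _)]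
    have := μ.tsum_coe
    rw [tsum_bool, add_comm] at this
    rw [this, ENNReal.toReal_one]
  have hle : ∀ b c, (g c).toReal ≤ (guessDist pp A b c).toReal + (simError pp n).toReal := by
    intro b c
    rw [← ENNReal.toReal_add (PMF.apply_ne_top _ _) (simError_ne_top pp n)]
    exact ENNReal.toReal_mono (ENNReal.add_ne_top.2 ⟨PMF.apply_ne_top _ _, simError_ne_top pp n⟩)
      (hg b c)
  have hgame : (game pp A true).toReal =
      ((guessDist pp A true true).toReal + (guessDist pp A false false).toReal) / 2 := by
    have h1 : ∀ b, ((guessDist pp A b).bind fun b' => PMF.pure (b' == b)) true =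
        guessDist pp A b b := by
      intro b
      rw [PMF.bind_apply, tsum_bool]
      cases b <;> simp [PMF.pure_apply]
    rw [game_eq, PMF.bind_apply, tsum_bool]
    simp only [h1, PMF.uniformOfFintype_apply, Fintype.card_bool]
    rw [ENNReal.toReal_add (ENNReal.mul_ne_top (by simp) (PMF.apply_ne_top _ _))
      (ENNReal.mul_ne_top (by simp) (PMF.apply_ne_top _ _))]
    simp only [ENNReal.toReal_mul, ENNReal.toReal_inv, ENNReal.toReal_natCast]
    push_cast
    ring
  have h1 := hsum g
  have h2 := hsum (guessDist pp A true)
  have h3 := hsum (guessDist pp A false)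
  have h4 := hle true true
  have h5 := hle true false
  have h6 := hle false true
  have h7 := hle false false
  rw [advantage, hgame, abs_le]
  constructor <;> linarith

end

end Piratte

theorem theorem1 (pp : ℕ → Piratte.Params)
    (hp : Piratte.Negligible fun n => ((pp n).p : ℝ)⁻¹)
    (A : ∀ n, Piratte.PublicKey (pp n) → Piratte.Adversary (pp n))
    (hA : Piratte.PolyCost A) :
    Piratte.Negligible fun n => Piratte.advantage (pp n) (A n) := by
  obtain ⟨c, hc⟩ := hA
  let c' : Polynomial ℝ := c.map (Nat.castRingHom ℝ)
  have hc' : ∀ n : ℕ, c'.eval (n : ℝ) = (c.eval n : ℕ) := fun n =>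
    Polynomial.eval_natCast_map _ c n
  have hdecay : ∀ R : Polynomial ℝ, Piratte.Negligible fun n =>
      R.eval ((c.eval n : ℕ) : ℝ) * ((pp n).p : ℝ)⁻¹ := by
    intro R
    have := hp.polynomial_mul (R.comp c')
    simp only [Polynomial.eval_comp, hc'] at this
    exact this
  have hlarge : ∀ᶠ n in Filter.atTop, 5000 + 5 + 3 * c.eval n < (pp n).p := by
    have h := hdecay (5000 + 5 + 3 * Polynomial.X) 0
    simp only [pow_zero, one_mul] at h
    filter_upwards [h.eventually_lt_const one_pos] with n hn
    have hp0 : (0 : ℝ) < (pp n).p := by exact_mod_cast (pp n).prime.pos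
    rw [← div_eq_mul_inv, div_lt_one hp0] at hn
    simp at hn
    exact_mod_cast hn
  refine Asymptotics.SuperpolynomialDecay.trans_eventually_abs_le (hdecay Piratte.errorPoly) ?_
  filter_upwards [hlarge] with n hn
  refine (Piratte.abs_advantage_le (by omega) (A n) (by omega) (hc n)).trans (le_abs_self _)
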